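/- Let $\mathbb D$ be the open unit disk, $dA$ the normalized Lebesgue measure on $\mathbb D$, $H(\mathbb D)$ the space of analytic functions on $\mathbb D$, and $\hat f(n)$ the Taylor coefficients of $f\in H(\mathbb D)$ at $0$. For a positive function $w$ on $[0,1)$ let $\mathfrak B_w$ be the space of all $f\in H(\mathbb D)$ with $|f'(z)|=O\big((1-|z|)^{-1}w(|z|)\big)$ on $\mathbb D$, normed by $|f(0)|+\sup_{z\in\mathbb D}(1-|z|)\,w(|z|)^{-1}|f'(z)|$; let $\mathfrak b_w$ be its subspace of those $f$ with $|f'(z)|=o\big((1-|z|)^{-1}w(|z|)\big)$ as $|z|\uparrow 1$; and let $\mathfrak B^1_w$ be the space of all $f\in H(\mathbb D)$ with $\|f\|=|f(0)|+\int_{\mathbb D}|f'(z)|\,w(|z|)\,dA(z)<\infty$. The index $\log^\alpha$ ($\alpha\in\mathbb R$) stands for $w(r)=\log^\alpha\frac{2}{1-r}$, and the index $\mathrm{logg}$ for $w(r)=\log\log\frac{4}{1-r}$. Let $$\langle f,g\rangle=\lim_{r\uparrow1}\sum_{n=0}^\infty\hat f(n)\hat g(n)r^{2n}$$ be the Abel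 pairing, and put $$\mathcal Cf(z)=\sum_{n=0}^\infty\Big(\frac1{n+1}\sum_{k=0}^n\hat f(k)\Big)z^n,\qquad \Lambda f(z)=\sum_{n=0}^\infty\Big(\sum_{k=n}^\infty\frac{\hat f(k)}{k+1}\Big)z^n,$$ where $\Lambda f$ is defined when $\sum_{k}|\hat f(k)|/(k+1)<\infty$. For spaces $X,X',Y,Y'$ of analytic functions, "the adjoint (with respect to the pairing) of $T:X\to Y$ is $S:Y'\to X'$" means: $T:X\to Y$ and $S:Y'\to X'$ are well-defined bounded linear operators; the limits $\langle f,g\rangle$ exist for all $(f,g)\in X\times X'$ and all $(f,g)\in Y\times Y'$; $g\mapsto\langle\cdot,g\rangle$ is a linear homeomorphism of $X'$ onto the Banach dual $X^*$ and of $Y'$ onto $Y^*$; and under these identifications the Banach-space adjoint $T^*:Y^*\to X^*$ is $S$, that is, $\langle Tf,g\rangle=\langle f,Sg\rangle$ for all $f\in X$, $g\in Y'$. **Theorem.** Let $\alpha>0$. Then $\Lambda$ is well defined on $\mathfrak B^1_{\log^\alpha}$, the adjoint of $\Lambda:\mathfrak B^1_{\log^\alpha}\to\mathfrak B^1_{\log^{\alpha-1}}$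 is $\mathcal C:\mathfrak B_{\log^{\alpha-1}}\to\mathfrak B_{\log^\alpha}$, and the adjoint of $\mathcal C:\mathfrak b_{\log^{\alpha-1}}\to\mathfrak b_{\log^\alpha}$ is $\Lambda:\mathfrak B^1_{\log^\alpha}\to\mathfrak B^1_{\log^{\alpha-1}}$. For $\alpha=0$: $\Lambda$ is well defined on $\mathfrak B^1_{\mathrm{logg}}$, the adjoint of $\Lambda:\mathfrak B^1_{\mathrm{logg}}\to\mathfrak B^1_{\log^{-1}}$ is $\mathcal C:\mathfrak B_{\log^{-1}}\to\mathfrak B_{\mathrm{logg}}$, and the adjoint of $\mathcal C:\mathfrak b_{\log^{-1}}\to\mathfrak b_{\mathrm{logg}}$ is $\Lambda:\mathfrak B^1_{\mathrm{logg}}\to\mathfrak B^1_{\log^{-1}}$. -/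

import Mathlib

open Filter Topology MeasureTheory Metric Asymptotics

noncomputable section

namespace LogBloch

/-- The space `H(𝔻)` of functions analytic in the open unit disk; a function on the disk is
represented by its extension by zero to the plane, so that two elements are equal exactly when
they agree on the disk. -/
def holDisk : Submodule ℂ (ℂ → ℂ) where
  carrier := {f | DifferentiableOn ℂ f (ball 0 1) ∧ ∀ z ∉ ball (0 : ℂ) 1, f z = 0}
  add_mem' := by
    rintro f g ⟨hf, hf0⟩ ⟨hg, hg0⟩
    exact ⟨hf.add hg, fun z hz => by simp [hf0 z hz, hg0 z hz]⟩
  zero_mem' := ⟨differentiableOn_const 0, fun _ _ => rfl⟩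
  smul_mem' := by
    rintro c f ⟨hf, hf0⟩
    exact ⟨hf.const_smul c, fun z hz => by simp [hf0 z hz]⟩

/-- The Taylor coefficient `f̂(n)` at the origin. -/
def coeff (f : ℂ → ℂ) (n : ℕ) : ℂ := iteratedDeriv n f 0 / (n.factorial : ℂ)

/-- The expression `∑ f̂(n) ĝ(n) r^{2n}`, whose limit as `r ↑ 1` is the Abel pairing. -/
def abelMean (f g : ℂ → ℂ) (r : ℝ) : ℂ := ∑' n : ℕ, coeff f n * coeff g n * (r : ℂ) ^ (2 * n)

/-- `⟨f, g⟩` exists and equals `L`, where `⟨f, g⟩ = lim_{r ↑ 1} ∑ f̂(n) ĝ(n) r^{2n}`. -/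
def HasAbelPairing (f g : ℂ → ℂ) (L : ℂ) : Prop :=
  Tendsto (abelMean f g) (𝓝[<] (1 : ℝ)) (𝓝 L)

/-- The Cesàro operator. -/
def cesaro (f : ℂ → ℂ) : ℂ → ℂ :=
  (ball (0 : ℂ) 1).indicator fun z =>
    ∑' n : ℕ, (1 / ((n : ℂ) + 1) * ∑ k ∈ Finset.range (n + 1), coeff f k) * z ^ n

/-- The condition `∑ |f̂(n)| / (n + 1) < ∞` under which the Libera transform is defined. -/
def LiberaDefined (f : ℂ → ℂ) : Prop := Summable fun n : ℕ => ‖coeff f n‖ / ((n : ℝ) + 1)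

/-- The Libera operator: the coefficient of `z ^ n` is `∑_{k ≥ n} f̂(k) / (k + 1)`,
here written with `k = n + j`. -/
def libera (f : ℂ → ℂ) : ℂ → ℂ :=
  (ball (0 : ℂ) 1).indicator fun z =>
    ∑' n : ℕ, (∑' j : ℕ, coeff f (n + j) / (((n + j : ℕ) : ℂ) + 1)) * z ^ n

/-- A measurable function of `r = |z|` that is positive on `[0, 1)`. -/
structure Weight where
  toFun : ℝ → ℝ
  measurable : Measurable toFun
  pos : ∀ r, 0 ≤ r → r < 1 → 0 < toFun r

instance : CoeFun Weight (fun _ => ℝ → ℝ) := ⟨Weight.toFun⟩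

/-- The weight `log^α (2 / (1 - r))`. -/
def logWeight (α : ℝ) : Weight where
  toFun r := Real.log (2 / (1 - r)) ^ α
  measurable := by fun_prop
  pos r h0 h1 := by
    have h : (1 : ℝ) < 2 / (1 - r) := by
      rw [lt_div_iff₀ (by linarith)]; linarith
    exact Real.rpow_pos_of_pos (Real.log_pos h) α

/-- The weight `log log (4 / (1 - r))`. -/
def loglogWeight : Weight where
  toFun r := Real.log (Real.log (4 / (1 - r)))
  measurable := by fun_prop
  pos r h0 h1 := by
    have h : (4 : ℝ) ≤ 4 / (1 - r) := by
      rw [le_div_iff₀ (by linarith)]; linarith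
    have h4 : Real.exp 1 < 4 / (1 - r) := by
      have := Real.exp_one_lt_d9
      linarith
    refine Real.log_pos ?_
    rwa [Real.lt_log_iff_exp_lt (by linarith)]

theorem deriv_add_ball {f g : ℂ → ℂ} (hf : f ∈ holDisk) (hg : g ∈ holDisk) {z : ℂ}
    (hz : z ∈ ball (0 : ℂ) 1) : deriv (f + g) z = deriv f z + deriv g z :=
  deriv_add (hf.1.differentiableAt (isOpen_ball.mem_nhds hz))
    (hg.1.differentiableAt (isOpen_ball.mem_nhds hz))

theorem deriv_smul_ball {f : ℂ → ℂ} (hf : f ∈ holDisk) (c : ℂ) {z : ℂ}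
    (hz : z ∈ ball (0 : ℂ) 1) : deriv (c • f) z = c * deriv f z := by
  rw [deriv_const_smul c (hf.1.differentiableAt (isOpen_ball.mem_nhds hz)), smul_eq_mul]

/-- A function of `H(𝔻)` vanishing at the origin whose derivative vanishes is zero. -/
theorem eq_zero_of_deriv {f : ℂ → ℂ} (hf : f ∈ holDisk) (h0 : f 0 = 0)
    (hd : ∀ z ∈ ball (0 : ℂ) 1, deriv f z = 0) : f = 0 := by
  funext z
  by_cases hz : z ∈ ball (0 : ℂ) 1
  · have := isOpen_ball.is_const_of_deriv_eq_zero (convex_ball (0 : ℂ) 1).isPreconnected hf.1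
      hd hz (mem_ball_self one_pos)
    simpa [h0] using this
  · exact hf.2 z hz

/-! ### The spaces `𝔅_w` and `𝔟_w` -/

/-- The functions `f ∈ H(𝔻)` with `|f'(z)| = O((1 - |z|)⁻¹ w(|z|))` on `𝔻`. -/
def blochSubmodule (w : Weight) : Submodule ℂ (ℂ → ℂ) where
  carrier := {f | f ∈ holDisk ∧
    deriv f =O[𝓟 (ball (0 : ℂ) 1)] fun z => (1 - ‖z‖)⁻¹ * w ‖z‖}
  add_mem' := by
    rintro f g ⟨hf, hfO⟩ ⟨hg, hgO⟩
    refine ⟨add_mem hf hg, (hfO.add hgO).congr' ?_ EventuallyEq.rfl⟩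
    filter_upwards [mem_principal_self _] with z hz
    exact (deriv_add_ball hf hg hz).symm
  zero_mem' := by
    refine ⟨zero_mem _, ?_⟩
    have : deriv (0 : ℂ → ℂ) = fun _ => 0 := by funext z; exact deriv_const z 0
    rw [this]
    exact isBigO_zero _ _
  smul_mem' := by
    rintro c f ⟨hf, hfO⟩
    refine ⟨Submodule.smul_mem _ c hf, (hfO.const_mul_left c).congr' ?_ EventuallyEq.rfl⟩
    filter_upwards [mem_principal_self _] with z hz
    exact (deriv_smul_ball hf c hz).symm

/-- The Bloch type space `𝔅_w`. -/
def Bloch (w : Weight) : Type := ↥(blochSubmodule w)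

namespace Bloch

variable {w : Weight}

instance : AddCommGroup (Bloch w) := inferInstanceAs (AddCommGroup ↥(blochSubmodule w))

instance : Module ℂ (Bloch w) := inferInstanceAs (Module ℂ ↥(blochSubmodule w))

/-- The underlying function. -/
def fn (f : Bloch w) : ℂ → ℂ := f.1

/-- `(1 - |z|) w(|z|)⁻¹ |f'(z)|`. -/
def density (f : Bloch w) (z : ball (0 : ℂ) 1) : ℝ :=
  (1 - ‖(z : ℂ)‖) * (w ‖(z : ℂ)‖)⁻¹ * ‖deriv f.fn z‖

theorem factor_pos (w : Weight) (z : ball (0 : ℂ) 1) :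
    0 < (1 - ‖(z : ℂ)‖) * (w ‖(z : ℂ)‖)⁻¹ := by
  have hz : ‖(z : ℂ)‖ < 1 := mem_ball_zero_iff.1 z.2
  exact mul_pos (by linarith) (inv_pos.2 (w.pos _ (norm_nonneg _) hz))

theorem density_nonneg (f : Bloch w) (z : ball (0 : ℂ) 1) : 0 ≤ f.density z :=
  mul_nonneg (factor_pos w z).le (norm_nonneg _)

theorem bddAbove_density (f : Bloch w) : BddAbove (Set.range f.density) := by
  obtain ⟨C, hC⟩ := f.2.2.bound
  refine ⟨C, ?_⟩
  rintro _ ⟨z, rfl⟩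
  have h : ‖deriv f.fn z‖ ≤ C * ‖(1 - ‖(z : ℂ)‖)⁻¹ * w ‖(z : ℂ)‖‖ := hC z.2
  have hz : ‖(z : ℂ)‖ < 1 := mem_ball_zero_iff.1 z.2
  have hw := w.pos _ (norm_nonneg _) hz
  have h1 : 0 < 1 - ‖(z : ℂ)‖ := by linarith
  have h2 : 0 < (1 - ‖(z : ℂ)‖)⁻¹ * w ‖(z : ℂ)‖ := mul_pos (inv_pos.2 h1) hw
  rw [Real.norm_of_nonneg h2.le] at h
  calc f.density z ≤ (1 - ‖(z : ℂ)‖) * (w ‖(z : ℂ)‖)⁻¹ *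
        (C * ((1 - ‖(z : ℂ)‖)⁻¹ * w ‖(z : ℂ)‖)) :=
        mul_le_mul_of_nonneg_left h (factor_pos w z).le
    _ = C := by field_simp

/-- The norm `|f(0)| + sup_{z ∈ 𝔻} (1 - |z|) w(|z|)⁻¹ |f'(z)|`. -/
def groupNorm (w : Weight) : AddGroupNorm (Bloch w) where
  toFun f := ‖f.fn 0‖ + ⨆ z, f.density z
  map_zero' := by
    have h0 : (0 : Bloch w).fn = fun _ => 0 := rfl
    simp [density, h0]
  add_le' f g := by
    have : Nonempty (ball (0 : ℂ) 1) := ⟨⟨0, mem_ball_self one_pos⟩⟩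
    have h1 : ‖(f + g).fn 0‖ ≤ ‖f.fn 0‖ + ‖g.fn 0‖ := norm_add_le _ _
    have h2 : (⨆ z, (f + g).density z) ≤ (⨆ z, f.density z) + ⨆ z, g.density z := by
      refine ciSup_le fun z => ?_
      have h3 : (f + g).density z ≤ f.density z + g.density z := by
        have : deriv (f + g).fn z = deriv f.fn z + deriv g.fn z :=
          deriv_add_ball f.2.1 g.2.1 z.2
        unfold density
        rw [this, ← mul_add]
        exact mul_le_mul_of_nonneg_left (norm_add_le _ _) (factor_pos w z).le
      exact h3.trans (add_le_add (le_ciSup f.bddAbove_density z) (le_ciSup g.bddAbove_density z))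
    linarith
  neg' f := by
    have h0 : (-f).fn = -f.fn := rfl
    have h1 : (-f).density = f.density := by
      funext z
      unfold density
      rw [h0, deriv.neg, norm_neg]
    rw [h1, h0, Pi.neg_apply, norm_neg]
  eq_zero_of_map_eq_zero' f h := by
    have h1 : 0 ≤ ⨆ z, f.density z := Real.iSup_nonneg f.density_nonneg
    have h2 : ‖f.fn 0‖ = 0 := by
      have := norm_nonneg (f.fn 0)
      linarith
    have h3 : (⨆ z, f.density z) = 0 := by
      linarith
    refine Subtype.ext (eq_zero_of_deriv f.2.1 (norm_eq_zero.1 h2) fun z hz => ?_)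
    have h4 : f.density ⟨z, hz⟩ ≤ 0 := h3 ▸ le_ciSup f.bddAbove_density ⟨z, hz⟩
    have h5 := factor_pos w ⟨z, hz⟩
    have h6 : ‖deriv f.fn z‖ ≤ 0 := by
      by_contra h7
      exact absurd h4 (not_le.2 (mul_pos h5 (not_le.1 h7)))
    exact norm_le_zero_iff.1 h6

instance : NormedAddCommGroup (Bloch w) := (groupNorm w).toNormedAddCommGroup

theorem norm_def (f : Bloch w) :
    ‖f‖ = ‖f.fn 0‖ + ⨆ z : ball (0 : ℂ) 1,
      (1 - ‖(z : ℂ)‖) * (w ‖(z : ℂ)‖)⁻¹ * ‖deriv f.fn z‖ := rfl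

instance : NormedSpace ℂ (Bloch w) where
  norm_smul_le c f := by
    have h0 : (c • f).fn 0 = c * f.fn 0 := rfl
    have h1 : (c • f).density = fun z => ‖c‖ * f.density z := by
      funext z
      have : deriv (c • f).fn z = c * deriv f.fn z := deriv_smul_ball f.2.1 c z.2
      unfold density
      rw [this, norm_mul]
      ring
    change ‖(c • f).fn 0‖ + (⨆ z, (c • f).density z) ≤ ‖c‖ * (‖f.fn 0‖ + ⨆ z, f.density z)
    rw [h0, h1, norm_mul, mul_add, Real.mul_iSup_of_nonneg (norm_nonneg c)]

end Bloch

/-- The little Bloch type space `𝔟_w`, a normed subspace of `𝔅_w`: the functions with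
`|f'(z)| = o((1 - |z|)⁻¹ w(|z|))` as `|z| ↑ 1`. -/
def littleBloch (w : Weight) : Submodule ℂ (Bloch w) where
  carrier := {f | deriv f.fn =o[comap (fun z : ℂ => ‖z‖) (𝓝[<] (1 : ℝ))]
    fun z => (1 - ‖z‖)⁻¹ * w ‖z‖}
  add_mem' := by
    intro f g hf hg
    refine (hf.add hg).congr' ?_ EventuallyEq.rfl
    filter_upwards [preimage_mem_comap (self_mem_nhdsWithin (a := (1 : ℝ)))] with z hz
    exact (deriv_add_ball f.2.1 g.2.1 (mem_ball_zero_iff.2 hz)).symm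
  zero_mem' := by
    have : deriv (0 : Bloch w).fn = fun _ => 0 := by funext z; exact deriv_const z 0
    change deriv (0 : Bloch w).fn =o[_] _
    rw [this]
    exact isLittleO_zero _ _
  smul_mem' := by
    intro c f hf
    refine (IsLittleO.const_mul_left hf c).congr' ?_ EventuallyEq.rfl
    filter_upwards [preimage_mem_comap (self_mem_nhdsWithin (a := (1 : ℝ)))] with z hz
    exact (deriv_smul_ball f.2.1 c (mem_ball_zero_iff.2 hz)).symm

/-- The little Bloch type space as a normed space, with the norm of `𝔅_w`. -/
abbrev LittleBloch (w : Weight) : Type := ↥(littleBloch w)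

/-- The underlying function. -/
def LittleBloch.fn {w : Weight} (f : LittleBloch w) : ℂ → ℂ := Bloch.fn f.1

/-! ### The space `𝔅¹_w` -/

/-- The functions `f ∈ H(𝔻)` with `∫_𝔻 |f'(z)| w(|z|) dA(z) < ∞`. -/
def bloch1Submodule (w : Weight) : Submodule ℂ (ℂ → ℂ) where
  carrier := {f | f ∈ holDisk ∧ IntegrableOn (fun z => ‖deriv f z‖ * w ‖z‖) (ball (0 : ℂ) 1)}
  add_mem' := by
    rintro f g ⟨hf, hfI⟩ ⟨hg, hgI⟩
    refine ⟨add_mem hf hg, (hfI.add hgI).mono' ?_ ?_⟩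
    · exact (((measurable_deriv _).norm).mul
        (w.measurable.comp measurable_norm)).aestronglyMeasurable
    · filter_upwards [ae_restrict_mem measurableSet_ball] with z hz
      have hw := w.pos _ (norm_nonneg z) (mem_ball_zero_iff.1 hz)
      rw [deriv_add_ball hf hg hz, Real.norm_of_nonneg (by positivity), Pi.add_apply, ← add_mul]
      exact mul_le_mul_of_nonneg_right (norm_add_le _ _) hw.le
  zero_mem' := by
    refine ⟨zero_mem _, ?_⟩
    have : deriv (0 : ℂ → ℂ) = fun _ => 0 := by funext z; exact deriv_const z 0
    simp [this]
  smul_mem' := by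
    rintro c f ⟨hf, hfI⟩
    refine ⟨Submodule.smul_mem _ c hf, (hfI.const_mul ‖c‖).congr ?_⟩
    filter_upwards [ae_restrict_mem measurableSet_ball] with z hz
    rw [deriv_smul_ball hf c hz, norm_mul, mul_assoc]

/-- The space `𝔅¹_w`. -/
def Bloch1 (w : Weight) : Type := ↥(bloch1Submodule w)

namespace Bloch1

variable {w : Weight}

instance : AddCommGroup (Bloch1 w) := inferInstanceAs (AddCommGroup ↥(bloch1Submodule w))

instance : Module ℂ (Bloch1 w) := inferInstanceAs (Module ℂ ↥(bloch1Submodule w))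

/-- The underlying function. -/
def fn (f : Bloch1 w) : ℂ → ℂ := f.1

/-- `∫_𝔻 |f'(z)| w(|z|) dA(z)`, with `dA` the normalized Lebesgue measure on `𝔻`. -/
def energy (f : Bloch1 w) : ℝ :=
  Real.pi⁻¹ * ∫ z in ball (0 : ℂ) 1, ‖deriv f.fn z‖ * w ‖z‖

theorem energy_nonneg (f : Bloch1 w) : 0 ≤ f.energy := by
  refine mul_nonneg (inv_nonneg.2 Real.pi_pos.le) (setIntegral_nonneg measurableSet_ball ?_)
  intro z hz
  exact mul_nonneg (norm_nonneg _) (w.pos _ (norm_nonneg z) (mem_ball_zero_iff.1 hz)).le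

theorem energy_add_le (f g : Bloch1 w) : (f + g).energy ≤ f.energy + g.energy := by
  have hf : IntegrableOn (fun z => ‖deriv f.fn z‖ * w ‖z‖) (ball (0 : ℂ) 1) := f.2.2
  have hg : IntegrableOn (fun z => ‖deriv g.fn z‖ * w ‖z‖) (ball (0 : ℂ) 1) := g.2.2
  unfold energy
  rw [← mul_add, ← integral_add hf hg]
  refine mul_le_mul_of_nonneg_left ?_ (inv_nonneg.2 Real.pi_pos.le)
  refine setIntegral_mono_on (f + g).2.2 (hf.add hg) measurableSet_ball ?_
  intro z hz
  have hw := w.pos _ (norm_nonneg z) (mem_ball_zero_iff.1 hz)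
  have : deriv (f + g).fn z = deriv f.fn z + deriv g.fn z := deriv_add_ball f.2.1 g.2.1 hz
  rw [this, ← add_mul]
  exact mul_le_mul_of_nonneg_right (norm_add_le _ _) hw.le

theorem energy_smul (c : ℂ) (f : Bloch1 w) : (c • f).energy = ‖c‖ * f.energy := by
  have h : ∫ z in ball (0 : ℂ) 1, ‖deriv (c • f).fn z‖ * w ‖z‖ =
      ∫ z in ball (0 : ℂ) 1, ‖c‖ * (‖deriv f.fn z‖ * w ‖z‖) := by
    refine setIntegral_congr_fun measurableSet_ball fun z hz => ?_
    have : deriv (c • f).fn z = c * deriv f.fn z := deriv_smul_ball f.2.1 c hz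
    rw [this, norm_mul, mul_assoc]
  unfold energy
  rw [h, integral_const_mul, mul_left_comm]

theorem deriv_eq_zero_of_energy (f : Bloch1 w) (h : f.energy = 0) (z : ℂ)
    (hz : z ∈ ball (0 : ℂ) 1) : deriv f.fn z = 0 := by
  have h1 : ∫ z in ball (0 : ℂ) 1, ‖deriv f.fn z‖ * w ‖z‖ = 0 := by
    have := mul_eq_zero.1 h
    exact this.resolve_left (inv_ne_zero Real.pi_ne_zero)
  have h2 := (setIntegral_eq_zero_iff_of_nonneg_ae (by
    filter_upwards [ae_restrict_mem (measurableSet_ball (x := (0 : ℂ)) (ε := 1))] with z hz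
    exact mul_nonneg (norm_nonneg _)
      (w.pos _ (norm_nonneg z) (mem_ball_zero_iff.1 hz)).le) f.2.2).1 h1
  have h3 : deriv f.fn =ᵐ[volume.restrict (ball (0 : ℂ) 1)] fun _ => 0 := by
    filter_upwards [h2, ae_restrict_mem measurableSet_ball] with z h4 hz
    have hw := w.pos _ (norm_nonneg z) (mem_ball_zero_iff.1 hz)
    exact norm_eq_zero.1 ((mul_eq_zero.1 h4).resolve_right hw.ne')
  have hc : ContinuousOn (deriv f.fn) (ball (0 : ℂ) 1) :=
    (DifferentiableOn.deriv f.2.1.1 isOpen_ball).continuousOn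
  exact Measure.eqOn_open_of_ae_eq h3 isOpen_ball hc continuousOn_const hz

/-- The norm `|f(0)| + ∫_𝔻 |f'(z)| w(|z|) dA(z)`. -/
def groupNorm (w : Weight) : AddGroupNorm (Bloch1 w) where
  toFun f := ‖f.fn 0‖ + f.energy
  map_zero' := by
    have h : (0 : Bloch1 w).energy = 0 := by
      simpa using energy_smul (0 : ℂ) (0 : Bloch1 w)
    have h0 : (0 : Bloch1 w).fn 0 = 0 := rfl
    rw [h, h0, norm_zero, add_zero]
  add_le' f g := by
    have h1 : ‖(f + g).fn 0‖ ≤ ‖f.fn 0‖ + ‖g.fn 0‖ := norm_add_le _ _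
    have h2 := energy_add_le f g
    linarith
  neg' f := by
    have h1 : (-f).energy = f.energy := by
      simpa using energy_smul (-1 : ℂ) f
    have h0 : (-f).fn 0 = -f.fn 0 := rfl
    rw [h1, h0, norm_neg]
  eq_zero_of_map_eq_zero' f h := by
    have h1 := f.energy_nonneg
    have h2 := norm_nonneg (f.fn 0)
    have h3 : ‖f.fn 0‖ = 0 := by linarith
    exact Subtype.ext (eq_zero_of_deriv f.2.1 (norm_eq_zero.1 h3)
      (f.deriv_eq_zero_of_energy (by linarith)))

instance : NormedAddCommGroup (Bloch1 w) := (groupNorm w).toNormedAddCommGroup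

theorem norm_def (f : Bloch1 w) :
    ‖f‖ = ‖f.fn 0‖ + Real.pi⁻¹ * ∫ z in ball (0 : ℂ) 1, ‖deriv f.fn z‖ * w ‖z‖ := rfl

instance : NormedSpace ℂ (Bloch1 w) where
  norm_smul_le c f := by
    have h0 : (c • f).fn 0 = c * f.fn 0 := rfl
    change ‖(c • f).fn 0‖ + (c • f).energy ≤ ‖c‖ * (‖f.fn 0‖ + f.energy)
    rw [h0, energy_smul, norm_mul, mul_add]

end Bloch1

/-! ### Duality and adjoints under the Abel pairing

In the next definitions `X`, `Y`, … are normed spaces of analytic functions and the maps `eX`,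
`eY`, … send an element to the function that it is. -/

section Duality

variable {X X' Y Y' : Type} [NormedAddCommGroup X] [NormedSpace ℂ X]
  [NormedAddCommGroup X'] [NormedSpace ℂ X'] [NormedAddCommGroup Y] [NormedSpace ℂ Y]
  [NormedAddCommGroup Y'] [NormedSpace ℂ Y']

/-- The isomorphism `J` of `X'` onto the dual of `X` is the one given by the Abel pairing: for all
`f ∈ X` and `g ∈ X'` the limit `⟨f, g⟩` exists and is the value at `f` of the functional `J g`. -/
def IsPairingIso (eX : X → ℂ → ℂ) (eX' : X' → ℂ → ℂ) (J : X' ≃L[ℂ] StrongDual ℂ X) : Prop :=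
  ∀ (f : X) (g : X'), HasAbelPairing (eX f) (eX' g) (J g f)

/-- The formula `A` defines a bounded operator `T : X → Y`, the formula `B` defines a bounded
operator `S : Y' → X'`, the duals of `X` and `Y` are isomorphic to `X'` and `Y'` under the Abel
pairing, and under these identifications the adjoint `Φ ↦ Φ ∘ T` of `T`, from the dual of `Y` to
the dual of `X`, is `S`. -/
def IsPairingAdjoint (eX : X → ℂ → ℂ) (eX' : X' → ℂ → ℂ) (eY : Y → ℂ → ℂ) (eY' : Y' → ℂ → ℂ)
    (A B : (ℂ → ℂ) → ℂ → ℂ) : Prop :=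
  ∃ (T : X →L[ℂ] Y) (S : Y' →L[ℂ] X')
    (JX : X' ≃L[ℂ] StrongDual ℂ X) (JY : Y' ≃L[ℂ] StrongDual ℂ Y),
    (∀ f, eY (T f) = A (eX f)) ∧ (∀ g, eX' (S g) = B (eY' g)) ∧
    IsPairingIso eX eX' JX ∧ IsPairingIso eY eY' JY ∧
    ∀ g : Y', (JY g).comp T = JX (S g)

end Duality

/-- The operator `Λ` is well defined on `𝔅¹_v`, and the adjoint of `Λ : 𝔅¹_v → 𝔅¹_w` under the
Abel pairing is `𝒞 : 𝔅_w → 𝔅_v`. -/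
def AdjointOfLibera (v w : Weight) : Prop :=
  (∀ f : Bloch1 v, LiberaDefined f.fn) ∧
  IsPairingAdjoint (X := Bloch1 v) (X' := Bloch v) (Y := Bloch1 w) (Y' := Bloch w)
    Bloch1.fn Bloch.fn Bloch1.fn Bloch.fn libera cesaro

/-- The operator `Λ` is well defined on `𝔅¹_v`, and the adjoint of `𝒞 : 𝔟_w → 𝔟_v` under the
Abel pairing is `Λ : 𝔅¹_v → 𝔅¹_w`. -/
def AdjointOfCesaro (w v : Weight) : Prop :=
  (∀ f : Bloch1 v, LiberaDefined f.fn) ∧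
  IsPairingAdjoint (X := LittleBloch w) (X' := Bloch1 w) (Y := LittleBloch v) (Y' := Bloch1 v)
    LittleBloch.fn Bloch1.fn LittleBloch.fn Bloch1.fn cesaro libera

end LogBloch

end

noncomputable section

namespace LogBloch

/-! ### Power series on the unit disk -/

/-! The proof rests on two dualities under the Abel pairing, valid for every slowly varying weight
`w` (`IsSlow`): the dual of 𝔅¹_w is 𝔅_w (`IsSlow.exists_dual_bloch1`) and the dual of 𝔟_w is 𝔅¹_w
(`IsSlow.exists_dual_littleBloch`).

The pairing is bounded because of an area formula: with K = g' + (g - g(0))/z, the Abel mean at r is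
f(0)g(0) plus r²/π times the integral over 𝔻 of f'(z) (1 - |z|²) K(r² z̄). Since |K| ≲ ‖g‖ w(|z|)/(1
- |z|), dominated convergence gives both the limit and its bound (`IsSlow.exists_pairing`).

Conversely, a functional Φ is represented by g = ∑ Φ(zⁿ) zⁿ, because dilations f_r converge to f in
𝔅¹_w and in 𝔟_w. The norm of g is controlled through g'(ζ) = Φ(h_ζ), h_ζ(z) = z/(1 - ζz)², whose
derivative is (1 + ζz)/(1 - ζz)³. The decisive estimate is ∫ w(|z|) |1 - ζz|⁻³ ≤ C w(|ζ|)/(1 - |ζ|)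
(`IsSlow.kernel`). For 𝔅¹_w it bounds ‖h_ζ‖ directly. For 𝔟_w one tests Φ on the superposition of
the h_ζ against the conjugate phase of g' times w.

The Cesàro operator satisfies (z 𝒞f)' = f/(1 - z). If w(r)/(1 - r) is dominated by v', integration
along radii gives |f| ≲ ‖f‖ v for f in 𝔅_w, hence 𝒞 : 𝔅_w → 𝔅_v. As v → ∞, 𝒞 sends monomials into
𝔟_v, and density and closedness give 𝒞 : 𝔟_w → 𝔟_v. These hypotheses are collected in `CesaroPair`.

The operator Λ needs no direct estimate. The Banach adjoint of 𝒞 on 𝔟_w, transported by the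
dualities, is a bounded map 𝔅¹_v → 𝔅¹_w whose coefficients are the pairings with 𝒞zⁿ, and these are
the coefficients of Λ. With Λ bounded, the other adjoint relation is again checked on monomials. It
remains to verify `CesaroPair` for the logarithmic weights, where w/(1 - r) is comparable to v'. -/

/-- The power series with coefficients `c` converges absolutely in the unit disk. -/
def DiskSummable (c : ℕ → ℂ) : Prop :=
  ∀ r : ℝ, 0 ≤ r → r < 1 → Summable fun n => ‖c n‖ * r ^ n

/-- The sum of a power series, extended by zero outside the unit disk. -/
def powerSum (c : ℕ → ℂ) : ℂ → ℂ :=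
  (ball (0 : ℂ) 1).indicator fun z => ∑' n, c n * z ^ n

theorem DiskSummable.summable {c : ℕ → ℂ} (hc : DiskSummable c) {z : ℂ} (hz : ‖z‖ < 1) :
    Summable fun n => c n * z ^ n := by
  refine Summable.of_norm ?_
  simpa using hc ‖z‖ (norm_nonneg z) hz

theorem DiskSummable.mono {c d : ℕ → ℂ} (hd : DiskSummable d) (h : ∀ n, ‖c n‖ ≤ ‖d n‖) :
    DiskSummable c := fun r h0 h1 =>
  (hd r h0 h1).of_nonneg_of_le (fun n => by positivity) fun n => by gcongr; exact h n

theorem diskSummable_of_le_pow {c : ℕ → ℂ} {K : ℝ} (k : ℕ)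
    (h : ∀ n, ‖c n‖ ≤ K * ((n : ℝ) + 1) ^ k) : DiskSummable c := by
  intro r h0 h1
  have h2 : Summable fun n : ℕ => ((n + 1 : ℕ) : ℝ) ^ k * r ^ (n + 1) :=
    (summable_nat_add_iff 1).2
      (summable_pow_mul_geometric_of_norm_lt_one (R := ℝ) k
        (by rwa [Real.norm_of_nonneg h0]))
  -- The comparison series is shifted by one index and so costs a factor r⁻¹; r = 0 is treated
  -- apart.
  rcases h0.eq_or_lt with rfl | hr
  · refine summable_of_ne_finset_zero (s := {0}) fun n hn => ?_
    have : n ≠ 0 := by simpa using hn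
    simp [this]
  refine ((h2.mul_left (K * r⁻¹))).of_nonneg_of_le (fun n => by positivity) fun n => ?_
  calc ‖c n‖ * r ^ n ≤ K * ((n : ℝ) + 1) ^ k * r ^ n := by gcongr; exact h n
    _ = K * r⁻¹ * (((n + 1 : ℕ) : ℝ) ^ k * r ^ (n + 1)) := by
      push_cast
      rw [pow_succ]
      field_simp

theorem hasSum_powerSum {c : ℕ → ℂ} (hc : DiskSummable c) {z : ℂ} (hz : z ∈ ball (0 : ℂ) 1) :
    HasSum (fun n => c n * z ^ n) (powerSum c z) := by
  rw [powerSum, Set.indicator_of_mem hz]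
  exact (hc.summable (mem_ball_zero_iff.1 hz)).hasSum

theorem hasFPowerSeriesOnBall_powerSum {c : ℕ → ℂ} (hc : DiskSummable c) :
    HasFPowerSeriesOnBall (powerSum c) (FormalMultilinearSeries.ofScalars ℂ c) 0 1 where
  r_le := by
    refine ENNReal.le_of_forall_nnreal_lt fun r hr => ?_
    refine FormalMultilinearSeries.le_radius_of_summable_norm _ ?_
    simp_rw [FormalMultilinearSeries.ofScalars_norm]
    exact hc r r.2 (by exact_mod_cast hr)
  r_pos := one_pos
  hasSum := by
    intro y hy
    have hy' : y ∈ ball (0 : ℂ) 1 := by simpa [Metric.mem_eball, edist_zero_right, enorm_eq_nnnorm,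
      ← NNReal.coe_lt_coe] using hy
    simp_rw [FormalMultilinearSeries.ofScalars_apply_eq, smul_eq_mul, zero_add]
    exact hasSum_powerSum hc hy'

theorem coeff_powerSum {c : ℕ → ℂ} (hc : DiskSummable c) (n : ℕ) : coeff (powerSum c) n = c n := by
  have h := (hasFPowerSeriesOnBall_powerSum hc).hasFPowerSeriesAt
  have h1 := h.analyticAt.hasFPowerSeriesAt.eq_formalMultilinearSeries h
  have h2 := congrArg (fun p => FormalMultilinearSeries.coeff p n) h1
  simp only [FormalMultilinearSeries.coeff_ofScalars] at h2
  exact h2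

theorem powerSum_mem_holDisk {c : ℕ → ℂ} (hc : DiskSummable c) : powerSum c ∈ holDisk := by
  refine ⟨?_, fun z hz => Set.indicator_of_notMem hz _⟩
  have h := (hasFPowerSeriesOnBall_powerSum hc).differentiableOn
  refine h.mono fun z hz => ?_
  simpa [Metric.mem_eball, edist_zero_right, enorm_eq_nnnorm, ← NNReal.coe_lt_coe] using hz

theorem hasSum_coeff {f : ℂ → ℂ} (hf : f ∈ holDisk) {z : ℂ} (hz : z ∈ ball (0 : ℂ) 1) :
    HasSum (fun n => coeff f n * z ^ n) (f z) := by
  have h := Complex.hasSum_taylorSeries_on_ball hf.1 hz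
  refine h.congr_fun fun n => ?_
  simp only [coeff, smul_eq_mul, sub_zero]
  ring

theorem hasSum_deriv {f : ℂ → ℂ} (hf : f ∈ holDisk) {z : ℂ} (hz : z ∈ ball (0 : ℂ) 1) :
    HasSum (fun n : ℕ => ((n : ℂ) + 1) * coeff f (n + 1) * z ^ n) (deriv f z) := by
  have h := Complex.hasSum_taylorSeries_on_ball (hf.1.deriv isOpen_ball) hz
  refine h.congr_fun fun n => ?_
  have h1 : ((n.factorial : ℕ) : ℂ) ≠ 0 := by exact_mod_cast n.factorial_ne_zero
  have h2 : (n : ℂ) + 1 ≠ 0 := by exact_mod_cast n.succ_ne_zero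
  simp only [coeff, smul_eq_mul, sub_zero, Nat.factorial_succ, iteratedDeriv_succ']
  push_cast
  field_simp

theorem diskSummable_of_hasSum {c : ℕ → ℂ} {f : ℂ → ℂ}
    (h : ∀ z ∈ ball (0 : ℂ) 1, HasSum (fun n => c n * z ^ n) (f z)) : DiskSummable c := by
  intro r h0 h1
  have := (h (r : ℂ) (by simpa [abs_of_nonneg h0] using h1)).summable.norm
  simpa [abs_of_nonneg h0] using this

theorem diskSummable_coeff {f : ℂ → ℂ} (hf : f ∈ holDisk) : DiskSummable (coeff f) :=
  diskSummable_of_hasSum fun _ hz => hasSum_coeff hf hz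

theorem coeff_eq_of_hasSum {c : ℕ → ℂ} {f : ℂ → ℂ}
    (h : ∀ z ∈ ball (0 : ℂ) 1, HasSum (fun n => c n * z ^ n) (f z)) (n : ℕ) : coeff f n = c n := by
  have hc := diskSummable_of_hasSum h
  rw [← coeff_powerSum hc n, coeff, coeff]
  congr 1
  refine Filter.EventuallyEq.iteratedDeriv_eq n ?_
  filter_upwards [isOpen_ball.mem_nhds (mem_ball_self one_pos)] with z hz
  exact (h z hz).unique (hasSum_powerSum hc hz)

theorem holDisk_ext {f g : ℂ → ℂ} (hf : f ∈ holDisk) (hg : g ∈ holDisk)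
    (h : ∀ n, coeff f n = coeff g n) : f = g := by
  funext z
  by_cases hz : z ∈ ball (0 : ℂ) 1
  · refine (hasSum_coeff hf hz).unique ?_
    simp_rw [h]
    exact hasSum_coeff hg hz
  · rw [hf.2 z hz, hg.2 z hz]

theorem powerSum_coeff {f : ℂ → ℂ} (hf : f ∈ holDisk) : powerSum (coeff f) = f :=
  holDisk_ext (powerSum_mem_holDisk (diskSummable_coeff hf)) hf
    (coeff_powerSum (diskSummable_coeff hf))

theorem hasSum_deriv_powerSum {c : ℕ → ℂ} (hc : DiskSummable c) {z : ℂ}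
    (hz : z ∈ ball (0 : ℂ) 1) :
    HasSum (fun n : ℕ => ((n : ℂ) + 1) * c (n + 1) * z ^ n) (deriv (powerSum c) z) := by
  simpa only [coeff_powerSum hc] using hasSum_deriv (powerSum_mem_holDisk hc) hz

theorem powerSum_zero (c : ℕ → ℂ) : powerSum c 0 = c 0 := by
  rw [powerSum, Set.indicator_of_mem (mem_ball_self one_pos), tsum_eq_single 0] <;> simp +contextual

theorem coeff_zero_eq (f : ℂ → ℂ) : coeff f 0 = f 0 := by simp [coeff]

theorem coeff_add {f g : ℂ → ℂ} (hf : f ∈ holDisk) (hg : g ∈ holDisk) (n : ℕ) :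
    coeff (f + g) n = coeff f n + coeff g n :=
  coeff_eq_of_hasSum (c := fun n => coeff f n + coeff g n) (fun z hz => by
    simpa [add_mul] using (hasSum_coeff hf hz).add (hasSum_coeff hg hz)) n

theorem coeff_smul {f : ℂ → ℂ} (hf : f ∈ holDisk) (a : ℂ) (n : ℕ) :
    coeff (a • f) n = a * coeff f n :=
  coeff_eq_of_hasSum (c := fun n => a * coeff f n) (fun z hz => by
    simpa [mul_assoc] using (hasSum_coeff hf hz).mul_left a) n

/-! ### The Abel pairing: bilinearity, absolutely convergent case, monomials. -/

theorem DiskSummable.abel {c d : ℕ → ℂ} (hc : DiskSummable c) (hd : DiskSummable d) {r : ℝ}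
    (h0 : 0 ≤ r) (h1 : r < 1) : Summable fun n => c n * d n * (r : ℂ) ^ (2 * n) := by
  -- Of the two factors rⁿ in r^{2n}, one makes the series of c converge and the other keeps d
  -- bounded.
  obtain ⟨C, hC⟩ := (hd r h0 h1).tendsto_atTop_zero.bddAbove_range
  refine Summable.of_norm_bounded ((hc r h0 h1).mul_right C) fun n => ?_
  have : ‖d n‖ * r ^ n ≤ C := hC ⟨n, rfl⟩
  calc ‖c n * d n * (r : ℂ) ^ (2 * n)‖ = (‖c n‖ * r ^ n) * (‖d n‖ * r ^ n) := by
        simp [abs_of_nonneg h0]; ring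
    _ ≤ _ := by gcongr

theorem abelMean_comm (f g : ℂ → ℂ) : abelMean f g = abelMean g f := by
  funext r
  simp only [abelMean, mul_comm (coeff f _)]

theorem HasAbelPairing.symm {f g : ℂ → ℂ} {L : ℂ} (h : HasAbelPairing f g L) :
    HasAbelPairing g f L := by
  rwa [HasAbelPairing, abelMean_comm]

theorem eventually_mem_Ioo_nhdsLT_one : ∀ᶠ r : ℝ in 𝓝[<] 1, 0 < r ∧ r < 1 :=
  Ioo_mem_nhdsLT one_pos

theorem HasAbelPairing.add_right {f g h : ℂ → ℂ} (hf : f ∈ holDisk) (hg : g ∈ holDisk)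
    (hh : h ∈ holDisk) {L M : ℂ} (h1 : HasAbelPairing f g L) (h2 : HasAbelPairing f h M) :
    HasAbelPairing f (g + h) (L + M) := by
  refine (Tendsto.add h1 h2).congr' ?_
  filter_upwards [eventually_mem_Ioo_nhdsLT_one] with r ⟨h0, h1⟩
  have hf' := diskSummable_coeff hf
  simp only [abelMean, coeff_add hg hh]
  rw [← (hf'.abel (diskSummable_coeff hg) h0.le h1).tsum_add
    (hf'.abel (diskSummable_coeff hh) h0.le h1)]
  exact tsum_congr fun n => by ring

theorem HasAbelPairing.smul_right {f g : ℂ → ℂ} (hg : g ∈ holDisk) {L : ℂ} (a : ℂ)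
    (h1 : HasAbelPairing f g L) : HasAbelPairing f (a • g) (a * L) := by
  refine (Tendsto.const_mul a h1).congr fun r => ?_
  simp only [abelMean, coeff_smul hg]
  rw [← tsum_mul_left]
  exact tsum_congr fun n => by ring

theorem HasAbelPairing.add_left {f g h : ℂ → ℂ} (hf : f ∈ holDisk) (hg : g ∈ holDisk)
    (hh : h ∈ holDisk) {L M : ℂ} (h1 : HasAbelPairing f h L) (h2 : HasAbelPairing g h M) :
    HasAbelPairing (f + g) h (L + M) :=
  (h1.symm.add_right hh hf hg h2.symm).symm

theorem HasAbelPairing.smul_left {f g : ℂ → ℂ} (hf : f ∈ holDisk) {L : ℂ} (a : ℂ)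
    (h1 : HasAbelPairing f g L) : HasAbelPairing (a • f) g (a * L) :=
  (h1.symm.smul_right hf a).symm

theorem HasAbelPairing.unique {f g : ℂ → ℂ} {L M : ℂ} (h1 : HasAbelPairing f g L)
    (h2 : HasAbelPairing f g M) : L = M :=
  tendsto_nhds_unique h1 h2

/-- If `∑ f̂(n) ĝ(n)` converges absolutely, it is the Abel pairing. -/
theorem hasAbelPairing_of_summable {f g : ℂ → ℂ}
    (h : Summable fun n => ‖coeff f n * coeff g n‖) :
    HasAbelPairing f g (∑' n, coeff f n * coeff g n) := by
  refine tendsto_tsum_of_dominated_convergence h ?_ ?_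
  · intro n
    have h1 : Tendsto (fun r : ℝ => coeff f n * coeff g n * (r : ℂ) ^ (2 * n)) (𝓝[<] 1)
        (𝓝 (coeff f n * coeff g n * ((1 : ℝ) : ℂ) ^ (2 * n))) :=
      (Continuous.tendsto (by fun_prop) 1).mono_left nhdsWithin_le_nhds
    simpa using h1
  · filter_upwards [eventually_mem_Ioo_nhdsLT_one] with r ⟨h0, h1⟩ n
    rw [norm_mul _ ((r : ℂ) ^ _), norm_pow, Complex.norm_real, Real.norm_of_nonneg h0.le]
    exact mul_le_of_le_one_right (norm_nonneg _) (pow_le_one₀ h0.le h1.le)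

/-- The coefficients of the monomial `z ^ n`. -/
def monoSeq (n : ℕ) : ℕ → ℂ := Pi.single n 1

theorem diskSummable_of_finite {c : ℕ → ℂ} (N : ℕ) (h : ∀ n, N ≤ n → c n = 0) :
    DiskSummable c := fun r _ _ =>
  summable_of_ne_finset_zero (s := Finset.range N) fun n hn => by
    rw [h n (by simpa using hn), norm_zero, zero_mul]

theorem diskSummable_monoSeq (n : ℕ) : DiskSummable (monoSeq n) :=
  diskSummable_of_finite (n + 1) fun m hm => by
    rw [monoSeq, Pi.single_eq_of_ne (by omega)]

/-- Pairing with monomials reads off Taylor coefficients; this reduces the later identities between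
functions, functionals and operators to coefficients. -/
theorem hasAbelPairing_monoSeq (n : ℕ) (g : ℂ → ℂ) :
    HasAbelPairing (powerSum (monoSeq n)) g (coeff g n) := by
  have h0 : ∀ m, coeff (powerSum (monoSeq n)) m * coeff g m = if m = n then coeff g n else 0 := by
    intro m
    rw [coeff_powerSum (diskSummable_monoSeq n), monoSeq, Pi.single_apply]
    split_ifs with h
    · rw [h, one_mul]
    · rw [zero_mul]
  have h1 := hasAbelPairing_of_summable (f := powerSum (monoSeq n)) (g := g) (by
    simp_rw [h0]
    refine summable_of_ne_finset_zero (s := {n}) fun m hm => ?_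
    have : m ≠ n := by simpa using hm
    simp [this])
  simpa only [h0, tsum_ite_eq] using h1


/-! ### Polar coordinates in the unit disk -/

theorem polarCoord_symm_eq_circleMap (p : ℝ × ℝ) :
    Complex.polarCoord.symm p = circleMap 0 p.1 p.2 := by
  rw [Complex.polarCoord_symm_apply, circleMap_zero, Complex.exp_mul_I]
  push_cast
  rfl

theorem circleMap_mem_ball_iff {s θ : ℝ} (hs : 0 < s) : circleMap 0 s θ ∈ ball (0 : ℂ) 1 ↔ s < 1 := by
  rw [mem_ball_zero_iff, norm_circleMap_zero, abs_of_pos hs]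

theorem measurable_circleMap : Measurable fun p : ℝ × ℝ => circleMap 0 p.1 p.2 := by
  unfold circleMap
  fun_prop

theorem lintegral_ball_polar {F : ℂ → ENNReal} (hF : Measurable F) :
    ∫⁻ z in ball (0 : ℂ) 1, F z = ∫⁻ s in Set.Ioo (0 : ℝ) 1, ENNReal.ofReal s *
      ∫⁻ θ in Set.Ioo (-Real.pi) Real.pi, F (circleMap 0 s θ) := by
  have hI : Measurable ((ball (0 : ℂ) 1).indicator F) := hF.indicator measurableSet_ball
  rw [← lintegral_indicator measurableSet_ball, ← Complex.lintegral_comp_polarCoord_symm,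
    polarCoord_target, Measure.volume_eq_prod, ← Measure.prod_restrict]
  simp_rw [polarCoord_symm_eq_circleMap, smul_eq_mul]
  have hm : Measurable fun p : ℝ × ℝ =>
      ENNReal.ofReal p.1 * (ball (0 : ℂ) 1).indicator F (circleMap 0 p.1 p.2) :=
    measurable_fst.ennreal_ofReal.mul (hI.comp measurable_circleMap)
  rw [lintegral_prod _ hm.aemeasurable]
  have h1 : Set.Ioo (0 : ℝ) 1 = Set.Iio 1 ∩ Set.Ioi 0 := by
    rw [Set.inter_comm]; rfl
  rw [h1, ← Measure.restrict_restrict measurableSet_Iio, ← lintegral_indicator measurableSet_Iio]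
  refine setLIntegral_congr_fun measurableSet_Ioi fun s hs => ?_
  have hs' : (0 : ℝ) < s := hs
  simp only
  by_cases h : s < 1
  · rw [Set.indicator_of_mem (by exact h), ← lintegral_const_mul]
    · refine lintegral_congr fun θ => ?_
      rw [Set.indicator_of_mem ((circleMap_mem_ball_iff hs').2 h)]
    · exact hF.comp (measurable_circleMap.comp (measurable_const.prodMk measurable_id))
  · rw [Set.indicator_of_notMem (by exact h)]
    refine (lintegral_congr fun θ => ?_).trans lintegral_zero
    rw [Set.indicator_of_notMem (by rwa [circleMap_mem_ball_iff hs']), mul_zero]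

theorem integral_ball_polar {F : ℂ → ℂ} (hF : Measurable F) (hi : IntegrableOn F (ball (0 : ℂ) 1)) :
    ∫ z in ball (0 : ℂ) 1, F z = ∫ s in Set.Ioo (0 : ℝ) 1, (s : ℂ) *
      ∫ θ in Set.Ioo (-Real.pi) Real.pi, F (circleMap 0 s θ) := by
  have hI : Measurable ((ball (0 : ℂ) 1).indicator F) := hF.indicator measurableSet_ball
  have hint : Integrable (fun p : ℝ × ℝ => p.1 • (ball (0 : ℂ) 1).indicator F (circleMap 0 p.1 p.2))
      ((volume.restrict (Set.Ioi 0)).prod (volume.restrict (Set.Ioo (-Real.pi) Real.pi))) := by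
    have h2 := hi.2
    refine ⟨(measurable_fst.smul (hI.comp measurable_circleMap)).aestronglyMeasurable, ?_⟩
    rw [HasFiniteIntegral, ← lintegral_indicator measurableSet_ball,
      ← Complex.lintegral_comp_polarCoord_symm, polarCoord_target, Measure.volume_eq_prod,
      ← Measure.prod_restrict] at h2
    refine lt_of_le_of_lt (lintegral_mono_ae ?_) h2
    rw [Measure.prod_restrict]
    filter_upwards [ae_restrict_mem (measurableSet_Ioi.prod measurableSet_Ioo)] with p hp
    have : (0 : ℝ) < p.1 := hp.1
    rw [polarCoord_symm_eq_circleMap, smul_eq_mul, enorm_smul, Real.enorm_of_nonneg this.le,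
      enorm_indicator_eq_indicator_enorm]
  rw [← integral_indicator measurableSet_ball, ← Complex.integral_comp_polarCoord_symm,
    polarCoord_target, Measure.volume_eq_prod, ← Measure.prod_restrict]
  simp_rw [polarCoord_symm_eq_circleMap]
  rw [integral_prod _ hint]
  have h1 : Set.Ioo (0 : ℝ) 1 = Set.Iio 1 ∩ Set.Ioi 0 := by
    rw [Set.inter_comm]; rfl
  rw [h1, ← Measure.restrict_restrict measurableSet_Iio, ← integral_indicator measurableSet_Iio]
  refine setIntegral_congr_fun measurableSet_Ioi fun s hs => ?_
  have hs' : (0 : ℝ) < s := hs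
  simp only
  by_cases h : s < 1
  · rw [Set.indicator_of_mem (by exact h), ← integral_const_mul]
    refine integral_congr_ae (Eventually.of_forall fun θ => ?_)
    beta_reduce
    rw [Set.indicator_of_mem ((circleMap_mem_ball_iff hs').2 h), Complex.real_smul]
  · rw [Set.indicator_of_notMem (by exact h)]
    refine (integral_congr_ae (Eventually.of_forall fun θ => ?_)).trans (integral_zero _ _)
    rw [Set.indicator_of_notMem (by rwa [circleMap_mem_ball_iff hs']), smul_zero]

theorem setIntegral_circleMap {E : Type*} [NormedAddCommGroup E] [NormedSpace ℝ E]
    (G : ℂ → E) (s : ℝ) :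
    ∫ θ in Set.Ioo (-Real.pi) Real.pi, G (circleMap 0 s θ) =
      (2 * Real.pi) • Real.circleAverage G 0 s := by
  have hper : Function.Periodic (fun θ => G (circleMap 0 s θ)) (2 * Real.pi) := fun θ => by
    simp only [periodic_circleMap 0 s θ]
  have h := hper.intervalIntegral_add_eq (-Real.pi) 0
  rw [zero_add, show -Real.pi + 2 * Real.pi = Real.pi by ring] at h
  rw [← integral_Ioc_eq_integral_Ioo,
    ← intervalIntegral.integral_of_le (by linarith [Real.pi_pos]), h, Real.circleAverage_def,
    smul_smul, mul_inv_cancel₀ (by positivity), one_smul]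

/-- The Poisson integral `∫ |1 - ζ s e^{iθ}|⁻² dθ`. -/
theorem integral_norm_one_sub_sq {ζ : ℂ} {s : ℝ} (h0 : 0 ≤ s) (h : ‖ζ‖ * s < 1) :
    ∫ θ in Set.Ioo (-Real.pi) Real.pi, (‖1 - ζ * circleMap 0 s θ‖ ^ 2)⁻¹ =
      2 * Real.pi / (1 - (‖ζ‖ * s) ^ 2) := by
  have hne : ∀ z : ℂ, ‖z‖ ≤ s → 1 - ζ * z ≠ 0 := by
    intro z hz h1
    have h2 : ζ * z = 1 := (sub_eq_zero.1 h1).symm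
    have h3 : ‖ζ‖ * ‖z‖ = 1 := by rw [← norm_mul, h2, norm_one]
    nlinarith [norm_nonneg ζ, mul_le_mul_of_nonneg_left hz (norm_nonneg ζ)]
  -- On the circle the real part of this function is (1 - |ζz|²)/|1 - ζz|², so its mean value f(0) =
  -- 1 is the Poisson integral.
  let f : ℂ → ℂ := fun z => (1 + ζ * z) / (1 - ζ * z)
  have hf : DifferentiableOn ℂ f (closedBall 0 s) := by
    intro z hz
    refine DifferentiableAt.differentiableWithinAt ?_
    have := hne z (by simpa using hz)
    fun_prop (disch := exact this)
  have hd : DiffContOnCl ℂ f (ball 0 |s|) := by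
    rw [abs_of_nonneg h0]
    refine DifferentiableOn.diffContOnCl (hf.mono closure_ball_subset_closedBall)
  have h1 : Real.circleAverage f 0 s = 1 := by
    rw [hd.circleAverage]; simp [f]
  have hci : CircleIntegrable f 0 s := by
    refine ContinuousOn.circleIntegrable h0 (hf.continuousOn.mono sphere_subset_closedBall)
  have h2 : Real.circleAverage (fun z => (f z).re) 0 s = 1 := by
    have := Complex.reCLM.circleAverage_comp_comm hci
    rw [h1] at this
    simpa [Function.comp_def] using this
  have hpos : 0 < 1 - (‖ζ‖ * s) ^ 2 := by
    have : 0 ≤ ‖ζ‖ * s := by positivity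
    nlinarith
  have h3 : Real.circleAverage (fun z => (f z).re) 0 s =
      Real.circleAverage (fun z => (1 - (‖ζ‖ * s) ^ 2) • (‖1 - ζ * z‖ ^ 2)⁻¹) 0 s := by
    refine Real.circleAverage_congr_sphere fun z hz => ?_
    have hz' : ‖z‖ = s := by simpa [abs_of_nonneg h0] using hz
    have h4 := hne z hz'.le
    have h5 : ‖ζ‖ * s = ‖ζ * z‖ := by rw [norm_mul, hz']
    simp only [f, smul_eq_mul]
    rw [h5, Complex.div_re, ← Complex.normSq_eq_norm_sq, ← Complex.normSq_eq_norm_sq,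
      Complex.normSq_apply (ζ * z)]
    have h6 : Complex.normSq (1 - ζ * z) ≠ 0 := by simpa using h4
    field_simp
    simp only [Complex.add_re, Complex.sub_re, Complex.one_re, Complex.add_im, Complex.one_im,
      Complex.sub_im]
    ring
  rw [setIntegral_circleMap (fun z => (‖1 - ζ * z‖ ^ 2)⁻¹)]
  rw [h2, Real.circleAverage_fun_smul] at h3
  rw [smul_eq_mul] at h3 ⊢
  rw [eq_div_iff hpos.ne', mul_assoc, mul_comm (Real.circleAverage _ _ _), ← h3, mul_one]

/-! ### Slowly varying weights -/

/-- A weight such that `w(s) / w(r)` grows at most like the square root of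
`max ((1 - s) / (1 - r), (1 - r) / (1 - s))`. -/
def IsSlow (w : Weight) : Prop :=
  ∃ C : ℝ, 0 < C ∧ ∀ s r, 0 ≤ s → s < 1 → 0 ≤ r → r < 1 →
    w s ≤ C * w r * (((1 - s) + (1 - r)) / √((1 - s) * (1 - r)))

/-- For s ≤ r the loss permitted by `IsSlow` is at most 2(1 - s)/(1 - r), exactly what the factors
(1 - s)⁻¹ and (1 - r)⁻¹ compensate. -/
theorem IsSlow.almost_mono {w : Weight} (hw : IsSlow w) :
    ∃ C : ℝ, 0 < C ∧ ∀ s r, 0 ≤ s → s ≤ r → r < 1 →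
      (1 - s)⁻¹ * w s ≤ C * ((1 - r)⁻¹ * w r) := by
  obtain ⟨C, hC, h⟩ := hw
  refine ⟨2 * C, by positivity, fun s r h0 hsr h1 => ?_⟩
  have hx : 0 < 1 - s := by linarith
  have ha : 0 < 1 - r := by linarith
  have hwr := w.pos r (by linarith) h1
  have h2 : 1 - r ≤ √((1 - s) * (1 - r)) := Real.le_sqrt_of_sq_le (by nlinarith)
  calc (1 - s)⁻¹ * w s ≤ (1 - s)⁻¹ * (C * w r * (((1 - s) + (1 - r)) / √((1 - s) * (1 - r)))) := by
        gcongr; exact h s r h0 (by linarith) (by linarith) h1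
    _ ≤ (1 - s)⁻¹ * (C * w r * ((2 * (1 - s)) / (1 - r))) := by
        gcongr; linarith
    _ = _ := by field_simp

/-- Comparison with the point 0. A lower bound by the square root, not merely by 1 - r, is what
makes w(r)/(1 - r) tend to infinity. -/
theorem IsSlow.lower {w : Weight} (hw : IsSlow w) :
    ∃ c : ℝ, 0 < c ∧ ∀ r, 0 ≤ r → r < 1 → c * √(1 - r) ≤ w r := by
  obtain ⟨C, hC, h⟩ := hw
  have hw0 := w.pos 0 le_rfl one_pos
  refine ⟨w 0 / (2 * C), by positivity, fun r h0 h1 => ?_⟩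
  have ha : 0 < 1 - r := by linarith
  have hwr := w.pos r h0 h1
  have h2 := h 0 r le_rfl one_pos h0 h1
  have h3 : 0 < √(1 - r) := Real.sqrt_pos.2 ha
  rw [sub_zero, one_mul] at h2
  have h4 : w 0 ≤ C * w r * (2 / √(1 - r)) := h2.trans (by gcongr; linarith)
  have h5 : w 0 * √(1 - r) ≤ C * w r * 2 := by
    calc w 0 * √(1 - r) ≤ C * w r * (2 / √(1 - r)) * √(1 - r) := by gcongr
      _ = _ := by field_simp
  rw [div_mul_eq_mul_div, div_le_iff₀ (by positivity)]
  linarith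

/-- This weaker form puts functions with bounded derivative into 𝔅_w and makes (1 - |z|²) f'
integrable for f in 𝔅¹_w. -/
theorem IsSlow.lower_linear {w : Weight} (hw : IsSlow w) :
    ∃ c : ℝ, 0 < c ∧ ∀ r, 0 ≤ r → r < 1 → c * (1 - r) ≤ w r := by
  obtain ⟨c, hc, h⟩ := hw.lower
  refine ⟨c, hc, fun r h0 h1 => le_trans ?_ (h r h0 h1)⟩
  gcongr
  exact Real.le_sqrt_of_sq_le (by nlinarith)

theorem IsSlow.tendsto {w : Weight} (hw : IsSlow w) :
    Tendsto (fun r => (1 - r)⁻¹ * w r) (𝓝[<] 1) atTop := by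
  obtain ⟨c, hc, h⟩ := hw.lower
  have h1 : Tendsto (fun r : ℝ => √(1 - r)) (𝓝[<] 1) (𝓝[>] 0) := by
    refine tendsto_nhdsWithin_iff.2 ⟨?_, ?_⟩
    · have : Tendsto (fun r : ℝ => √(1 - r)) (𝓝[<] 1) (𝓝 (√(1 - 1))) :=
        (Continuous.tendsto (by fun_prop) 1).mono_left nhdsWithin_le_nhds
      simpa using this
    · filter_upwards [self_mem_nhdsWithin] with r hr
      exact Real.sqrt_pos.2 (sub_pos.2 hr)
  refine tendsto_atTop_mono' _ ?_ ((tendsto_inv_nhdsGT_zero.comp h1).const_mul_atTop hc)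
  filter_upwards [eventually_mem_Ioo_nhdsLT_one] with r ⟨h0, h1⟩
  have ha : 0 < 1 - r := by linarith
  have h3 : 0 < √(1 - r) := Real.sqrt_pos.2 ha
  calc c * (√(1 - r))⁻¹ = (1 - r)⁻¹ * (c * √(1 - r)) := by
        rw [← Real.mul_self_sqrt ha.le]
        field_simp
        rw [Real.sqrt_sq h3.le]
    _ ≤ _ := by gcongr; exact h r h0.le h1

/-- The substitution t = √((1 - s)/a) turns the integrand into 2/(a(1 + t²)). The primitive is
continuous up to s = 1, which also yields integrability at that singular endpoint. -/
theorem lintegral_inv_sqrt_mul {a : ℝ} (ha : 0 < a) :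
    ∫⁻ s in Set.Ioo (0 : ℝ) 1, ENNReal.ofReal ((√((1 - s) * a) * ((1 - s) + a))⁻¹) ≤
      ENNReal.ofReal (Real.pi / a) := by
  let A : ℝ → ℝ := fun s => -(2 / a) * Real.arctan (√((1 - s) / a))
  have hA : ContinuousOn A (Set.Icc 0 1) := by
    refine Continuous.continuousOn ?_
    exact continuous_const.mul (Real.continuous_arctan.comp (by fun_prop))
  have hd : ∀ s ∈ Set.Ioo (0 : ℝ) 1, HasDerivAt A ((√((1 - s) * a) * ((1 - s) + a))⁻¹) s := by
    intro s hs
    have hx : 0 < 1 - s := by linarith [hs.2]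
    have h1 : HasDerivAt (fun s : ℝ => (1 - s) / a) (-1 / a) s :=
      ((hasDerivAt_id s).const_sub 1).div_const a
    have h2 := ((h1.sqrt (by positivity)).arctan).const_mul (-(2 / a))
    refine h2.congr_deriv ?_
    rw [Real.sq_sqrt (by positivity), Real.sqrt_div hx.le, Real.sqrt_mul hx.le]
    have h3 : 0 < √(1 - s) := Real.sqrt_pos.2 hx
    have h4 : 0 < √a := Real.sqrt_pos.2 ha
    have h5 : a = √a ^ 2 := (Real.sq_sqrt ha.le).symm
    have h6 : 0 < 1 + (1 - s) / a := by positivity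
    field_simp
    rw [Real.sq_sqrt ha.le]
    ring
  have hnn : ∀ s ∈ Set.Ioo (0 : ℝ) 1, 0 ≤ (√((1 - s) * a) * ((1 - s) + a))⁻¹ := by
    intro s hs
    have hx : 0 < 1 - s := by linarith [hs.2]
    positivity
  have hint := intervalIntegral.integrableOn_deriv_of_nonneg hA hd hnn
  have hii : IntervalIntegrable (fun s => (√((1 - s) * a) * ((1 - s) + a))⁻¹) volume 0 1 :=
    (intervalIntegrable_iff_integrableOn_Ioc_of_le zero_le_one).2 hint
  have hval := intervalIntegral.integral_eq_sub_of_hasDerivAt_of_le zero_le_one hA hd hii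
  rw [intervalIntegral.integral_of_le zero_le_one, integral_Ioc_eq_integral_Ioo] at hval
  rw [← ofReal_integral_eq_lintegral_ofReal (hint.mono_set Set.Ioo_subset_Ioc_self), hval]
  · refine ENNReal.ofReal_le_ofReal ?_
    simp only [A, sub_self, zero_div, Real.sqrt_zero, Real.arctan_zero]
    have := Real.arctan_lt_pi_div_two (√((1 - 0) / a))
    calc _ = 2 / a * Real.arctan (√((1 - 0) / a)) := by ring
      _ ≤ 2 / a * (Real.pi / 2) := by gcongr
      _ = _ := by ring
  · filter_upwards [ae_restrict_mem measurableSet_Ioo] with s hs using hnn s hs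

/-- Slow variation replaces w(s) by w(r) at the price of a factor which, divided by (1 - sr)², is at
most a constant times the integrand of `lintegral_inv_sqrt_mul` with a = 1 - r. -/
theorem IsSlow.radial {w : Weight} (hw : IsSlow w) :
    ∃ C : ℝ, 0 < C ∧ ∀ r, 0 ≤ r → r < 1 →
      ∫⁻ s in Set.Ioo (0 : ℝ) 1, ENNReal.ofReal (w s * ((1 - s * r) ^ 2)⁻¹) ≤
        ENNReal.ofReal (C * ((1 - r)⁻¹ * w r)) := by
  obtain ⟨C, hC, h⟩ := hw
  refine ⟨4 * C * Real.pi, by positivity, fun r h0 h1 => ?_⟩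
  have ha : 0 < 1 - r := by linarith
  have hwr := w.pos r h0 h1
  have h2 : ∀ s ∈ Set.Ioo (0 : ℝ) 1, ENNReal.ofReal (w s * ((1 - s * r) ^ 2)⁻¹) ≤
      ENNReal.ofReal (4 * C * w r) *
        ENNReal.ofReal ((√((1 - s) * (1 - r)) * ((1 - s) + (1 - r)))⁻¹) := by
    intro s hs
    have hx : 0 < 1 - s := by linarith [hs.2]
    rw [← ENNReal.ofReal_mul (by positivity)]
    refine ENNReal.ofReal_le_ofReal ?_
    -- With x = 1 - s and a = 1 - r, 1 - sr = x + a - xa. The square of the factor 1/2 produces the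
    -- 4 in the constant.
    have h3 : ((1 - s) + (1 - r)) / 2 ≤ 1 - s * r := by nlinarith [hs.1]
    have h4 : 0 < √((1 - s) * (1 - r)) := Real.sqrt_pos.2 (by positivity)
    calc w s * ((1 - s * r) ^ 2)⁻¹
        ≤ C * w r * (((1 - s) + (1 - r)) / √((1 - s) * (1 - r))) *
            ((((1 - s) + (1 - r)) / 2) ^ 2)⁻¹ := by
          gcongr
          exact h s r hs.1.le hs.2 h0 h1
      _ = _ := by field_simp; ring
  calc _ ≤ ∫⁻ s in Set.Ioo (0 : ℝ) 1, ENNReal.ofReal (4 * C * w r) *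
        ENNReal.ofReal ((√((1 - s) * (1 - r)) * ((1 - s) + (1 - r)))⁻¹) :=
        setLIntegral_mono' measurableSet_Ioo h2
    _ ≤ ENNReal.ofReal (4 * C * w r) * ENNReal.ofReal (Real.pi / (1 - r)) := by
        rw [lintegral_const_mul' _ _ ENNReal.ofReal_ne_top]
        gcongr
        exact lintegral_inv_sqrt_mul ha
    _ = _ := by
        rw [← ENNReal.ofReal_mul (by positivity)]
        congr 1
        field_simp

/-- The Forelli–Rudin type estimate of `∫_𝔻 w(|z|) |1 - ζ z|⁻³ dz`. -/
theorem IsSlow.kernel {w : Weight} (hw : IsSlow w) :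
    ∃ C : ℝ, 0 < C ∧ ∀ ζ : ℂ, ‖ζ‖ < 1 →
      ∫⁻ z in ball (0 : ℂ) 1, ENNReal.ofReal (w ‖z‖ * (‖1 - ζ * z‖ ^ 3)⁻¹) ≤
        ENNReal.ofReal (C * ((1 - ‖ζ‖)⁻¹ * w ‖ζ‖)) := by
  obtain ⟨C, hC, h⟩ := hw.radial
  refine ⟨2 * Real.pi * C, by positivity, fun ζ hζ => ?_⟩
  have hm : Measurable fun z : ℂ => ENNReal.ofReal (w ‖z‖ * (‖1 - ζ * z‖ ^ 3)⁻¹) := by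
    have := w.measurable
    fun_prop
  rw [lintegral_ball_polar hm]
  -- Of the three factors |1 - ζz|⁻¹ one is bounded by (1 - |ζ|s)⁻¹, and the other two give the
  -- Poisson integral, which contributes a second (1 - |ζ|s)⁻¹. The Jacobian s is bounded by 1.
  have key : ∀ s ∈ Set.Ioo (0 : ℝ) 1, ENNReal.ofReal s *
      ∫⁻ θ in Set.Ioo (-Real.pi) Real.pi,
        ENNReal.ofReal (w ‖circleMap 0 s θ‖ * (‖1 - ζ * circleMap 0 s θ‖ ^ 3)⁻¹) ≤
      ENNReal.ofReal (2 * Real.pi) * ENNReal.ofReal (w s * ((1 - s * ‖ζ‖) ^ 2)⁻¹) := by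
    rintro s ⟨h0, h1⟩
    have hws := w.pos s h0.le h1
    have hsz : ‖ζ‖ * s < 1 := by nlinarith [norm_nonneg ζ]
    have hpos : 0 < 1 - ‖ζ‖ * s := by linarith
    have hle : ∀ θ, 1 - ‖ζ‖ * s ≤ ‖1 - ζ * circleMap 0 s θ‖ := by
      intro θ
      have := norm_sub_norm_le 1 (ζ * circleMap 0 s θ)
      rwa [norm_one, norm_mul, norm_circleMap_zero, abs_of_pos h0] at this
    have hcont : Continuous fun θ => (‖1 - ζ * circleMap 0 s θ‖ ^ 2)⁻¹ := by
      refine Continuous.inv₀ (by fun_prop) fun θ => ?_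
      have h2 : 0 < ‖1 - ζ * circleMap 0 s θ‖ := hpos.trans_le (hle θ)
      positivity
    have hint : IntegrableOn (fun θ => (‖1 - ζ * circleMap 0 s θ‖ ^ 2)⁻¹)
        (Set.Ioo (-Real.pi) Real.pi) :=
      (hcont.integrableOn_Icc (a := -Real.pi) (b := Real.pi)).mono_set Set.Ioo_subset_Icc_self
    calc ENNReal.ofReal s * ∫⁻ θ in Set.Ioo (-Real.pi) Real.pi,
          ENNReal.ofReal (w ‖circleMap 0 s θ‖ * (‖1 - ζ * circleMap 0 s θ‖ ^ 3)⁻¹)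
        ≤ 1 * ∫⁻ θ in Set.Ioo (-Real.pi) Real.pi, ENNReal.ofReal (w s * (1 - ‖ζ‖ * s)⁻¹) *
            ENNReal.ofReal ((‖1 - ζ * circleMap 0 s θ‖ ^ 2)⁻¹) := by
          gcongr with θ
          · exact ENNReal.ofReal_le_one.2 h1.le
          · rw [← ENNReal.ofReal_mul (by positivity)]
            refine ENNReal.ofReal_le_ofReal ?_
            have h2 := hle θ
            have h3 : 0 < ‖1 - ζ * circleMap 0 s θ‖ := by linarith
            rw [norm_circleMap_zero, abs_of_pos h0, mul_assoc, pow_succ', mul_inv]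
            gcongr
      _ = ENNReal.ofReal (w s * (1 - ‖ζ‖ * s)⁻¹) *
            ENNReal.ofReal (2 * Real.pi / (1 - (‖ζ‖ * s) ^ 2)) := by
          rw [one_mul, lintegral_const_mul' _ _ ENNReal.ofReal_ne_top,
            ← ofReal_integral_eq_lintegral_ofReal hint
              (Eventually.of_forall fun θ => by positivity), integral_norm_one_sub_sq h0.le hsz]
      _ ≤ _ := by
          rw [← ENNReal.ofReal_mul (by positivity), ← ENNReal.ofReal_mul (by positivity)]
          refine ENNReal.ofReal_le_ofReal ?_
          have h4 : 1 - ‖ζ‖ * s ≤ 1 - (‖ζ‖ * s) ^ 2 := by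
            have : 0 ≤ ‖ζ‖ * s := by positivity
            nlinarith
          calc w s * (1 - ‖ζ‖ * s)⁻¹ * (2 * Real.pi / (1 - (‖ζ‖ * s) ^ 2))
              ≤ w s * (1 - ‖ζ‖ * s)⁻¹ * (2 * Real.pi / (1 - ‖ζ‖ * s)) := by gcongr
            _ = _ := by rw [mul_comm s]; field_simp
  calc _ ≤ ∫⁻ s in Set.Ioo (0 : ℝ) 1, ENNReal.ofReal (2 * Real.pi) *
        ENNReal.ofReal (w s * ((1 - s * ‖ζ‖) ^ 2)⁻¹) := setLIntegral_mono' measurableSet_Ioo key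
    _ ≤ ENNReal.ofReal (2 * Real.pi) * ENNReal.ofReal (C * ((1 - ‖ζ‖)⁻¹ * w ‖ζ‖)) := by
        rw [lintegral_const_mul' _ _ ENNReal.ofReal_ne_top]
        gcongr
        exact h _ (norm_nonneg ζ) hζ
    _ = _ := by
        rw [← ENNReal.ofReal_mul (by positivity)]
        congr 1
        ring

theorem IsSlow.kernel_integral {w : Weight} (hw : IsSlow w) :
    ∃ C : ℝ, 0 < C ∧ ∀ ζ : ℂ, ‖ζ‖ < 1 →
      IntegrableOn (fun z => w ‖z‖ * (‖1 - ζ * z‖ ^ 3)⁻¹) (ball (0 : ℂ) 1) ∧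
      ∫ z in ball (0 : ℂ) 1, w ‖z‖ * (‖1 - ζ * z‖ ^ 3)⁻¹ ≤ C * ((1 - ‖ζ‖)⁻¹ * w ‖ζ‖) := by
  obtain ⟨C, hC, h⟩ := hw.kernel
  refine ⟨C, hC, fun ζ hζ => ?_⟩
  have hm : AEStronglyMeasurable (fun z : ℂ => w ‖z‖ * (‖1 - ζ * z‖ ^ 3)⁻¹)
      (volume.restrict (ball (0 : ℂ) 1)) := by
    have := w.measurable
    exact Measurable.aestronglyMeasurable (by fun_prop)
  have hnn : 0 ≤ᵐ[volume.restrict (ball (0 : ℂ) 1)] fun z => w ‖z‖ * (‖1 - ζ * z‖ ^ 3)⁻¹ := by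
    filter_upwards [ae_restrict_mem measurableSet_ball] with z hz
    have := w.pos _ (norm_nonneg z) (mem_ball_zero_iff.1 hz)
    exact mul_nonneg this.le (by positivity)
  have hpos : 0 ≤ C * ((1 - ‖ζ‖)⁻¹ * w ‖ζ‖) := by
    have := w.pos _ (norm_nonneg ζ) hζ
    have : 0 < 1 - ‖ζ‖ := by linarith
    positivity
  refine ⟨⟨hm, ?_⟩, ?_⟩
  · rw [hasFiniteIntegral_iff_ofReal hnn]
    exact (h ζ hζ).trans_lt ENNReal.ofReal_lt_top
  · rw [integral_eq_lintegral_of_nonneg_ae hnn hm]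
    exact ENNReal.toReal_le_of_le_ofReal hpos (h ζ hζ)

theorem IsSlow.integrableOn {w : Weight} (hw : IsSlow w) :
    IntegrableOn (fun z => w ‖z‖) (ball (0 : ℂ) 1) := by
  obtain ⟨C, -, h⟩ := hw.kernel_integral
  simpa using (h 0 (by simp)).1


/-! ### The area formula for the Abel pairing -/

/-- On |z| = s one has z̄ = s²/z, so the average is s^{2n} times Cauchy's integral for the n-th
coefficient. -/
theorem circleAverage_mul_conj_pow {F : ℂ → ℂ} (hF : DifferentiableOn ℂ F (ball 0 1)) (n : ℕ)
    {s : ℝ} (h0 : 0 < s) (h1 : s < 1) :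
    Real.circleAverage (fun z => F z * (starRingEnd ℂ) z ^ n) 0 s =
      coeff F n * (s : ℂ) ^ (2 * n) := by
  have h := (hF.mono (closedBall_subset_ball h1)).circleIntegral_one_div_sub_center_pow_smul h0 n
  have h2 : ∀ z ∈ sphere (0 : ℂ) s, (starRingEnd ℂ) z ^ n * z ^ n = (s : ℂ) ^ (2 * n) := by
    intro z hz
    rw [← mul_pow, Complex.conj_mul', mem_sphere_zero_iff_norm.1 hz, ← pow_mul]
  rw [Real.circleAverage_eq_circleIntegral h0.ne']
  have h3 : (∮ z in C(0, s), (z - 0)⁻¹ • (F z * (starRingEnd ℂ) z ^ n)) =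
      ∮ z in C(0, s), (s : ℂ) ^ (2 * n) • ((1 / (z - 0) ^ (n + 1)) • F z) := by
    refine circleIntegral.integral_congr h0.le fun z hz => ?_
    have hz0 : z ≠ 0 := by
      rintro rfl
      simp [h0.ne] at hz
    simp only [sub_zero, smul_eq_mul]
    rw [← h2 z hz, pow_succ]
    field_simp
  rw [h3, circleIntegral.integral_smul, h, smul_eq_mul, smul_eq_mul, smul_eq_mul, coeff]
  have : (2 * (Real.pi : ℂ) * Complex.I) ≠ 0 := Complex.two_pi_I_ne_zero
  field_simp

/-- The radial integral is 2∫(s^{2n+1} - s^{2n+3}) ds = 1/(n+1) - 1/(n+2). In the pairing, n + 1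
cancels against the coefficients of f' and n + 2 against those of `conjugateKernel`; the factor 1 -
|z|² absorbs the growth (1 - |z|)⁻¹ of g'. -/
theorem integral_ball_mul_conj_pow {F : ℂ → ℂ} (hF : DifferentiableOn ℂ F (ball 0 1))
    (hm : Measurable F)
    (hi : IntegrableOn (fun z => F z * (1 - (‖z‖ : ℂ) ^ 2)) (ball (0 : ℂ) 1)) (n : ℕ) :
    ∫ z in ball (0 : ℂ) 1, F z * (1 - (‖z‖ : ℂ) ^ 2) * (starRingEnd ℂ) z ^ n =
      Real.pi * (coeff F n / (((n : ℂ) + 1) * ((n : ℂ) + 2))) := by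
  have hconj : Measurable fun z : ℂ => (starRingEnd ℂ) z ^ n :=
    (Complex.continuous_conj.pow n).measurable
  have hmeas : Measurable fun z : ℂ => F z * (1 - (‖z‖ : ℂ) ^ 2) * (starRingEnd ℂ) z ^ n := by
    refine Measurable.mul ?_ hconj
    fun_prop
  have hint : IntegrableOn (fun z : ℂ => F z * (1 - (‖z‖ : ℂ) ^ 2) * (starRingEnd ℂ) z ^ n)
      (ball (0 : ℂ) 1) := by
    refine hi.norm.mono' hmeas.aestronglyMeasurable ?_
    filter_upwards [ae_restrict_mem measurableSet_ball] with z hz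
    rw [norm_mul _ ((starRingEnd ℂ) z ^ n), norm_pow, RCLike.norm_conj]
    exact mul_le_of_le_one_right (norm_nonneg _)
      (pow_le_one₀ (norm_nonneg z) (mem_ball_zero_iff.1 hz).le)
  rw [integral_ball_polar hmeas hint]
  have h1 : ∀ s ∈ Set.Ioo (0 : ℝ) 1, (s : ℂ) * ∫ θ in Set.Ioo (-Real.pi) Real.pi,
      F (circleMap 0 s θ) * (1 - (‖circleMap 0 s θ‖ : ℂ) ^ 2) *
        (starRingEnd ℂ) (circleMap 0 s θ) ^ n =
      2 * Real.pi * coeff F n * ((s ^ (2 * n + 1) - s ^ (2 * n + 3) : ℝ) : ℂ) := by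
    rintro s ⟨h0, h1⟩
    have h2 := setIntegral_circleMap (fun z => F z * (starRingEnd ℂ) z ^ n) s
    rw [circleAverage_mul_conj_pow hF n h0 h1] at h2
    have h3 : ∫ θ in Set.Ioo (-Real.pi) Real.pi,
        F (circleMap 0 s θ) * (1 - (‖circleMap 0 s θ‖ : ℂ) ^ 2) *
        (starRingEnd ℂ) (circleMap 0 s θ) ^ n = (1 - (s : ℂ) ^ 2) *
          ∫ θ in Set.Ioo (-Real.pi) Real.pi,
          F (circleMap 0 s θ) * (starRingEnd ℂ) (circleMap 0 s θ) ^ n := by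
      rw [← integral_const_mul]
      congr 1
      funext θ
      rw [norm_circleMap_zero, abs_of_pos h0]
      ring
    rw [h3, h2, Complex.real_smul]
    push_cast
    ring
  rw [setIntegral_congr_fun measurableSet_Ioo h1, integral_const_mul, integral_complex_ofReal,
    ← integral_Ioc_eq_integral_Ioo, ← intervalIntegral.integral_of_le zero_le_one,
    intervalIntegral.integral_sub (by simp) (by simp), integral_pow, integral_pow]
  have h2 : (n : ℂ) + 1 ≠ 0 := by exact_mod_cast n.succ_ne_zero
  have h3 : (n : ℂ) + 2 ≠ 0 := by exact_mod_cast (n + 1).succ_ne_zero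
  have h4 : (2 * (n : ℂ) + 1 + 1) = 2 * ((n : ℂ) + 1) := by ring
  have h5 : (2 * (n : ℂ) + 3 + 1) = 2 * ((n : ℂ) + 2) := by ring
  push_cast
  rw [h4, h5]
  field_simp
  ring

/-- Termwise integration of the expansion of G(r z̄), legitimate because r < 1 makes the series
converge absolutely and uniformly on the disk. -/
theorem hasSum_integral_mul_conj {F G : ℂ → ℂ} {d : ℕ → ℂ} (hF : DifferentiableOn ℂ F (ball 0 1))
    (hm : Measurable F)
    (hi : IntegrableOn (fun z => F z * (1 - (‖z‖ : ℂ) ^ 2)) (ball (0 : ℂ) 1))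
    (hG : ∀ z ∈ ball (0 : ℂ) 1, HasSum (fun n => d n * z ^ n) (G z)) {r : ℝ} (h0 : 0 ≤ r)
    (h1 : r < 1) :
    HasSum (fun n : ℕ => d n * (r : ℂ) ^ n *
        (Real.pi * (coeff F n / (((n : ℂ) + 1) * ((n : ℂ) + 2)))))
      (∫ z in ball (0 : ℂ) 1, F z * (1 - (‖z‖ : ℂ) ^ 2) * G (r * (starRingEnd ℂ) z)) := by
  have hd := diskSummable_of_hasSum hG
  have hnorm : ∀ n, ∀ z ∈ ball (0 : ℂ) 1,
      ‖d n * (r : ℂ) ^ n * (F z * (1 - (‖z‖ : ℂ) ^ 2) * (starRingEnd ℂ) z ^ n)‖ ≤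
        ‖d n‖ * r ^ n * ‖F z * (1 - (‖z‖ : ℂ) ^ 2)‖ := by
    intro n z hz
    rw [norm_mul, norm_mul (d n), norm_pow, Complex.norm_real, Real.norm_of_nonneg h0,
      norm_mul _ ((starRingEnd ℂ) z ^ n), norm_pow, RCLike.norm_conj]
    gcongr
    exact mul_le_of_le_one_right (norm_nonneg _)
      (pow_le_one₀ (norm_nonneg z) (mem_ball_zero_iff.1 hz).le)
  have hint : ∀ n, IntegrableOn (fun z => d n * (r : ℂ) ^ n *
      (F z * (1 - (‖z‖ : ℂ) ^ 2) * (starRingEnd ℂ) z ^ n)) (ball (0 : ℂ) 1) := by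
    intro n
    have hconj : Measurable fun z : ℂ => (starRingEnd ℂ) z ^ n :=
      (Complex.continuous_conj.pow n).measurable
    have hmeas : Measurable fun z : ℂ => d n * (r : ℂ) ^ n *
        (F z * (1 - (‖z‖ : ℂ) ^ 2) * (starRingEnd ℂ) z ^ n) := by
      refine measurable_const.mul (Measurable.mul ?_ hconj)
      fun_prop
    refine (hi.norm.const_mul (‖d n‖ * r ^ n)).mono' hmeas.aestronglyMeasurable ?_
    filter_upwards [ae_restrict_mem measurableSet_ball] with z hz using hnorm n z hz
  have hsum : Summable fun n => ∫ z in ball (0 : ℂ) 1, ‖d n * (r : ℂ) ^ n *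
      (F z * (1 - (‖z‖ : ℂ) ^ 2) * (starRingEnd ℂ) z ^ n)‖ := by
    refine ((hd r h0 h1).mul_right
      (∫ z in ball (0 : ℂ) 1, ‖F z * (1 - (‖z‖ : ℂ) ^ 2)‖)).of_nonneg_of_le
      (fun n => integral_nonneg fun z => norm_nonneg _) fun n => ?_
    rw [← integral_const_mul]
    exact setIntegral_mono_on (hint n).norm (hi.norm.const_mul _) measurableSet_ball (hnorm n)
  have h := hasSum_integral_of_summable_integral_norm hint hsum
  simp_rw [integral_const_mul, integral_ball_mul_conj_pow hF hm hi] at h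
  have key : ∀ z ∈ ball (0 : ℂ) 1, F z * (1 - (‖z‖ : ℂ) ^ 2) * G (r * (starRingEnd ℂ) z) =
      ∑' n, d n * (r : ℂ) ^ n * (F z * (1 - (‖z‖ : ℂ) ^ 2) * (starRingEnd ℂ) z ^ n) := by
    intro z hz
    have hz' : (r : ℂ) * (starRingEnd ℂ) z ∈ ball (0 : ℂ) 1 := by
      rw [mem_ball_zero_iff] at hz ⊢
      rw [norm_mul, RCLike.norm_conj, Complex.norm_real, Real.norm_of_nonneg h0]
      nlinarith [norm_nonneg z]
    refine (HasSum.tsum_eq ?_).symm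
    refine ((hG _ hz').mul_left (F z * (1 - (‖z‖ : ℂ) ^ 2))).congr_fun fun n => ?_
    rw [mul_pow]
    ring
  rw [setIntegral_congr_fun measurableSet_ball key]
  exact h

/-- The function with Taylor coefficients `(n + 2) ĝ(n + 1)`. -/
def conjugateKernel (g : ℂ → ℂ) (z : ℂ) : ℂ := deriv g z + dslope g 0 z

theorem hasSum_conjugateKernel {g : ℂ → ℂ} (hg : g ∈ holDisk) {z : ℂ} (hz : z ∈ ball (0 : ℂ) 1) :
    HasSum (fun n : ℕ => ((n : ℂ) + 2) * coeff g (n + 1) * z ^ n) (conjugateKernel g z) := by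
  have h1 := hasSum_deriv hg hz
  have h2 : HasSum (fun n : ℕ => coeff g (n + 1) * z ^ n) (dslope g 0 z) := by
    by_cases h0 : z = 0
    · subst h0
      rw [dslope_same]
      have h3 := hasSum_single (f := fun n : ℕ => coeff g (n + 1) * 0 ^ n) 0
        (fun n hn => by simp [hn])
      simpa [coeff] using h3
    · rw [dslope_of_ne _ h0, slope_def_field, sub_zero]
      have h3 := ((hasSum_nat_add_iff' 1).2 (hasSum_coeff hg hz)).div_const z
      simp only [Finset.range_one, Finset.sum_singleton, pow_zero, mul_one, coeff_zero_eq] at h3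
      refine h3.congr_fun fun n => ?_
      rw [pow_succ]
      field_simp
  refine (h1.add h2).congr_fun fun n => ?_
  ring

theorem continuousOn_conjugateKernel {g : ℂ → ℂ} (hg : g ∈ holDisk) :
    ContinuousOn (conjugateKernel g) (ball 0 1) := by
  refine ContinuousOn.add (hg.1.deriv isOpen_ball).continuousOn ?_
  refine ((Complex.differentiableOn_dslope (isOpen_ball.mem_nhds (mem_ball_self one_pos))).2
    hg.1).continuousOn

theorem norm_conjugateKernel_le {g : ℂ → ℂ} (hg : g ∈ holDisk) {z : ℂ} (hz : ‖z‖ < 1) {B : ℝ}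
    (hB : ∀ ζ : ℂ, ‖ζ‖ ≤ ‖z‖ → ‖deriv g ζ‖ ≤ B) : ‖conjugateKernel g z‖ ≤ 2 * B := by
  have h1 := hB z le_rfl
  have h2 : ‖dslope g 0 z‖ ≤ B := by
    by_cases h0 : z = 0
    · subst h0
      rw [dslope_same]
      exact h1
    · rw [dslope_of_ne _ h0, slope_def_field, norm_div, sub_zero,
        div_le_iff₀ (norm_pos_iff.2 h0)]
      have := (convex_closedBall (0 : ℂ) ‖z‖).norm_image_sub_le_of_norm_deriv_le
        (f := g) (x := 0) (y := z) (C := B)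
        (fun x hx => hg.1.differentiableAt (isOpen_ball.mem_nhds
          (mem_ball_zero_iff.2 ((mem_closedBall_zero_iff.1 hx).trans_lt hz))))
        (fun x hx => hB x (mem_closedBall_zero_iff.1 hx)) (by simp) (by simp)
      simpa using this
  calc _ ≤ ‖deriv g z‖ + ‖dslope g 0 z‖ := norm_add_le _ _
    _ ≤ _ := by linarith

theorem Bloch.norm_deriv_le {w : Weight} (g : Bloch w) {z : ℂ} (hz : ‖z‖ < 1) :
    ‖deriv g.fn z‖ ≤ ‖g‖ * ((1 - ‖z‖)⁻¹ * w ‖z‖) := by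
  have h1 : g.density ⟨z, mem_ball_zero_iff.2 hz⟩ ≤ ‖g‖ := by
    have := le_ciSup g.bddAbove_density ⟨z, mem_ball_zero_iff.2 hz⟩
    have h2 := norm_nonneg (g.fn 0)
    rw [Bloch.norm_def]
    change _ ≤ _ + ⨆ z, g.density z
    linarith
  have hw := w.pos _ (norm_nonneg z) hz
  have h2 : 0 < 1 - ‖z‖ := by linarith
  calc ‖deriv g.fn z‖ = g.density ⟨z, mem_ball_zero_iff.2 hz⟩ * ((1 - ‖z‖)⁻¹ * w ‖z‖) := by
        simp only [Bloch.density]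
        field_simp
    _ ≤ _ := by gcongr

theorem Bloch.norm_apply_zero_le {w : Weight} (g : Bloch w) : ‖g.fn 0‖ ≤ ‖g‖ := by
  rw [Bloch.norm_def]
  exact le_add_of_nonneg_right (Real.iSup_nonneg g.density_nonneg)

theorem Bloch1.norm_apply_zero_le {w : Weight} (f : Bloch1 w) : ‖f.fn 0‖ ≤ ‖f‖ := by
  rw [Bloch1.norm_def]
  exact le_add_of_nonneg_right f.energy_nonneg

theorem Bloch1.integral_le {w : Weight} (f : Bloch1 w) :
    ∫ z in ball (0 : ℂ) 1, ‖deriv f.fn z‖ * w ‖z‖ ≤ Real.pi * ‖f‖ := by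
  rw [Bloch1.norm_def, mul_add, mul_inv_cancel_left₀ Real.pi_ne_zero]
  exact le_add_of_nonneg_left (by positivity)

/-- The Abel pairing of `𝔅¹_w` and `𝔅_w` exists and is bounded. -/
theorem IsSlow.exists_pairing {w : Weight} (hw : IsSlow w) :
    ∃ C : ℝ, 0 < C ∧ ∀ (f : Bloch1 w) (g : Bloch w), ∃ L : ℂ,
      HasAbelPairing f.fn g.fn L ∧ ‖L‖ ≤ C * ‖f‖ * ‖g‖ := by
  obtain ⟨C, hC, hmono⟩ := hw.almost_mono
  obtain ⟨c, hc, hlow⟩ := hw.lower_linear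
  refine ⟨1 + 4 * C, by positivity, fun f g => ?_⟩
  have hf : f.fn ∈ holDisk := f.2.1
  have hg : g.fn ∈ holDisk := g.2.1
  have hfi : IntegrableOn (fun z => ‖deriv f.fn z‖ * w ‖z‖) (ball (0 : ℂ) 1) := f.2.2
  have hF : DifferentiableOn ℂ (deriv f.fn) (ball 0 1) := hf.1.deriv isOpen_ball
  have hsq : ∀ z : ℂ, ‖z‖ < 1 → ‖1 - (‖z‖ : ℂ) ^ 2‖ = 1 - ‖z‖ ^ 2 := by
    intro z hz
    have : 1 - (‖z‖ : ℂ) ^ 2 = ((1 - ‖z‖ ^ 2 : ℝ) : ℂ) := by push_cast; rfl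
    rw [this, Complex.norm_real, Real.norm_of_nonneg]
    nlinarith [norm_nonneg z]
  have hsq2 : ∀ z : ℂ, ‖z‖ < 1 → 1 - ‖z‖ ^ 2 ≤ 2 * (1 - ‖z‖) := fun z hz => by
    nlinarith [norm_nonneg z]
  have hi : IntegrableOn (fun z => deriv f.fn z * (1 - (‖z‖ : ℂ) ^ 2)) (ball (0 : ℂ) 1) := by
    refine (hfi.const_mul (2 / c)).mono' ?_ ?_
    · have := measurable_deriv f.fn
      exact Measurable.aestronglyMeasurable (by fun_prop)
    · filter_upwards [ae_restrict_mem measurableSet_ball] with z hz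
      have hz' := mem_ball_zero_iff.1 hz
      rw [norm_mul, hsq z hz']
      have h1 : 1 - ‖z‖ ^ 2 ≤ 2 / c * w ‖z‖ := by
        refine (hsq2 z hz').trans ?_
        rw [div_mul_eq_mul_div, le_div_iff₀ hc]
        linarith [hlow ‖z‖ (norm_nonneg z) hz']
      calc _ ≤ ‖deriv f.fn z‖ * (2 / c * w ‖z‖) := by gcongr
        _ = _ := by ring
  -- A majorant independent of r: the kernel is evaluated at radius r|z| ≤ |z|, where almost
  -- monotonicity costs C. One factor 2 comes from 1 - |z|² ≤ 2(1 - |z|), the other from the two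
  -- terms of the kernel.
  have hK : ∀ (r : ℝ) (z : ℂ), 0 ≤ r → r ≤ 1 → ‖z‖ < 1 →
      ‖deriv f.fn z * (1 - (‖z‖ : ℂ) ^ 2) * conjugateKernel g.fn (r * (starRingEnd ℂ) z)‖ ≤
        (4 * C * ‖g‖) * (‖deriv f.fn z‖ * w ‖z‖) := by
    intro r z h0 h1 hz
    have hw' := w.pos _ (norm_nonneg z) hz
    have hz1 : 0 < 1 - ‖z‖ := by linarith
    have hn : ‖(r : ℂ) * (starRingEnd ℂ) z‖ ≤ ‖z‖ := by
      rw [norm_mul, RCLike.norm_conj, Complex.norm_real, Real.norm_of_nonneg h0]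
      exact mul_le_of_le_one_left (norm_nonneg z) h1
    have h2 := norm_conjugateKernel_le hg (hn.trans_lt hz)
      (B := ‖g‖ * (C * ((1 - ‖z‖)⁻¹ * w ‖z‖))) (fun ζ hζ => by
        refine (g.norm_deriv_le (hζ.trans_lt (hn.trans_lt hz))).trans ?_
        exact mul_le_mul_of_nonneg_left (hmono _ _ (norm_nonneg ζ) (hζ.trans hn) hz)
          (norm_nonneg g))
    rw [norm_mul, norm_mul, hsq z hz]
    calc _ ≤ ‖deriv f.fn z‖ * (2 * (1 - ‖z‖)) * (2 * (‖g‖ * (C * ((1 - ‖z‖)⁻¹ * w ‖z‖)))) := by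
          gcongr
          exact hsq2 z hz
      _ = _ := by field_simp; ring
  -- The term of index n + 1 carries r^{2n+2} = r² (r²)ⁿ, hence the outer r² and the dilation of the
  -- kernel by r².
  have hmain : ∀ r : ℝ, 0 < r → r < 1 → abelMean f.fn g.fn r = f.fn 0 * g.fn 0 +
      (r : ℂ) ^ 2 * ((Real.pi : ℂ)⁻¹ * ∫ z in ball (0 : ℂ) 1,
        deriv f.fn z * (1 - (‖z‖ : ℂ) ^ 2) *
          conjugateKernel g.fn ((r ^ 2 : ℝ) * (starRingEnd ℂ) z)) := by
    intro r h0 h1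
    have h2 := hasSum_integral_mul_conj hF (measurable_deriv _) hi
      (fun z hz => hasSum_conjugateKernel hg hz) (r := r ^ 2) (by positivity)
      (pow_lt_one₀ h0.le h1 two_ne_zero)
    have h3 : ∀ n : ℕ, coeff (deriv f.fn) n = ((n : ℂ) + 1) * coeff f.fn (n + 1) :=
      coeff_eq_of_hasSum fun z hz => hasSum_deriv hf hz
    have h4 := (h2.mul_left ((Real.pi : ℂ)⁻¹)).mul_left ((r : ℂ) ^ 2)
    rw [abelMean, ((diskSummable_coeff hf).abel (diskSummable_coeff hg) h0.le h1).tsum_eq_zero_add,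
      ← h4.tsum_eq]
    simp only [mul_zero, pow_zero, mul_one, coeff_zero_eq]
    congr 1
    refine tsum_congr fun n => ?_
    rw [h3]
    have h5 : (n : ℂ) + 1 ≠ 0 := by exact_mod_cast n.succ_ne_zero
    have h6 : (n : ℂ) + 2 ≠ 0 := by exact_mod_cast (n + 1).succ_ne_zero
    have h7 : (Real.pi : ℂ) ≠ 0 := by exact_mod_cast Real.pi_ne_zero
    push_cast
    field_simp
    ring
  let L : ℂ := f.fn 0 * g.fn 0 + (Real.pi : ℂ)⁻¹ * ∫ z in ball (0 : ℂ) 1,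
        deriv f.fn z * (1 - (‖z‖ : ℂ) ^ 2) * conjugateKernel g.fn ((starRingEnd ℂ) z)
  have hmeasK : ∀ r : ℝ, 0 ≤ r → r ≤ 1 → AEStronglyMeasurable (fun z : ℂ =>
      deriv f.fn z * (1 - (‖z‖ : ℂ) ^ 2) * conjugateKernel g.fn (r * (starRingEnd ℂ) z))
      (volume.restrict (ball 0 1)) := by
    intro r h0 h1
    refine ContinuousOn.aestronglyMeasurable ?_ measurableSet_ball
    refine ContinuousOn.mul (hF.continuousOn.mul (by fun_prop)) ?_
    refine (continuousOn_conjugateKernel hg).comp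
      (Continuous.continuousOn (continuous_const.mul Complex.continuous_conj)) fun z hz => ?_
    rw [mem_ball_zero_iff] at hz ⊢
    rw [norm_mul, RCLike.norm_conj, Complex.norm_real, Real.norm_of_nonneg h0]
    nlinarith [norm_nonneg z]
  refine ⟨L, ?_, ?_⟩
  · have hlim : Tendsto (fun r : ℝ => f.fn 0 * g.fn 0 +
        (r : ℂ) ^ 2 * ((Real.pi : ℂ)⁻¹ * ∫ z in ball (0 : ℂ) 1,
        deriv f.fn z * (1 - (‖z‖ : ℂ) ^ 2) *
          conjugateKernel g.fn ((r ^ 2 : ℝ) * (starRingEnd ℂ) z))) (𝓝[<] 1)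
        (𝓝 (f.fn 0 * g.fn 0 + ((1 : ℝ) : ℂ) ^ 2 * ((Real.pi : ℂ)⁻¹ * ∫ z in ball (0 : ℂ) 1,
        deriv f.fn z * (1 - (‖z‖ : ℂ) ^ 2) * conjugateKernel g.fn ((starRingEnd ℂ) z)))) := by
      refine Tendsto.const_add _ (Tendsto.mul ?_ (Tendsto.const_mul _ ?_))
      · exact (Continuous.tendsto (by fun_prop) 1).mono_left nhdsWithin_le_nhds
      · refine tendsto_integral_filter_of_dominated_convergence
          (fun z => (4 * C * ‖g‖) * (‖deriv f.fn z‖ * w ‖z‖)) ?_ ?_ (hfi.const_mul _) ?_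
        · filter_upwards [eventually_mem_Ioo_nhdsLT_one] with r ⟨h0, h1⟩
          exact hmeasK _ (by positivity) (pow_le_one₀ h0.le h1.le)
        · filter_upwards [eventually_mem_Ioo_nhdsLT_one] with r ⟨h0, h1⟩
          filter_upwards [ae_restrict_mem measurableSet_ball] with z hz
          exact hK _ z (by positivity) (pow_le_one₀ h0.le h1.le) (mem_ball_zero_iff.1 hz)
        · filter_upwards [ae_restrict_mem measurableSet_ball] with z hz
          refine Tendsto.const_mul _ ?_
          have hz' : (starRingEnd ℂ) z ∈ ball (0 : ℂ) 1 := by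
            rw [mem_ball_zero_iff, RCLike.norm_conj]; exact mem_ball_zero_iff.1 hz
          have h5 := ((continuousOn_conjugateKernel hg).continuousAt
            (isOpen_ball.mem_nhds hz')).tendsto
          refine h5.comp ?_
          have h6 : Tendsto (fun r : ℝ => ((r ^ 2 : ℝ) : ℂ) * (starRingEnd ℂ) z) (𝓝[<] 1)
              (𝓝 (((1 ^ 2 : ℝ) : ℂ) * (starRingEnd ℂ) z)) :=
            (Continuous.tendsto (by fun_prop) 1).mono_left nhdsWithin_le_nhds
          simpa using h6
    have hL : f.fn 0 * g.fn 0 + ((1 : ℝ) : ℂ) ^ 2 * ((Real.pi : ℂ)⁻¹ * ∫ z in ball (0 : ℂ) 1,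
        deriv f.fn z * (1 - (‖z‖ : ℂ) ^ 2) * conjugateKernel g.fn ((starRingEnd ℂ) z)) = L := by
      simp [L]
    rw [hL] at hlim
    refine hlim.congr' ?_
    filter_upwards [eventually_mem_Ioo_nhdsLT_one] with r ⟨h0, h1⟩
    exact (hmain r h0 h1).symm
  · have h1 : ‖∫ z in ball (0 : ℂ) 1, deriv f.fn z * (1 - (‖z‖ : ℂ) ^ 2) *
        conjugateKernel g.fn ((starRingEnd ℂ) z)‖ ≤ 4 * C * ‖g‖ * (Real.pi * ‖f‖) := by
      refine (norm_integral_le_of_norm_le (hfi.const_mul (4 * C * ‖g‖)) ?_).trans ?_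
      · filter_upwards [ae_restrict_mem measurableSet_ball] with z hz
        simpa using hK 1 z zero_le_one le_rfl (mem_ball_zero_iff.1 hz)
      · rw [integral_const_mul]
        gcongr
        exact f.integral_le
    calc ‖L‖ ≤ ‖f.fn 0 * g.fn 0‖ + ‖(Real.pi : ℂ)⁻¹ * ∫ z in ball (0 : ℂ) 1,
          deriv f.fn z * (1 - (‖z‖ : ℂ) ^ 2) * conjugateKernel g.fn ((starRingEnd ℂ) z)‖ :=
          norm_add_le _ _
      _ ≤ ‖f‖ * ‖g‖ + Real.pi⁻¹ * (4 * C * ‖g‖ * (Real.pi * ‖f‖)) := by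
          rw [norm_mul, norm_mul, norm_inv, Complex.norm_real, Real.norm_of_nonneg Real.pi_pos.le]
          gcongr
          · exact f.norm_apply_zero_le
          · exact g.norm_apply_zero_le
      _ = _ := by field_simp


/-! ### Integral means -/

theorem circleAverage_comp_mul {E : Type*} [NormedAddCommGroup E] [NormedSpace ℝ E] (g : ℂ → E)
    (η : ℝ) :
    Real.circleAverage (fun x => g (circleMap 0 1 η * x)) 0 1 = Real.circleAverage g 0 1 := by
  rw [Real.circleAverage_eq_integral_add (f := g) η, Real.circleAverage_def]
  congr 2
  funext θ
  rw [circleMap_zero_mul, mul_one, add_comm]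

/-- The integral means of a holomorphic function increase with the radius. -/
theorem circleAverage_norm_mono {F : ℂ → ℂ} (hF : DifferentiableOn ℂ F (ball 0 1)) {r s : ℝ}
    (h0 : 0 < r) (hrs : r ≤ s) (h1 : s < 1) :
    Real.circleAverage (fun z => ‖F z‖) 0 r ≤ Real.circleAverage (fun z => ‖F z‖) 0 s := by
  have hs : 0 < s := h0.trans_le hrs
  have hFc : ContinuousOn F (ball 0 1) := hF.continuousOn
  obtain ⟨c, hc⟩ : ∃ c : ℕ → ℂ, ∀ z ∈ ball (0 : ℂ) 1, HasSum (fun n => c n * z ^ n) (F z) := by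
    refine ⟨coeff F, fun z hz => ?_⟩
    refine (Complex.hasSum_taylorSeries_on_ball hF hz).congr_fun fun n => ?_
    simp only [coeff, smul_eq_mul, sub_zero]
    ring
  have hd := diskSummable_of_hasSum hc
  have hmem : ∀ z : ℂ, ‖z‖ < 1 → ∀ θ, z * circleMap 0 1 θ ∈ ball (0 : ℂ) 1 := by
    intro z hz θ
    rwa [mem_ball_zero_iff, norm_mul, norm_circleMap_zero, abs_one, mul_one]
  have hcont : ∀ z : ℂ, ‖z‖ < 1 → Continuous fun θ => F (z * circleMap 0 1 θ) := by
    intro z hz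
    exact hFc.comp_continuous (by fun_prop) (hmem z hz)
  have hr1 : ‖(r : ℂ)‖ < 1 := by
    rw [Complex.norm_real, Real.norm_of_nonneg h0.le]; linarith
  -- The conjugate phase of F on the circle of radius r, equal to 0 where F vanishes. The function
  -- H(z) = ∫ F(z e^{iθ}) φ(θ) dθ is a power series in z, equals 2π times the mean of |F| at z = r,
  -- and is at most 2π times the mean over radius s when |z| = s. The maximum principle then
  -- compares the two means.
  let φ : ℝ → ℂ := fun θ => (starRingEnd ℂ) (F (r * circleMap 0 1 θ)) *
    ((‖F (r * circleMap 0 1 θ)‖⁻¹ : ℝ) : ℂ)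
  have hφm : Measurable φ := by
    have := (hcont r hr1).measurable
    refine (Complex.continuous_conj.measurable.comp this).mul ?_
    exact Complex.measurable_ofReal.comp this.norm.inv
  have hφ1 : ∀ θ, ‖φ θ‖ ≤ 1 := by
    intro θ
    simp only [φ]
    rw [norm_mul, RCLike.norm_conj, Complex.norm_real, norm_inv, norm_norm]
    exact mul_inv_le_one
  have hφF : ∀ θ, F (r * circleMap 0 1 θ) * φ θ = ((‖F (r * circleMap 0 1 θ)‖ : ℝ) : ℂ) := by
    intro θ
    simp only [φ]
    rw [← mul_assoc, Complex.mul_conj', Complex.ofReal_inv, pow_two]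
    by_cases h : (‖F (r * circleMap 0 1 θ)‖ : ℂ) = 0
    · simp [h]
    · field_simp
  let μ : Measure ℝ := volume.restrict (Set.Ioc 0 (2 * Real.pi))
  let a : ℕ → ℂ := fun n => ∫ θ, circleMap 0 1 θ ^ n * φ θ ∂μ
  have hH : ∀ z ∈ ball (0 : ℂ) 1,
      HasSum (fun n => c n * a n * z ^ n) (∫ θ, F (z * circleMap 0 1 θ) * φ θ ∂μ) := by
    intro z hz
    have hz' := mem_ball_zero_iff.1 hz
    have hmeas : ∀ n, Measurable fun θ => c n * z ^ n * (circleMap 0 1 θ ^ n * φ θ) := by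
      intro n
      have : Measurable fun θ => circleMap 0 1 θ :=
        (continuous_circleMap 0 1).measurable
      fun_prop
    have hle : ∀ n θ, ‖c n * z ^ n * (circleMap 0 1 θ ^ n * φ θ)‖ ≤ ‖c n‖ * ‖z‖ ^ n := by
      intro n θ
      rw [norm_mul, norm_mul, norm_pow, norm_mul, norm_pow, norm_circleMap_zero, abs_one, one_pow,
        one_mul]
      exact mul_le_of_le_one_right (by positivity) (hφ1 θ)
    have hint : ∀ n, Integrable (fun θ => c n * z ^ n * (circleMap 0 1 θ ^ n * φ θ)) μ :=
      fun n => (integrable_const (‖c n‖ * ‖z‖ ^ n)).mono' (hmeas n).aestronglyMeasurable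
        (Eventually.of_forall (hle n))
    have hsum : Summable fun n => ∫ θ, ‖c n * z ^ n * (circleMap 0 1 θ ^ n * φ θ)‖ ∂μ := by
      refine ((hd ‖z‖ (norm_nonneg z) hz').mul_left (μ.real Set.univ)).of_nonneg_of_le
        (fun n => integral_nonneg fun θ => norm_nonneg _) fun n => ?_
      refine (integral_mono (hint n).norm (integrable_const _) (hle n)).trans ?_
      rw [integral_const, smul_eq_mul]
    have h := hasSum_integral_of_summable_integral_norm hint hsum
    have h2 : ∀ θ, ∑' n, c n * z ^ n * (circleMap 0 1 θ ^ n * φ θ) =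
        F (z * circleMap 0 1 θ) * φ θ := by
      intro θ
      refine HasSum.tsum_eq ?_
      refine ((hc _ (hmem z hz' θ)).mul_right (φ θ)).congr_fun fun n => ?_
      rw [mul_pow]
      ring
    simp_rw [h2, integral_const_mul] at h
    refine h.congr_fun fun n => ?_
    simp only [a]
    ring
  have hda := diskSummable_of_hasSum hH
  have hHz : ∀ z ∈ ball (0 : ℂ) 1, powerSum (fun n => c n * a n) z =
      ∫ θ, F (z * circleMap 0 1 θ) * φ θ ∂μ := fun z hz =>
    (hasSum_powerSum hda hz).unique (hH z hz)
  have hpi := Real.pi_pos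
  have hbound : ∀ z ∈ frontier (ball (0 : ℂ) s), ‖powerSum (fun n => c n * a n) z‖ ≤
      (2 * Real.pi) * Real.circleAverage (fun z => ‖F z‖) 0 s := by
    intro z hz
    rw [frontier_ball _ hs.ne', mem_sphere_zero_iff_norm] at hz
    have hz1 : ‖z‖ < 1 := by rwa [hz]
    rw [hHz z (mem_ball_zero_iff.2 hz1)]
    have h2 : ‖∫ θ, F (z * circleMap 0 1 θ) * φ θ ∂μ‖ ≤ ∫ θ, ‖F (z * circleMap 0 1 θ)‖ ∂μ := by
      refine norm_integral_le_of_norm_le ?_ (Eventually.of_forall fun θ => ?_)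
      · exact ((hcont z hz1).norm.integrableOn_Icc).mono_set Set.Ioc_subset_Icc_self
      · rw [norm_mul]
        exact mul_le_of_le_one_right (norm_nonneg _) (hφ1 θ)
    have hzarg : z = s * circleMap 0 1 (Complex.arg z) := by
      rw [circleMap_zero, Complex.ofReal_one, one_mul, ← hz, Complex.norm_mul_exp_arg_mul_I]
    have h3 : Real.circleAverage (fun x => ‖F (z * x)‖) 0 1 =
        Real.circleAverage (fun z => ‖F z‖) 0 s := by
      rw [Real.circleAverage_eq_circleAverage_zero_one (R := s), ← circleAverage_comp_mul
        (fun x => ‖F (s * x + 0)‖) (Complex.arg z)]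
      congr 1
      funext x
      rw [add_zero, ← mul_assoc, ← hzarg]
    rw [← h3, Real.circleAverage_def, smul_eq_mul, mul_inv_cancel_left₀ (by positivity),
      intervalIntegral.integral_of_le (by positivity)]
    exact h2
  have hdiff : DiffContOnCl ℂ (powerSum fun n => c n * a n) (ball 0 s) := by
    refine DifferentiableOn.diffContOnCl ((powerSum_mem_holDisk hda).1.mono ?_)
    exact closure_ball_subset_closedBall.trans (closedBall_subset_ball h1)
  have h2 := Complex.norm_le_of_forall_mem_frontier_norm_le isBounded_ball hdiff hbound
    (z := (r : ℂ)) (by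
      rw [closure_ball _ hs.ne', mem_closedBall_zero_iff, Complex.norm_real,
        Real.norm_of_nonneg h0.le]
      exact hrs)
  rw [hHz _ (mem_ball_zero_iff.2 hr1)] at h2
  simp_rw [hφF] at h2
  rw [integral_complex_ofReal, Complex.norm_real,
    Real.norm_of_nonneg (integral_nonneg fun θ => norm_nonneg _)] at h2
  have h3 : Real.circleAverage (fun z => ‖F z‖) 0 r =
      (2 * Real.pi)⁻¹ * ∫ θ, ‖F (r * circleMap 0 1 θ)‖ ∂μ := by
    rw [Real.circleAverage_eq_circleAverage_zero_one, Real.circleAverage_def,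
      intervalIntegral.integral_of_le (by positivity), smul_eq_mul]
    simp [μ]
  rw [h3]
  calc _ ≤ (2 * Real.pi)⁻¹ * ((2 * Real.pi) * Real.circleAverage (fun z => ‖F z‖) 0 s) := by
        gcongr
    _ = _ := by field_simp

theorem lintegral_circle_eq {F : ℂ → ℂ} (hF : ContinuousOn F (ball 0 1)) {s : ℝ} (h0 : 0 < s)
    (h1 : s < 1) : ∫⁻ θ in Set.Ioo (-Real.pi) Real.pi, ENNReal.ofReal ‖F (circleMap 0 s θ)‖ =
      ENNReal.ofReal (2 * Real.pi * Real.circleAverage (fun z => ‖F z‖) 0 s) := by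
  have hc : Continuous fun θ => ‖F (circleMap 0 s θ)‖ :=
    (hF.comp_continuous (continuous_circleMap 0 s)
      fun θ => (circleMap_mem_ball_iff h0).2 h1).norm
  rw [← ofReal_integral_eq_lintegral_ofReal
    ((hc.integrableOn_Icc (a := -Real.pi) (b := Real.pi)).mono_set Set.Ioo_subset_Icc_self)
    (Eventually.of_forall fun θ => norm_nonneg _), setIntegral_circleMap (fun z => ‖F z‖) s,
    smul_eq_mul]

theorem lintegral_circle_mono {F : ℂ → ℂ} (hF : DifferentiableOn ℂ F (ball 0 1)) {r s : ℝ}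
    (h0 : 0 < r) (hrs : r ≤ s) (h1 : s < 1) :
    ∫⁻ θ in Set.Ioo (-Real.pi) Real.pi, ENNReal.ofReal ‖F (circleMap 0 r θ)‖ ≤
      ∫⁻ θ in Set.Ioo (-Real.pi) Real.pi, ENNReal.ofReal ‖F (circleMap 0 s θ)‖ := by
  rw [lintegral_circle_eq hF.continuousOn h0 (hrs.trans_lt h1),
    lintegral_circle_eq hF.continuousOn (h0.trans_le hrs) h1]
  refine ENNReal.ofReal_le_ofReal ?_
  have := Real.pi_pos
  gcongr
  exact circleAverage_norm_mono hF h0 hrs h1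

/-! ### Dilations -/

/-- The coefficients of the dilation `f_r(z) = f (r z)`. -/
def dilateSeq (f : ℂ → ℂ) (r : ℝ) (n : ℕ) : ℂ := coeff f n * (r : ℂ) ^ n

theorem mul_mem_ball {r : ℝ} (h0 : 0 ≤ r) (h1 : r ≤ 1) {z : ℂ} (hz : z ∈ ball (0 : ℂ) 1) :
    (r : ℂ) * z ∈ ball (0 : ℂ) 1 := by
  rw [mem_ball_zero_iff] at hz ⊢
  rw [norm_mul, Complex.norm_real, Real.norm_of_nonneg h0]
  nlinarith [norm_nonneg z]

theorem diskSummable_dilateSeq {f : ℂ → ℂ} (hf : f ∈ holDisk) {r : ℝ} (h0 : 0 ≤ r) (h1 : r ≤ 1) :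
    DiskSummable (dilateSeq f r) :=
  (diskSummable_coeff hf).mono fun n => by
    rw [dilateSeq, norm_mul, norm_pow, Complex.norm_real, Real.norm_of_nonneg h0]
    exact mul_le_of_le_one_right (norm_nonneg _) (pow_le_one₀ h0 h1)

theorem deriv_dilate {f : ℂ → ℂ} (hf : f ∈ holDisk) {r : ℝ} (h0 : 0 ≤ r) (h1 : r ≤ 1) {z : ℂ}
    (hz : z ∈ ball (0 : ℂ) 1) :
    deriv (powerSum (dilateSeq f r)) z = r * deriv f (r * z) := by
  refine (hasSum_deriv_powerSum (diskSummable_dilateSeq hf h0 h1) hz).unique ?_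
  refine ((hasSum_deriv hf (mul_mem_ball h0 h1 hz)).mul_left (r : ℂ)).congr_fun fun n => ?_
  rw [dilateSeq, mul_pow, pow_succ]
  ring

/-- For F = f' the function r F(rz) is the derivative of the dilation f_r. Uniform continuity on a
compact disk controls F(rz) - F(z), and boundedness controls (1 - r) F(rz). -/
theorem eventually_dilate_close {F : ℂ → ℂ} (hF : ContinuousOn F (ball 0 1)) {R : ℝ} (hR : R < 1)
    {ε : ℝ} (hε : 0 < ε) :
    ∀ᶠ r : ℝ in 𝓝[<] 1, ∀ z : ℂ, ‖z‖ ≤ R → ‖r * F (r * z) - F z‖ ≤ ε := by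
  have hK : IsCompact (closedBall (0 : ℂ) R) := isCompact_closedBall 0 R
  have hFK : ContinuousOn F (closedBall 0 R) := hF.mono (closedBall_subset_ball hR)
  obtain ⟨M, hM⟩ := hK.exists_bound_of_continuousOn hFK
  have huc := Metric.uniformContinuousOn_iff.1 (hK.uniformContinuousOn_of_continuous hFK)
  obtain ⟨δ, hδ, hδF⟩ := huc (ε / 2) (by positivity)
  have h1 : ∀ᶠ r : ℝ in 𝓝[<] 1, 1 - r < min δ (ε / (2 * (|M| + 1))) := by
    have h2 : Tendsto (fun r : ℝ => 1 - r) (𝓝[<] 1) (𝓝 (1 - 1)) :=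
      (Continuous.tendsto (by fun_prop) 1).mono_left nhdsWithin_le_nhds
    rw [sub_self] at h2
    exact h2.eventually_lt_const (by positivity)
  filter_upwards [h1, eventually_mem_Ioo_nhdsLT_one] with r hr ⟨hr0, hr1⟩ z hz
  have hz1 : z ∈ closedBall (0 : ℂ) R := mem_closedBall_zero_iff.2 hz
  have hrz : (r : ℂ) * z ∈ closedBall (0 : ℂ) R := by
    rw [mem_closedBall_zero_iff, norm_mul, Complex.norm_real, Real.norm_of_nonneg hr0.le]
    nlinarith [norm_nonneg z]
  have hn : ‖(r : ℂ) - 1‖ = 1 - r := by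
    rw [← Complex.ofReal_one, ← Complex.ofReal_sub, Complex.norm_real, Real.norm_eq_abs,
      abs_sub_comm, abs_of_pos (by linarith)]
  have h3 : dist (F (r * z)) (F z) < ε / 2 := by
    refine hδF _ hrz _ hz1 ?_
    rw [dist_eq_norm, show (r : ℂ) * z - z = ((r : ℂ) - 1) * z by ring, norm_mul, hn]
    have := hr.trans_le (min_le_left _ _)
    nlinarith [norm_nonneg z]
  rw [dist_eq_norm] at h3
  have h4 : (1 - r) * (|M| + 1) ≤ ε / 2 := by
    have := (hr.trans_le (min_le_right _ _)).le
    rw [le_div_iff₀ (by positivity)] at this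
    linarith
  have h5 : ‖F (r * z)‖ ≤ |M| + 1 := (hM _ hrz).trans (by linarith [le_abs_self M])
  calc ‖r * F (r * z) - F z‖ = ‖((r : ℂ) - 1) * F (r * z) + (F (r * z) - F z)‖ := by
        congr 1; ring
    _ ≤ ‖((r : ℂ) - 1) * F (r * z)‖ + ‖F (r * z) - F z‖ := norm_add_le _ _
    _ ≤ (1 - r) * (|M| + 1) + ε / 2 := by
        rw [norm_mul, hn]
        gcongr
    _ ≤ ε := by linarith

/-- Rather than a pointwise majorant for F(rz) on the disk, the proof uses one in the radial
variable: circles are integrated first, and since integral means increase with the radius, twice the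
circle integral of |F| w is a majorant. -/
theorem tendsto_lintegral_dilate {F : ℂ → ℂ} (hF : DifferentiableOn ℂ F (ball 0 1))
    (hm : Measurable F) {w : Weight}
    (hi : IntegrableOn (fun z => ‖F z‖ * w ‖z‖) (ball (0 : ℂ) 1)) :
    Tendsto (fun r : ℝ => ∫⁻ z in ball (0 : ℂ) 1, ENNReal.ofReal (‖r * F (r * z) - F z‖ * w ‖z‖))
      (𝓝[<] 1) (𝓝 0) := by
  have hwm := w.measurable
  have hmr : ∀ r : ℝ, Measurable fun z : ℂ =>
      ENNReal.ofReal (‖r * F (r * z) - F z‖ * w ‖z‖) := fun r => by fun_prop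
  have hm0 : Measurable fun z : ℂ => ENNReal.ofReal (‖F z‖ * w ‖z‖) := by fun_prop
  have hin : ∀ {G : ℂ → ENNReal}, Measurable G → Measurable fun s : ℝ => ENNReal.ofReal s *
      ∫⁻ θ in Set.Ioo (-Real.pi) Real.pi, G (circleMap 0 s θ) := by
    intro G hG
    exact Measurable.mul (by fun_prop) ((hG.comp measurable_circleMap).lintegral_prod_right')
  have hfin : ∫⁻ s in Set.Ioo (0 : ℝ) 1, 2 * (ENNReal.ofReal s *
      ∫⁻ θ in Set.Ioo (-Real.pi) Real.pi,
        ENNReal.ofReal (‖F (circleMap 0 s θ)‖ * w ‖circleMap 0 s θ‖)) ≠ ⊤ := by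
    rw [lintegral_const_mul _ (hin hm0), ← lintegral_ball_polar hm0]
    refine ENNReal.mul_ne_top ENNReal.ofNat_ne_top ?_
    rw [← ofReal_integral_eq_lintegral_ofReal hi]
    · exact ENNReal.ofReal_ne_top
    · filter_upwards [ae_restrict_mem measurableSet_ball] with z hz
      have := w.pos _ (norm_nonneg z) (mem_ball_zero_iff.1 hz)
      positivity
  simp_rw [lintegral_ball_polar (hmr _)]
  have h := tendsto_lintegral_filter_of_dominated_convergence (μ := volume.restrict (Set.Ioo 0 1))
    (l := 𝓝[<] (1 : ℝ)) (F := fun (r s : ℝ) => ENNReal.ofReal s *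
      ∫⁻ θ in Set.Ioo (-Real.pi) Real.pi, ENNReal.ofReal
        (‖r * F (r * circleMap 0 s θ) - F (circleMap 0 s θ)‖ * w ‖circleMap 0 s θ‖))
    (f := fun _ => 0) _ (Eventually.of_forall fun r => hin (hmr r)) ?_ hfin ?_
  · simpa using h
  · filter_upwards [eventually_mem_Ioo_nhdsLT_one] with r ⟨hr0, hr1⟩
    filter_upwards [ae_restrict_mem measurableSet_Ioo] with s ⟨hs0, hs1⟩
    have hws := w.pos s hs0.le hs1
    have hnorm : ∀ θ, ‖circleMap 0 s θ‖ = s := fun θ => by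
      rw [norm_circleMap_zero, abs_of_pos hs0]
    have hmul : ∀ θ, (r : ℂ) * circleMap 0 s θ = circleMap 0 (r * s) θ := fun θ => by
      simp only [circleMap_zero]
      push_cast
      ring
    rw [mul_left_comm]
    gcongr ENNReal.ofReal s * ?_
    have h1 : ∀ θ, ENNReal.ofReal
        (‖r * F (r * circleMap 0 s θ) - F (circleMap 0 s θ)‖ * w ‖circleMap 0 s θ‖) ≤
        ENNReal.ofReal (w s) * (ENNReal.ofReal ‖F (circleMap 0 (r * s) θ)‖ +
          ENNReal.ofReal ‖F (circleMap 0 s θ)‖) := by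
      intro θ
      rw [← ENNReal.ofReal_add (norm_nonneg _) (norm_nonneg _), ← ENNReal.ofReal_mul hws.le]
      refine ENNReal.ofReal_le_ofReal ?_
      rw [hnorm, hmul, mul_comm]
      gcongr
      refine (norm_sub_le _ _).trans ?_
      gcongr
      rw [norm_mul, Complex.norm_real, Real.norm_of_nonneg hr0.le]
      exact mul_le_of_le_one_left (norm_nonneg _) hr1.le
    have hc : ∀ t : ℝ, Measurable fun θ => ENNReal.ofReal ‖F (circleMap 0 t θ)‖ := fun t =>
      (hm.comp (continuous_circleMap 0 t).measurable).norm.ennreal_ofReal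
    calc _ ≤ ∫⁻ θ in Set.Ioo (-Real.pi) Real.pi, ENNReal.ofReal (w s) *
            (ENNReal.ofReal ‖F (circleMap 0 (r * s) θ)‖ + ENNReal.ofReal ‖F (circleMap 0 s θ)‖) :=
          lintegral_mono h1
      _ = ENNReal.ofReal (w s) * ((∫⁻ θ in Set.Ioo (-Real.pi) Real.pi,
            ENNReal.ofReal ‖F (circleMap 0 (r * s) θ)‖) +
            ∫⁻ θ in Set.Ioo (-Real.pi) Real.pi, ENNReal.ofReal ‖F (circleMap 0 s θ)‖) := by
          rw [lintegral_const_mul' _ _ ENNReal.ofReal_ne_top, lintegral_add_left (hc _)]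
      _ ≤ ENNReal.ofReal (w s) * ((∫⁻ θ in Set.Ioo (-Real.pi) Real.pi,
            ENNReal.ofReal ‖F (circleMap 0 s θ)‖) +
            ∫⁻ θ in Set.Ioo (-Real.pi) Real.pi, ENNReal.ofReal ‖F (circleMap 0 s θ)‖) := by
          gcongr ENNReal.ofReal (w s) * (?_ + _)
          exact lintegral_circle_mono hF (by positivity) (by nlinarith) hs1
      _ = 2 * ∫⁻ θ in Set.Ioo (-Real.pi) Real.pi,
            ENNReal.ofReal (w s) * ENNReal.ofReal ‖F (circleMap 0 s θ)‖ := by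
          rw [lintegral_const_mul _ (hc _)]
          ring
      _ = _ := by
          congr 1
          refine lintegral_congr fun θ => ?_
          rw [← ENNReal.ofReal_mul hws.le, hnorm, mul_comm]
  · filter_upwards [ae_restrict_mem measurableSet_Ioo] with s ⟨hs0, hs1⟩
    have hws := w.pos s hs0.le hs1
    have hnorm : ∀ θ, ‖circleMap 0 s θ‖ = s := fun θ => by
      rw [norm_circleMap_zero, abs_of_pos hs0]
    rw [ENNReal.tendsto_nhds_zero]
    intro ε hε
    obtain ⟨δ, hδ0, hδ⟩ : ∃ δ : ℝ, 0 < δ ∧ ENNReal.ofReal (2 * Real.pi * w s * δ) ≤ ε := by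
      have hp : 0 < 2 * Real.pi * w s := by
        have := Real.pi_pos
        positivity
      by_cases hε' : ε = ⊤
      · exact ⟨1, one_pos, by simp [hε']⟩
      · refine ⟨ε.toReal / (2 * Real.pi * w s), div_pos (ENNReal.toReal_pos hε.ne' hε') hp, ?_⟩
        rw [mul_div_cancel₀ _ hp.ne', ENNReal.ofReal_toReal hε']
    -- For fixed s the dilations converge uniformly on the circle |z| = s, which gives the pointwise
    -- limit in s.
    filter_upwards [eventually_dilate_close hF.continuousOn hs1 hδ0] with r hr
    refine le_trans ?_ hδ
    calc _ ≤ 1 * ∫⁻ θ in Set.Ioo (-Real.pi) Real.pi, ENNReal.ofReal (w s * δ) := by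
          refine mul_le_mul' (ENNReal.ofReal_le_one.2 hs1.le) (lintegral_mono fun θ => ?_)
          refine ENNReal.ofReal_le_ofReal ?_
          rw [hnorm, mul_comm]
          exact mul_le_mul_of_nonneg_left (hr _ (hnorm θ).le) hws.le
      _ = _ := by
          have := Real.pi_pos
          rw [one_mul, setLIntegral_const, Real.volume_Ioo, ← ENNReal.ofReal_mul (by positivity)]
          congr 1
          ring


/-! ### The spaces as normed spaces of analytic functions -/

/-- The map from `𝔅_w` to functions. -/
def Bloch.fnLin (w : Weight) : Bloch w →ₗ[ℂ] (ℂ → ℂ) := (blochSubmodule w).subtype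

/-- The map from `𝔟_w` to functions. -/
def LittleBloch.fnLin (w : Weight) : LittleBloch w →ₗ[ℂ] (ℂ → ℂ) :=
  (Bloch.fnLin w).comp (littleBloch w).subtype

/-- The map from `𝔅¹_w` to functions. -/
def Bloch1.fnLin (w : Weight) : Bloch1 w →ₗ[ℂ] (ℂ → ℂ) := (bloch1Submodule w).subtype

theorem Bloch.fnLin_apply {w : Weight} (f : Bloch w) : Bloch.fnLin w f = f.fn := rfl

theorem Bloch.fn_mem {w : Weight} (f : Bloch w) : f.fn ∈ holDisk := f.2.1

theorem Bloch1.fn_mem {w : Weight} (f : Bloch1 w) : f.fn ∈ holDisk := f.2.1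

theorem LittleBloch.fn_mem {w : Weight} (f : LittleBloch w) : f.fn ∈ holDisk := f.1.2.1

theorem Bloch.fnLin_injective (w : Weight) : Function.Injective (Bloch.fnLin w) :=
  Subtype.val_injective

theorem Bloch1.fnLin_injective (w : Weight) : Function.Injective (Bloch1.fnLin w) :=
  Subtype.val_injective

theorem LittleBloch.fnLin_injective (w : Weight) : Function.Injective (LittleBloch.fnLin w) :=
  fun _ _ h => Subtype.ext (Bloch.fnLin_injective w h)

theorem Weight.factor_pos (w : Weight) {z : ℂ} (hz : ‖z‖ < 1) : 0 < (1 - ‖z‖)⁻¹ * w ‖z‖ :=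
  mul_pos (inv_pos.2 (by linarith)) (w.pos _ (norm_nonneg z) hz)

theorem Bloch.norm_le {w : Weight} (g : Bloch w) {M : ℝ}
    (h : ∀ z : ℂ, ‖z‖ < 1 → ‖deriv g.fn z‖ ≤ M * ((1 - ‖z‖)⁻¹ * w ‖z‖)) :
    ‖g‖ ≤ ‖g.fn 0‖ + M := by
  rw [Bloch.norm_def]
  have : Nonempty (ball (0 : ℂ) 1) := ⟨⟨0, mem_ball_self one_pos⟩⟩
  gcongr
  refine ciSup_le fun z => ?_
  have hz := mem_ball_zero_iff.1 z.2
  have hw := w.pos _ (norm_nonneg (z : ℂ)) hz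
  have h1 : 0 < 1 - ‖(z : ℂ)‖ := by linarith
  calc (1 - ‖(z : ℂ)‖) * (w ‖(z : ℂ)‖)⁻¹ * ‖deriv g.fn z‖
      ≤ (1 - ‖(z : ℂ)‖) * (w ‖(z : ℂ)‖)⁻¹ * (M * ((1 - ‖(z : ℂ)‖)⁻¹ * w ‖(z : ℂ)‖)) := by
        gcongr; exact h z hz
    _ = M := by field_simp

theorem Bloch.exists_of_bound {w : Weight} {f : ℂ → ℂ} (hf : f ∈ holDisk) {M : ℝ}
    (h : ∀ z : ℂ, ‖z‖ < 1 → ‖deriv f z‖ ≤ M * ((1 - ‖z‖)⁻¹ * w ‖z‖)) :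
    ∃ g : Bloch w, g.fn = f ∧ ‖g‖ ≤ ‖f 0‖ + M := by
  have hO : deriv f =O[𝓟 (ball (0 : ℂ) 1)] fun z => (1 - ‖z‖)⁻¹ * w ‖z‖ := by
    refine IsBigO.of_bound M ?_
    rw [eventually_principal]
    intro z hz
    have hz' := mem_ball_zero_iff.1 hz
    rw [Real.norm_of_nonneg (w.factor_pos hz').le]
    exact h z hz'
  exact ⟨⟨f, hf, hO⟩, rfl, Bloch.norm_le ⟨f, hf, hO⟩ h⟩

theorem mem_littleBloch_iff {w : Weight} {g : Bloch w} : g ∈ littleBloch w ↔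
    ∀ ε > 0, ∃ R < 1, ∀ z : ℂ, R < ‖z‖ → ‖z‖ < 1 →
      ‖deriv g.fn z‖ ≤ ε * ((1 - ‖z‖)⁻¹ * w ‖z‖) := by
  change deriv g.fn =o[_] _ ↔ _
  rw [isLittleO_iff]
  refine forall₂_congr fun ε hε => ?_
  rw [eventually_comap, (nhdsLT_basis (1 : ℝ)).eventually_iff]
  refine exists_congr fun R => and_congr_right fun hR => ?_
  constructor
  · intro h z h1 h2
    have := h ⟨h1, h2⟩ z rfl
    rwa [Real.norm_of_nonneg (w.factor_pos h2).le] at this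
  · rintro h _ ⟨h1, h2⟩ z rfl
    rw [Real.norm_of_nonneg (w.factor_pos h2).le]
    exact h z h1 h2

theorem Bloch1.norm_eq_lintegral {w : Weight} (f : Bloch1 w) :
    ‖f‖ = ‖f.fn 0‖ + Real.pi⁻¹ *
      (∫⁻ z in ball (0 : ℂ) 1, ENNReal.ofReal (‖deriv f.fn z‖ * w ‖z‖)).toReal := by
  have hm := measurable_deriv f.fn
  have hwm := w.measurable
  rw [Bloch1.norm_def, integral_eq_lintegral_of_nonneg_ae]
  · filter_upwards [ae_restrict_mem measurableSet_ball] with z hz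
    have := w.pos _ (norm_nonneg z) (mem_ball_zero_iff.1 hz)
    exact mul_nonneg (norm_nonneg _) this.le
  · exact Measurable.aestronglyMeasurable (by fun_prop)

/-! ### Absolutely convergent series -/

theorem diskSummable_of_summable {c : ℕ → ℂ} (hc : Summable fun n : ℕ => ((n : ℝ) + 1) * ‖c n‖) :
    DiskSummable c := fun r h0 h1 => hc.of_nonneg_of_le (fun n => by positivity) fun n => by
  rw [mul_comm]
  have : r ^ n ≤ 1 := pow_le_one₀ h0 h1.le
  gcongr
  linarith [(Nat.cast_nonneg n : (0 : ℝ) ≤ n)]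

/-- Summability with the factor n + 1 controls both the derivative and the value at 0, hence the
norms of all the spaces involved. -/
theorem norm_deriv_powerSum_le {c : ℕ → ℂ} (hc : Summable fun n : ℕ => ((n : ℝ) + 1) * ‖c n‖)
    {z : ℂ} (hz : ‖z‖ < 1) :
    ‖deriv (powerSum c) z‖ ≤ ∑' n : ℕ, ((n : ℝ) + 1) * ‖c n‖ := by
  have h := hasSum_deriv_powerSum (diskSummable_of_summable hc) (mem_ball_zero_iff.2 hz)
  have hs : Summable fun n : ℕ => (((n + 1 : ℕ) : ℝ) + 1) * ‖c (n + 1)‖ :=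
    (summable_nat_add_iff 1).2 hc
  rw [← h.tsum_eq, hc.tsum_eq_zero_add]
  refine (tsum_of_norm_bounded hs.hasSum fun n => ?_).trans ?_
  · rw [norm_mul, norm_mul, norm_pow]
    have h1 : ‖(n : ℂ) + 1‖ = (n : ℝ) + 1 := by exact_mod_cast Complex.norm_natCast (n + 1)
    rw [h1]
    have h2 : ‖z‖ ^ n ≤ 1 := pow_le_one₀ (norm_nonneg z) hz.le
    refine (mul_le_of_le_one_right (by positivity) h2).trans ?_
    gcongr
    simp
  · exact le_add_of_nonneg_left (by positivity)

theorem norm_powerSum_zero_le {c : ℕ → ℂ} (hc : Summable fun n : ℕ => ((n : ℝ) + 1) * ‖c n‖) :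
    ‖powerSum c 0‖ ≤ ∑' n : ℕ, ((n : ℝ) + 1) * ‖c n‖ := by
  rw [powerSum_zero]
  simpa using hc.le_tsum 0 fun n _ => by positivity

/-- For coefficients of a holomorphic function this shows that every dilation with r < 1 satisfies
the hypothesis of `DiskSpace.exists_series`. -/
theorem DiskSummable.summable_mul {c : ℕ → ℂ} (hc : DiskSummable c) {r : ℝ} (h0 : 0 ≤ r)
    (h1 : r < 1) : Summable fun n : ℕ => ((n : ℝ) + 1) * ‖c n * (r : ℂ) ^ n‖ := by
  have h2 := diskSummable_of_hasSum fun z hz => hasSum_deriv_powerSum hc hz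
  have h3 : Summable fun n : ℕ => (n : ℝ) * (‖c n‖ * r ^ n) := by
    refine (summable_nat_add_iff 1).1 (((h2 r h0 h1).mul_right r).congr fun n => ?_)
    have h4 : ‖(n : ℂ) + 1‖ = (n : ℝ) + 1 := by exact_mod_cast Complex.norm_natCast (n + 1)
    rw [norm_mul, h4, pow_succ]
    push_cast
    ring
  refine (h3.add (hc r h0 h1)).congr fun n => ?_
  rw [norm_mul, norm_pow, Complex.norm_real, Real.norm_of_nonneg h0]
  ring

/-- The derivative is bounded by the sum S, and 1 ≤ k⁻¹ w(|z|)/(1 - |z|) turns this into a Bloch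
bound. The little o condition holds because w(r)/(1 - r) → ∞. -/
theorem IsSlow.exists_bloch {w : Weight} (hw : IsSlow w) : ∃ K : ℝ, 0 < K ∧ ∀ c : ℕ → ℂ,
    (Summable fun n : ℕ => ((n : ℝ) + 1) * ‖c n‖) → ∃ h : LittleBloch w, h.fn = powerSum c ∧
      ‖h‖ ≤ K * ∑' n : ℕ, ((n : ℝ) + 1) * ‖c n‖ := by
  obtain ⟨k, hk, hlow⟩ := hw.lower_linear
  refine ⟨1 + k⁻¹, by positivity, fun c hc => ?_⟩
  have hS : 0 ≤ ∑' n : ℕ, ((n : ℝ) + 1) * ‖c n‖ := tsum_nonneg fun n => by positivity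
  have h1 : ∀ z : ℂ, ‖z‖ < 1 → 1 ≤ k⁻¹ * ((1 - ‖z‖)⁻¹ * w ‖z‖) := by
    intro z hz
    have h2 := hlow ‖z‖ (norm_nonneg z) hz
    have h3 : 0 < 1 - ‖z‖ := by linarith
    calc 1 = k⁻¹ * ((1 - ‖z‖)⁻¹ * (k * (1 - ‖z‖))) := by field_simp
      _ ≤ _ := by gcongr
  obtain ⟨g, hg, hgn⟩ := Bloch.exists_of_bound (w := w) (M := k⁻¹ * ∑' n : ℕ, ((n : ℝ) + 1) * ‖c n‖)
    (powerSum_mem_holDisk (diskSummable_of_summable hc)) (fun z hz => by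
      refine (norm_deriv_powerSum_le hc hz).trans ?_
      calc _ ≤ (∑' n : ℕ, ((n : ℝ) + 1) * ‖c n‖) * (k⁻¹ * ((1 - ‖z‖)⁻¹ * w ‖z‖)) :=
            le_mul_of_one_le_right hS (h1 z hz)
        _ = _ := by ring)
  have hlit : g ∈ littleBloch w := by
    rw [mem_littleBloch_iff]
    intro ε hε
    have h2 := hw.tendsto.eventually_ge_atTop ((∑' n : ℕ, ((n : ℝ) + 1) * ‖c n‖) / ε)
    rw [(nhdsLT_basis (1 : ℝ)).eventually_iff] at h2
    obtain ⟨R, hR, h2⟩ := h2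
    refine ⟨R, hR, fun z h3 h4 => ?_⟩
    rw [hg]
    refine (norm_deriv_powerSum_le hc h4).trans ?_
    have := h2 ⟨h3, h4⟩
    rwa [div_le_iff₀' hε] at this
  refine ⟨⟨g, hlit⟩, hg, ?_⟩
  change ‖g‖ ≤ _
  have := norm_powerSum_zero_le hc
  linarith

/-- A bounded derivative suffices because the weight itself is integrable over the disk. -/
theorem IsSlow.exists_bloch1 {w : Weight} (hw : IsSlow w) : ∃ K : ℝ, 0 < K ∧ ∀ c : ℕ → ℂ,
    (Summable fun n : ℕ => ((n : ℝ) + 1) * ‖c n‖) → ∃ h : Bloch1 w, h.fn = powerSum c ∧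
      ‖h‖ ≤ K * ∑' n : ℕ, ((n : ℝ) + 1) * ‖c n‖ := by
  have hI : 0 ≤ ∫ z in ball (0 : ℂ) 1, w ‖z‖ := setIntegral_nonneg measurableSet_ball
    fun z hz => (w.pos _ (norm_nonneg z) (mem_ball_zero_iff.1 hz)).le
  have hpi := Real.pi_pos
  refine ⟨1 + Real.pi⁻¹ * ∫ z in ball (0 : ℂ) 1, w ‖z‖, by positivity, fun c hc => ?_⟩
  let S := ∑' n : ℕ, ((n : ℝ) + 1) * ‖c n‖
  have hle : ∀ z ∈ ball (0 : ℂ) 1, ‖deriv (powerSum c) z‖ * w ‖z‖ ≤ S * w ‖z‖ := by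
    intro z hz
    have hz' := mem_ball_zero_iff.1 hz
    exact mul_le_mul_of_nonneg_right (norm_deriv_powerSum_le hc hz')
      (w.pos _ (norm_nonneg z) hz').le
  have hint : IntegrableOn (fun z => ‖deriv (powerSum c) z‖ * w ‖z‖) (ball (0 : ℂ) 1) := by
    have hm := measurable_deriv (powerSum c)
    have hwm := w.measurable
    refine (hw.integrableOn.const_mul S).mono' (Measurable.aestronglyMeasurable (by fun_prop)) ?_
    filter_upwards [ae_restrict_mem measurableSet_ball] with z hz
    have := w.pos _ (norm_nonneg z) (mem_ball_zero_iff.1 hz)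
    rw [Real.norm_of_nonneg (by positivity)]
    exact hle z hz
  obtain ⟨g, hg⟩ : ∃ g : Bloch1 w, g.fn = powerSum c :=
    ⟨⟨powerSum c, powerSum_mem_holDisk (diskSummable_of_summable hc), hint⟩, rfl⟩
  refine ⟨g, hg, ?_⟩
  rw [Bloch1.norm_def, hg]
  have h1 := setIntegral_mono_on hint (hw.integrableOn.const_mul S) measurableSet_ball hle
  rw [integral_const_mul] at h1
  calc _ ≤ S + Real.pi⁻¹ * (S * ∫ z in ball (0 : ℂ) 1, w ‖z‖) := by
        gcongr
        exact norm_powerSum_zero_le hc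
    _ = _ := by ring

/-! ### Normed spaces of analytic functions in which polynomials are dense -/

/-- `e` embeds `X` in `H(𝔻)`; absolutely convergent series belong to `X`, and the dilations of
`f ∈ X` converge to `f`. -/
structure DiskSpace {X : Type} [NormedAddCommGroup X] [NormedSpace ℂ X] (e : X →ₗ[ℂ] (ℂ → ℂ)) :
    Prop where
  mem : ∀ f, e f ∈ holDisk
  inj : Function.Injective e
  exists_series : ∃ K : ℝ, 0 < K ∧ ∀ c : ℕ → ℂ, (Summable fun n : ℕ => ((n : ℝ) + 1) * ‖c n‖) →
    ∃ h : X, e h = powerSum c ∧ ‖h‖ ≤ K * ∑' n : ℕ, ((n : ℝ) + 1) * ‖c n‖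
  dilate : ∀ f : X, ∀ ε > 0, ∀ᶠ r in 𝓝[<] (1 : ℝ), ∀ h : X,
    e h = powerSum (dilateSeq (e f) r) → ‖h - f‖ ≤ ε

namespace DiskSpace

variable {X : Type} [NormedAddCommGroup X] [NormedSpace ℂ X] {e : X →ₗ[ℂ] (ℂ → ℂ)}

theorem summable_monoSeq (n : ℕ) : Summable fun m : ℕ => ((m : ℝ) + 1) * ‖monoSeq n m‖ :=
  summable_of_ne_finset_zero (s := {n}) fun m hm => by
    have : m ≠ n := by simpa using hm
    simp [monoSeq, this]

theorem exists_mono (hX : DiskSpace e) (n : ℕ) : ∃ h : X, e h = powerSum (monoSeq n) := by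
  obtain ⟨K, -, hK⟩ := hX.exists_series
  obtain ⟨h, hh, -⟩ := hK _ (summable_monoSeq n)
  exact ⟨h, hh⟩

/-- The monomial `z ^ n` as an element of `X`. -/
def mono (hX : DiskSpace e) (n : ℕ) : X := (hX.exists_mono n).choose

theorem apply_mono (hX : DiskSpace e) (n : ℕ) : e (hX.mono n) = powerSum (monoSeq n) :=
  (hX.exists_mono n).choose_spec

theorem coeff_mono (hX : DiskSpace e) (n m : ℕ) :
    coeff (e (hX.mono n)) m = if m = n then 1 else 0 := by
  rw [hX.apply_mono, coeff_powerSum (diskSummable_monoSeq n), monoSeq, Pi.single_apply]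

theorem norm_mono_le (hX : DiskSpace e) : ∃ K : ℝ, 0 < K ∧ ∀ n : ℕ,
    ‖hX.mono n‖ ≤ K * ((n : ℝ) + 1) := by
  obtain ⟨K, hK0, hK⟩ := hX.exists_series
  refine ⟨K, hK0, fun n => ?_⟩
  obtain ⟨h, hh, hn⟩ := hK _ (summable_monoSeq n)
  have : hX.mono n = h := hX.inj (by rw [hX.apply_mono, hh])
  rw [this]
  refine hn.trans_eq ?_
  rw [tsum_eq_single n fun m hm => by simp [monoSeq, hm]]
  simp [monoSeq]

theorem coeff_sum (hX : DiskSpace e) (c : ℕ → ℂ) (s : Finset ℕ) (m : ℕ) :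
    coeff (e (∑ n ∈ s, c n • hX.mono n)) m = if m ∈ s then c m else 0 := by
  classical
  induction s using Finset.induction_on with
  | empty =>
    rw [Finset.sum_empty, map_zero]
    simpa using coeff_smul (zero_mem holDisk) (0 : ℂ) m
  | insert a s ha ih =>
    rw [Finset.sum_insert ha, map_add, coeff_add (hX.mem _) (hX.mem _), ih, map_smul,
      coeff_smul (hX.mem _), hX.coeff_mono]
    by_cases h : m = a
    · subst h; simp [ha]
    · simp [h]

/-- The remainder after a finite set of terms is again an absolutely convergent series, so
`exists_series` bounds its norm by the tail of a convergent numerical series. -/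
theorem hasSum_mono (hX : DiskSpace e) {c : ℕ → ℂ}
    (hc : Summable fun n : ℕ => ((n : ℝ) + 1) * ‖c n‖) {h : X} (hh : e h = powerSum c) :
    HasSum (fun n => c n • hX.mono n) h := by
  classical
  obtain ⟨K, hK0, hK⟩ := hX.exists_series
  have ht := (tendsto_tsum_compl_atTop_zero fun n : ℕ => ((n : ℝ) + 1) * ‖c n‖).const_mul K
  rw [mul_zero] at ht
  rw [HasSum, SummationFilter.unconditional_filter, tendsto_iff_norm_sub_tendsto_zero]
  refine squeeze_zero (fun s => norm_nonneg _) (fun s => ?_) ht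
  let d : ℕ → ℂ := fun n => if n ∈ s then 0 else c n
  have hdc : (fun n : ℕ => ((n : ℝ) + 1) * ‖d n‖) =
      Set.indicator {n | n ∉ s} fun n : ℕ => ((n : ℝ) + 1) * ‖c n‖ := by
    funext n
    by_cases hn : n ∈ s <;> simp [d, hn]
  obtain ⟨k, hk, hkn⟩ := hK d (by rw [hdc]; exact hc.indicator _)
  have hdd : DiskSummable d := (diskSummable_of_summable hc).mono fun n => by
    by_cases hn : n ∈ s <;> simp [d, hn]
  have hkd : h = k + ∑ n ∈ s, c n • hX.mono n := by
    refine hX.inj (holDisk_ext (hX.mem _) (hX.mem _) fun n => ?_)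
    rw [map_add, coeff_add (hX.mem _) (hX.mem _), hX.coeff_sum, hk, hh, coeff_powerSum hdd,
      coeff_powerSum (diskSummable_of_summable hc)]
    by_cases hn : n ∈ s <;> simp [d, hn]
  rw [hkd, norm_sub_rev, add_sub_cancel_right]
  refine hkn.trans_eq ?_
  rw [hdc, ← tsum_subtype]
  rfl

theorem exists_dilate (hX : DiskSpace e) (f : X) {r : ℝ} (h0 : 0 ≤ r) (h1 : r < 1) :
    ∃ h : X, e h = powerSum (dilateSeq (e f) r) := by
  obtain ⟨K, -, hK⟩ := hX.exists_series
  obtain ⟨h, hh, -⟩ := hK _ ((diskSummable_coeff (hX.mem f)).summable_mul h0 h1)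
  exact ⟨h, hh⟩

/-- The coefficients of the function that represents a functional. -/
def dualSeq (hX : DiskSpace e) (Φ : StrongDual ℂ X) (n : ℕ) : ℂ := Φ (hX.mono n)

theorem diskSummable_dualSeq (hX : DiskSpace e) (Φ : StrongDual ℂ X) :
    DiskSummable (hX.dualSeq Φ) := by
  obtain ⟨K, hK0, hK⟩ := hX.norm_mono_le
  refine diskSummable_of_le_pow (K := ‖Φ‖ * K) 1 fun n => ?_
  rw [pow_one, mul_assoc]
  exact (Φ.le_opNorm _).trans (mul_le_mul_of_nonneg_left (hK n) (norm_nonneg _))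

theorem hasSum_dualSeq (hX : DiskSpace e) (Φ : StrongDual ℂ X) {c : ℕ → ℂ}
    (hc : Summable fun n : ℕ => ((n : ℝ) + 1) * ‖c n‖) {h : X} (hh : e h = powerSum c) :
    HasSum (fun n => c n * hX.dualSeq Φ n) (Φ h) := by
  simpa [dualSeq] using (hX.hasSum_mono hc hh).mapL Φ

/-- Because r^{2n} = (r²)ⁿ, the Abel mean at r is exactly Φ of the dilation of f by r², and these
dilations converge to f. -/
theorem hasAbelPairing_dualSeq (hX : DiskSpace e) (Φ : StrongDual ℂ X) (f : X) :
    HasAbelPairing (e f) (powerSum (hX.dualSeq Φ)) (Φ f) := by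
  have hmap : Tendsto (fun r : ℝ => r ^ 2) (𝓝[<] 1) (𝓝[<] 1) := by
    refine tendsto_nhdsWithin_iff.2 ⟨?_, ?_⟩
    · have : Tendsto (fun r : ℝ => r ^ 2) (𝓝[<] 1) (𝓝 (1 ^ 2)) :=
        (Continuous.tendsto (by fun_prop) 1).mono_left nhdsWithin_le_nhds
      simpa using this
    · filter_upwards [eventually_mem_Ioo_nhdsLT_one] with r ⟨h0, h1⟩
      exact pow_lt_one₀ h0.le h1 two_ne_zero
  rw [HasAbelPairing, Metric.tendsto_nhds]
  intro ε hε
  filter_upwards [hmap.eventually (hX.dilate f (ε / (2 * (‖Φ‖ + 1))) (by positivity)),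
    eventually_mem_Ioo_nhdsLT_one] with r hr ⟨h0, h1⟩
  have h2 : (0 : ℝ) ≤ r ^ 2 := by positivity
  have h3 : r ^ 2 < 1 := pow_lt_one₀ h0.le h1 two_ne_zero
  obtain ⟨h, hh⟩ := hX.exists_dilate f h2 h3
  have h4 := hX.hasSum_dualSeq Φ ((diskSummable_coeff (hX.mem f)).summable_mul h2 h3) hh
  have h5 : abelMean (e f) (powerSum (hX.dualSeq Φ)) r = Φ h := by
    rw [abelMean, ← h4.tsum_eq]
    refine tsum_congr fun n => ?_
    rw [coeff_powerSum (hX.diskSummable_dualSeq Φ), pow_mul]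
    push_cast
    ring
  rw [h5, dist_eq_norm, ← map_sub]
  calc ‖Φ (h - f)‖ ≤ ‖Φ‖ * ‖h - f‖ := Φ.le_opNorm _
    _ ≤ (‖Φ‖ + 1) * (ε / (2 * (‖Φ‖ + 1))) := by
        gcongr
        · linarith
        · exact hr h hh
    _ = ε / 2 := by field_simp
    _ < ε := by linarith

/-- The span of the monomials is dense. -/
theorem mem_of_isClosed (hX : DiskSpace e) {S : Submodule ℂ X} (hS : IsClosed (S : Set X))
    (h : ∀ n, hX.mono n ∈ S) (f : X) : f ∈ S := by
  have hd : ∀ r : ℝ, 0 ≤ r → r < 1 → ∀ g : X, e g = powerSum (dilateSeq (e f) r) → g ∈ S := by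
    intro r h0 h1 g hg
    have h2 := hX.hasSum_mono ((diskSummable_coeff (hX.mem f)).summable_mul h0 h1) hg
    exact hS.mem_of_tendsto h2 (Eventually.of_forall fun s =>
      S.sum_mem fun n _ => S.smul_mem _ (h n))
  rw [← SetLike.mem_coe, ← hS.closure_eq, Metric.mem_closure_iff]
  intro ε hε
  obtain ⟨r, hr, h0, h1⟩ :=
    ((hX.dilate f (ε / 2) (by positivity)).and eventually_mem_Ioo_nhdsLT_one).exists
  obtain ⟨g, hg⟩ := hX.exists_dilate f h0.le h1
  refine ⟨g, hd r h0.le h1 g hg, ?_⟩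
  rw [dist_comm, dist_eq_norm]
  exact (hr g hg).trans_lt (by linarith)

/-- A criterion for the Abel pairing to identify `X'` with the dual of `X`. -/
theorem exists_pairingIso (hX : DiskSpace e) {X' : Type} [NormedAddCommGroup X'] [NormedSpace ℂ X']
    {e' : X' →ₗ[ℂ] (ℂ → ℂ)} (hmem : ∀ g, e' g ∈ holDisk) (hinj : Function.Injective e')
    (hpair : ∃ C : ℝ, ∀ (f : X) (g : X'), ∃ L : ℂ, HasAbelPairing (e f) (e' g) L ∧
      ‖L‖ ≤ C * ‖f‖ * ‖g‖)
    (hrep : ∃ C : ℝ, ∀ Φ : StrongDual ℂ X, ∃ g : X', e' g = powerSum (hX.dualSeq Φ) ∧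
      ‖g‖ ≤ C * ‖Φ‖) :
    ∃ J : X' ≃L[ℂ] StrongDual ℂ X, IsPairingIso e e' J := by
  obtain ⟨C, hC⟩ := hpair
  obtain ⟨C', hC'⟩ := hrep
  choose L hL hLn using hC
  let B : X' →ₗ[ℂ] X →ₗ[ℂ] ℂ := LinearMap.mk₂ ℂ (fun g f => L f g)
    (fun g g' f => ((hL f (g + g')).unique (by
      rw [map_add]; exact (hL f g).add_right (hX.mem f) (hmem g) (hmem g') (hL f g'))))
    (fun a g f => ((hL f (a • g)).unique (by
      rw [map_smul]; exact (hL f g).smul_right (hmem g) a)))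
    (fun g f f' => ((hL (f + f') g).unique (by
      rw [map_add]; exact (hL f g).add_left (hX.mem f) (hX.mem f') (hmem g) (hL f' g))))
    (fun a g f => ((hL (a • f) g).unique (by
      rw [map_smul]; exact (hL f g).smul_left (hX.mem f) a)))
  have hB : ∀ g f, ‖B g f‖ ≤ C * ‖g‖ * ‖f‖ := fun g f => (hLn f g).trans_eq (by ring)
  let J₀ : X' →L[ℂ] StrongDual ℂ X := LinearMap.mkContinuous₂ B C hB
  have hJ : ∀ f g, HasAbelPairing (e f) (e' g) (J₀ g f) := fun f g => hL f g
  -- By evaluation at monomials, the function representing `J₀ g` is g itself. The bound in `hrep`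
  -- is therefore a lower bound for `J₀`, giving injectivity and a continuous inverse without the
  -- open mapping theorem.
  have hcoef : ∀ g n, hX.dualSeq (J₀ g) n = coeff (e' g) n := by
    intro g n
    have h1 := hJ (hX.mono n) g
    rw [hX.apply_mono] at h1
    exact h1.unique (hasAbelPairing_monoSeq n _)
  have hinv : ∀ g : X', ‖g‖ ≤ C' * ‖J₀ g‖ := by
    intro g
    obtain ⟨g', hg', hn⟩ := hC' (J₀ g)
    have : g = g' := hinj (by
      rw [hg', funext (hcoef g)]
      exact (powerSum_coeff (hmem g)).symm)
    rwa [← this] at hn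
  have hbij : Function.Bijective J₀ := by
    constructor
    · rw [injective_iff_map_eq_zero]
      intro g hg
      have := hinv g
      rw [hg, norm_zero, mul_zero] at this
      exact norm_le_zero_iff.1 this
    · intro Φ
      obtain ⟨g, hg, -⟩ := hC' Φ
      refine ⟨g, ContinuousLinearMap.ext fun f => (hJ f g).unique ?_⟩
      rw [hg]
      exact hX.hasAbelPairing_dualSeq Φ f
  let E := LinearEquiv.ofBijective J₀.toLinearMap hbij
  refine ⟨E.toContinuousLinearEquivOfBounds ‖J₀‖ C' (fun g => J₀.le_opNorm g) (fun Φ => ?_),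
    fun f g => hJ f g⟩
  have := hinv (E.symm Φ)
  have h2 : J₀ (E.symm Φ) = Φ := E.apply_symm_apply Φ
  rwa [h2] at this

end DiskSpace

/-! ### Convergence of dilations in 𝔅¹_w and in 𝔟_w. -/

theorem IsSlow.diskSpace_bloch1 {w : Weight} (hw : IsSlow w) : DiskSpace (Bloch1.fnLin w) where
  mem f := f.2.1
  inj := Bloch1.fnLin_injective w
  exists_series := hw.exists_bloch1
  dilate f ε hε := by
    have h := tendsto_lintegral_dilate (f.fn_mem.1.deriv isOpen_ball) (measurable_deriv _) f.2.2
    have hpi := Real.pi_pos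
    have h2 := h.eventually_le_const (u := ENNReal.ofReal (Real.pi * ε)) (by positivity)
    filter_upwards [h2, eventually_mem_Ioo_nhdsLT_one] with r hr ⟨h0, h1⟩ g hg
    have hg' : g.fn = powerSum (dilateSeq f.fn r) := hg
    have hsub : (g - f).fn = g.fn - f.fn := rfl
    have hz : (g - f).fn 0 = 0 := by
      rw [hsub, Pi.sub_apply, hg', powerSum_zero, dilateSeq, pow_zero, mul_one, coeff_zero_eq,
        sub_self]
    have hd : ∀ z ∈ ball (0 : ℂ) 1,
        deriv (g - f).fn z = r * deriv f.fn (r * z) - deriv f.fn z := by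
      intro z hz
      have hz' := isOpen_ball.mem_nhds hz
      rw [hsub, deriv_sub (g.fn_mem.1.differentiableAt hz') (f.fn_mem.1.differentiableAt hz'), hg',
        deriv_dilate f.fn_mem h0.le h1.le hz]
    rw [Bloch1.norm_eq_lintegral, hz, norm_zero, zero_add,
      setLIntegral_congr_fun (g := fun z => ENNReal.ofReal
        (‖r * deriv f.fn (r * z) - deriv f.fn z‖ * w ‖z‖)) measurableSet_ball
        (fun z hz => by rw [hd z hz])]
    have h3 := ENNReal.toReal_le_of_le_ofReal (by positivity) hr
    calc _ ≤ Real.pi⁻¹ * (Real.pi * ε) := by gcongr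
      _ = ε := by field_simp

theorem IsSlow.diskSpace_littleBloch {w : Weight} (hw : IsSlow w) :
    DiskSpace (LittleBloch.fnLin w) where
  mem f := f.fn_mem
  inj := LittleBloch.fnLin_injective w
  exists_series := hw.exists_bloch
  dilate f ε hε := by
    obtain ⟨C, hC, hmono⟩ := hw.almost_mono
    obtain ⟨k, hk, hlow⟩ := hw.lower_linear
    -- Near the boundary f' contributes one such ε-share and the dilated derivative C shares, by
    -- almost monotonicity; hence C + 1.
    have hf := mem_littleBloch_iff.1 f.2 (ε / (C + 1)) (by positivity)
    obtain ⟨R, hR, hfR⟩ := hf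
    -- An intermediate radius, so that r|z| still exceeds R for |z| > R' once r > max(R, 0)/R'. For
    -- |z| ≤ R' uniform convergence on compact sets applies, with tolerance kε because w(|z|) ≥ k(1
    -- - |z|).
    let R' : ℝ := (1 + max R 0) / 2
    have hm : max R 0 < 1 := max_lt hR one_pos
    have hm0 : 0 ≤ max R 0 := le_max_right _ _
    have hR'1 : R' < 1 := by simp only [R']; linarith
    have hR'0 : max R 0 < R' := by simp only [R']; linarith
    have hR'p : 0 < R' := hm0.trans_lt hR'0
    have hF := (f.fn_mem.1.deriv isOpen_ball).continuousOn
    have h3 : ∀ᶠ r : ℝ in 𝓝[<] 1, max R 0 / R' < r := by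
      filter_upwards [Ioo_mem_nhdsLT ((div_lt_one hR'p).2 hR'0)] with r hr using hr.1
    filter_upwards [eventually_dilate_close hF hR'1 (mul_pos hk hε), h3,
      eventually_mem_Ioo_nhdsLT_one] with r hr hrR ⟨h0, h1⟩ g hg
    have hg' : g.fn = powerSum (dilateSeq f.fn r) := hg
    have hsub : Bloch.fn (g - f).1 = g.fn - f.fn := rfl
    have hz : Bloch.fn (g - f).1 0 = 0 := by
      rw [hsub, Pi.sub_apply, hg', powerSum_zero, dilateSeq, pow_zero, mul_one, coeff_zero_eq,
        sub_self]
    have h4 := Bloch.norm_le (g - f).1 (M := ε) fun z hz => by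
      have hz1 : z ∈ ball (0 : ℂ) 1 := mem_ball_zero_iff.2 hz
      have hz' := isOpen_ball.mem_nhds hz1
      have h5 : 0 < 1 - ‖z‖ := by linarith
      have hwz := w.factor_pos hz
      rw [hsub, deriv_sub (g.fn_mem.1.differentiableAt hz') (f.fn_mem.1.differentiableAt hz'), hg',
        deriv_dilate f.fn_mem h0.le h1.le hz1]
      rcases le_or_gt ‖z‖ R' with h6 | h6
      · refine (hr z h6).trans ?_
        calc k * ε = ε * ((1 - ‖z‖)⁻¹ * (k * (1 - ‖z‖))) := by field_simp
          _ ≤ _ := by gcongr; exact hlow _ (norm_nonneg z) hz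
      · have h7 : ‖(r : ℂ) * z‖ = r * ‖z‖ := by
          rw [norm_mul, Complex.norm_real, Real.norm_of_nonneg h0.le]
        have h8 : max R 0 < r * ‖z‖ := by
          rw [div_lt_iff₀ hR'p] at hrR
          nlinarith
        have h9 : r * ‖z‖ ≤ ‖z‖ := mul_le_of_le_one_left (norm_nonneg z) h1.le
        have h10 := hfR (r * z) (by rw [h7]; exact (le_max_left _ _).trans_lt h8)
          (by rw [h7]; linarith)
        have h11 := hfR z (((le_max_left _ _).trans_lt hR'0).trans h6) hz
        have h12 := hmono (r * ‖z‖) ‖z‖ (hm0.trans h8.le) h9 hz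
        rw [h7] at h10
        have h13 : ‖(r : ℂ) * deriv f.fn (r * z)‖ ≤ ‖deriv f.fn (r * z)‖ := by
          rw [norm_mul, Complex.norm_real, Real.norm_of_nonneg h0.le]
          exact mul_le_of_le_one_left (norm_nonneg _) h1.le
        calc _ ≤ ‖(r : ℂ) * deriv f.fn (r * z)‖ + ‖deriv f.fn z‖ := norm_sub_le _ _
          _ ≤ ε / (C + 1) * (C * ((1 - ‖z‖)⁻¹ * w ‖z‖)) +
              ε / (C + 1) * ((1 - ‖z‖)⁻¹ * w ‖z‖) := by
              refine add_le_add (h13.trans (h10.trans ?_)) h11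
              exact mul_le_mul_of_nonneg_left h12 (by positivity)
          _ = _ := by field_simp
    rw [hz, norm_zero, zero_add] at h4
    exact h4


/-! ### The duality theorems -/

theorem summable_sq_mul_geometric {r : ℝ} (h0 : 0 ≤ r) (h1 : r < 1) :
    Summable fun n : ℕ => (((n : ℝ) + 1) + 1) * ((n : ℝ) + 1) * r ^ n := by
  have hr : ‖r‖ < 1 := by rwa [Real.norm_of_nonneg h0]
  have h2 := summable_pow_mul_geometric_of_norm_lt_one (R := ℝ) 2 hr
  have h3 := (summable_pow_mul_geometric_of_norm_lt_one (R := ℝ) 1 hr).mul_left 3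
  have h4 := (summable_pow_mul_geometric_of_norm_lt_one (R := ℝ) 0 hr).mul_left 2
  refine ((h2.add h3).add h4).congr fun n => ?_
  ring

/-- Uses (n+1)² = 2·C(n+2, 2) - C(n+1, 1). At x = ζz the sum is the derivative in z of the test
function z/(1 - ζz)². -/
theorem hasSum_sq_mul_geometric {x : ℂ} (hx : ‖x‖ < 1) :
    HasSum (fun n : ℕ => ((n : ℂ) + 1) ^ 2 * x ^ n) ((1 + x) / (1 - x) ^ 3) := by
  have h2 := (hasSum_choose_mul_geometric_of_norm_lt_one 2 hx).mul_left 2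
  have h1 := hasSum_choose_mul_geometric_of_norm_lt_one 1 hx
  have hne : 1 - x ≠ 0 := by
    intro h
    rw [← sub_eq_zero.1 h, norm_one] at hx
    exact lt_irrefl _ hx
  convert! h2.sub h1 using 1
  · funext n
    rw [Nat.choose_one_right, Nat.cast_choose_two]
    push_cast
    ring
  · field_simp
    ring

theorem norm_sq_mul_geometric_le {x : ℂ} (hx : ‖x‖ < 1) :
    ‖(1 + x) / (1 - x) ^ 3‖ ≤ 2 * (‖1 - x‖ ^ 3)⁻¹ := by
  rw [norm_div, norm_pow, div_eq_mul_inv]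
  gcongr
  refine (norm_add_le _ _).trans ?_
  rw [norm_one]
  linarith

theorem norm_natCast_add_one (n : ℕ) : ‖(n : ℂ) + 1‖ = (n : ℝ) + 1 := by
  exact_mod_cast Complex.norm_natCast (n + 1)

theorem summable_of_le_geometric {c : ℕ → ℂ} {W r : ℝ} (h0 : 0 ≤ r) (h1 : r < 1)
    (hc : ∀ n : ℕ, ‖c (n + 1)‖ ≤ ((n : ℝ) + 1) * r ^ n * W) :
    Summable fun n : ℕ => ((n : ℝ) + 1) * ‖c n‖ := by
  refine (summable_nat_add_iff 1).1 (((summable_sq_mul_geometric h0 h1).mul_right W).of_nonneg_of_le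
    (fun n => by positivity) fun n => ?_)
  push_cast
  calc _ ≤ ((n : ℝ) + 1 + 1) * (((n : ℝ) + 1) * r ^ n * W) := by gcongr; exact hc n
    _ = _ := by ring

theorem DiskSpace.norm_dualSeq_zero_le {X : Type} [NormedAddCommGroup X] [NormedSpace ℂ X]
    {e : X →ₗ[ℂ] (ℂ → ℂ)} (hX : DiskSpace e) :
    ∃ K : ℝ, 0 < K ∧ ∀ Φ : StrongDual ℂ X, ‖hX.dualSeq Φ 0‖ ≤ K * ‖Φ‖ := by
  obtain ⟨K, hK, h⟩ := hX.norm_mono_le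
  refine ⟨K, hK, fun Φ => (Φ.le_opNorm _).trans ?_⟩
  rw [mul_comm]
  gcongr
  simpa using h 0

/-- The value g'(ζ) is Φ applied to h_ζ(z) = ∑ n ζⁿ⁻¹ zⁿ = z/(1 - ζz)², and the kernel estimate
bounds ‖h_ζ‖ in 𝔅¹_w by a multiple of w(|ζ|)/(1 - |ζ|). The coefficient g(0) = Φ(1) is estimated
separately. -/
theorem IsSlow.exists_rep_bloch1 {w : Weight} (hw : IsSlow w) :
    ∃ C : ℝ, ∀ Φ : StrongDual ℂ (Bloch1 w), ∃ g : Bloch w,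
      Bloch.fnLin w g = powerSum (hw.diskSpace_bloch1.dualSeq Φ) ∧ ‖g‖ ≤ C * ‖Φ‖ := by
  obtain ⟨C, hC, hker⟩ := hw.kernel_integral
  have hX := hw.diskSpace_bloch1
  obtain ⟨K, hK, hK0⟩ := hX.norm_dualSeq_zero_le
  have hpi := Real.pi_pos
  refine ⟨K + Real.pi⁻¹ * (2 * C), fun Φ => ?_⟩
  have hb := hX.diskSummable_dualSeq Φ
  obtain ⟨g, hg, hgn⟩ := Bloch.exists_of_bound (w := w) (M := ‖Φ‖ * (Real.pi⁻¹ * (2 * C)))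
    (powerSum_mem_holDisk hb) fun ζ hζ => by
      -- The truncated exponent at n = 0 is harmless because of the factor n.
      let c : ℕ → ℂ := fun n => n * ζ ^ (n - 1)
      have hc : Summable fun n : ℕ => ((n : ℝ) + 1) * ‖c n‖ := by
        refine summable_of_le_geometric (W := 1) (norm_nonneg ζ) hζ fun n => ?_
        simp only [c, add_tsub_cancel_right]
        push_cast
        rw [norm_mul, norm_pow, norm_natCast_add_one, mul_one]
      obtain ⟨h, hh⟩ : ∃ h : Bloch1 w, Bloch1.fnLin w h = powerSum c := by
        obtain ⟨_, -, hs⟩ := hX.exists_series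
        obtain ⟨h, hh, -⟩ := hs c hc
        exact ⟨h, hh⟩
      have h1 := hX.hasSum_dualSeq Φ hc hh
      have h2 : Φ h = deriv (powerSum (hX.dualSeq Φ)) ζ := by
        refine HasSum.unique ?_ (hasSum_deriv_powerSum hb (mem_ball_zero_iff.2 hζ))
        have h3 := (hasSum_nat_add_iff' 1).2 h1
        simp only [c, Finset.range_one, Finset.sum_singleton, Nat.cast_zero, zero_mul,
          sub_zero, add_tsub_cancel_right] at h3
        refine h3.congr_fun fun n => ?_
        push_cast
        ring
      rw [← h2]
      have hh' : h.fn = powerSum c := hh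
      have h4 : ‖h‖ ≤ Real.pi⁻¹ * (2 * C) * ((1 - ‖ζ‖)⁻¹ * w ‖ζ‖) := by
        obtain ⟨hki, hkl⟩ := hker ζ hζ
        rw [Bloch1.norm_def, hh', powerSum_zero]
        have h5 : ∫ z in ball (0 : ℂ) 1, ‖deriv (powerSum c) z‖ * w ‖z‖ ≤
            ∫ z in ball (0 : ℂ) 1, 2 * (w ‖z‖ * (‖1 - ζ * z‖ ^ 3)⁻¹) := by
          refine setIntegral_mono_on ?_ (hki.const_mul 2) measurableSet_ball fun z hz => ?_
          · rw [← hh']; exact h.2.2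
          · have hz' := mem_ball_zero_iff.1 hz
            have hx : ‖ζ * z‖ < 1 := by
              rw [norm_mul]
              nlinarith [norm_nonneg z, norm_nonneg ζ]
            have h6 : deriv (powerSum c) z = (1 + ζ * z) / (1 - ζ * z) ^ 3 := by
              refine (hasSum_deriv_powerSum (diskSummable_of_summable hc) hz).unique ?_
              refine (hasSum_sq_mul_geometric hx).congr_fun fun n => ?_
              simp only [c, add_tsub_cancel_right, mul_pow]
              push_cast
              ring
            have h7 := norm_sq_mul_geometric_le hx
            have hwz := w.pos _ (norm_nonneg z) hz'
            rw [h6]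
            calc _ ≤ 2 * (‖1 - ζ * z‖ ^ 3)⁻¹ * w ‖z‖ := by gcongr
              _ = _ := by ring
        rw [integral_const_mul] at h5
        have h8 : ‖c 0‖ = 0 := by simp [c]
        rw [h8, zero_add]
        calc _ ≤ Real.pi⁻¹ * (2 * (C * ((1 - ‖ζ‖)⁻¹ * w ‖ζ‖))) := by
              gcongr
              exact h5.trans (by gcongr)
          _ = _ := by ring
      calc ‖Φ h‖ ≤ ‖Φ‖ * ‖h‖ := Φ.le_opNorm h
        _ ≤ ‖Φ‖ * (Real.pi⁻¹ * (2 * C) * ((1 - ‖ζ‖)⁻¹ * w ‖ζ‖)) := by gcongr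
        _ = _ := by ring
  refine ⟨g, hg, hgn.trans ?_⟩
  have := hK0 Φ
  rw [powerSum_zero]
  linarith

/-- The integral of |g'| w over |z| < ρ is Φ(h) for a test function h in 𝔟_w of norm at most 2C. The
restriction ρ < 1 makes the coefficients of h decay geometrically, so that h lies in 𝔟_w, while the
bound does not depend on ρ. -/
theorem setIntegral_le_of_littleBloch_dual {w : Weight} (hw : IsSlow w) :
    ∃ C : ℝ, 0 < C ∧ ∀ Φ : StrongDual ℂ (LittleBloch w), ∀ ρ : ℝ, 0 < ρ → ρ < 1 →
      IntegrableOn (fun z => ‖deriv (powerSum (hw.diskSpace_littleBloch.dualSeq Φ)) z‖ * w ‖z‖)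
        (ball 0 ρ) ∧
      ∫ z in ball (0 : ℂ) ρ,
        ‖deriv (powerSum (hw.diskSpace_littleBloch.dualSeq Φ)) z‖ * w ‖z‖ ≤ C * ‖Φ‖ := by
  obtain ⟨C, hC, hker⟩ := hw.kernel_integral
  have hX := hw.diskSpace_littleBloch
  refine ⟨2 * C, by positivity, fun Φ ρ hρ0 hρ1 => ?_⟩
  have hb := hX.diskSummable_dualSeq Φ
  let g := powerSum (hX.dualSeq Φ)
  have hg : g ∈ holDisk := powerSum_mem_holDisk hb
  have hgm : Measurable (deriv g) := measurable_deriv g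
  have hwm := w.measurable
  have hsub : ball (0 : ℂ) ρ ⊆ ball 0 1 := ball_subset_ball hρ1.le
  let μ : Measure ℂ := volume.restrict (ball 0 ρ)
  have hμ : ∀ᵐ z ∂μ, ‖z‖ < ρ := by
    filter_upwards [ae_restrict_mem measurableSet_ball] with z hz using mem_ball_zero_iff.1 hz
  have hwi : Integrable (fun z => w ‖z‖) μ := hw.integrableOn.mono_set hsub
  -- Conjugate phase of g' times the weight, so that g' φ = |g'| w while |φ| ≤ w.
  let φ : ℂ → ℂ := fun ζ => (starRingEnd ℂ) (deriv g ζ) * ((‖deriv g ζ‖⁻¹ : ℝ) : ℂ) * w ‖ζ‖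
  have hφm : Measurable φ := by
    refine Measurable.mul ((Complex.continuous_conj.measurable.comp hgm).mul
      (Complex.measurable_ofReal.comp hgm.norm.inv)) (Complex.measurable_ofReal.comp
        (hwm.comp measurable_norm))
  have hφ1 : ∀ ζ : ℂ, ‖ζ‖ < 1 → ‖φ ζ‖ ≤ w ‖ζ‖ := by
    intro ζ hζ
    have hwz := w.pos _ (norm_nonneg ζ) hζ
    simp only [φ]
    rw [norm_mul, norm_mul, RCLike.norm_conj, Complex.norm_real, Complex.norm_real, norm_inv,
      norm_norm, Real.norm_of_nonneg hwz.le]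
    exact mul_le_of_le_one_left hwz.le mul_inv_le_one
  have hφg : ∀ ζ : ℂ, deriv g ζ * φ ζ = ((‖deriv g ζ‖ * w ‖ζ‖ : ℝ) : ℂ) := by
    intro ζ
    simp only [φ]
    rw [← mul_assoc, ← mul_assoc, Complex.mul_conj', Complex.ofReal_inv, pow_two]
    push_cast
    by_cases h : (‖deriv g ζ‖ : ℂ) = 0
    · simp [h]
    · field_simp
  let W := ∫ z, w ‖z‖ ∂μ
  have hmono : ∀ a : ℂ, ∀ n : ℕ, Integrable (fun ζ => a * (ζ ^ n * φ ζ)) μ ∧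
      ∫ ζ, ‖a * (ζ ^ n * φ ζ)‖ ∂μ ≤ ‖a‖ * ρ ^ n * W := by
    intro a n
    have hle : ∀ᵐ ζ ∂μ, ‖a * (ζ ^ n * φ ζ)‖ ≤ ‖a‖ * ρ ^ n * w ‖ζ‖ := by
      filter_upwards [hμ] with ζ hζ
      rw [norm_mul, norm_mul, norm_pow, mul_assoc]
      gcongr
      exact hφ1 ζ (hζ.trans hρ1)
    have hi : Integrable (fun ζ => a * (ζ ^ n * φ ζ)) μ :=
      (hwi.const_mul (‖a‖ * ρ ^ n)).mono' (Measurable.aestronglyMeasurable (by fun_prop)) hle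
    refine ⟨hi, (integral_mono_ae hi.norm (hwi.const_mul _) hle).trans_eq ?_⟩
    rw [integral_const_mul]
  -- The coefficients of h = ∫ φ(ζ) h_ζ dμ(ζ), where h_ζ(z) = z/(1 - ζz)².
  let c : ℕ → ℂ := fun n => n * ∫ ζ, ζ ^ (n - 1) * φ ζ ∂μ
  have hc : Summable fun n : ℕ => ((n : ℝ) + 1) * ‖c n‖ := by
    refine summable_of_le_geometric (W := W) hρ0.le hρ1 fun n => ?_
    simp only [c, add_tsub_cancel_right]
    push_cast
    rw [norm_mul, norm_natCast_add_one, mul_assoc]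
    gcongr
    refine (norm_integral_le_integral_norm _).trans ?_
    simpa using (hmono 1 n).2
  have hint : Integrable (fun z => deriv g z * φ z) μ := by
    obtain ⟨M, hM⟩ := (isCompact_closedBall (0 : ℂ) ρ).exists_bound_of_continuousOn
      ((hg.1.deriv isOpen_ball).continuousOn.mono (closedBall_subset_ball hρ1))
    refine (hwi.const_mul M).mono' (hgm.mul hφm).aestronglyMeasurable ?_
    filter_upwards [hμ] with z hz
    rw [norm_mul]
    have h1 := hM z (mem_closedBall_zero_iff.2 hz.le)
    have h2 := w.pos _ (norm_nonneg z) (hz.trans hρ1)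
    have h3 := hφ1 z (hz.trans hρ1)
    have h4 := norm_nonneg (deriv g z)
    gcongr
    linarith
  obtain ⟨h, hh⟩ : ∃ h : LittleBloch w, LittleBloch.fnLin w h = powerSum c := by
    obtain ⟨_, -, hs⟩ := hX.exists_series
    obtain ⟨h, hh, -⟩ := hs c hc
    exact ⟨h, hh⟩
  have hh' : Bloch.fn h.1 = powerSum c := hh
  have hΦ : Φ h = ((∫ z, ‖deriv g z‖ * w ‖z‖ ∂μ : ℝ) : ℂ) := by
    have h1 := (hasSum_nat_add_iff' 1).2 (hX.hasSum_dualSeq Φ hc hh)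
    simp only [c, Finset.range_one, Finset.sum_singleton, Nat.cast_zero, zero_mul, sub_zero,
      add_tsub_cancel_right] at h1
    refine h1.unique ?_
    have h2 := diskSummable_of_hasSum fun z hz => hasSum_deriv_powerSum hb hz
    have h3 := hasSum_integral_of_summable_integral_norm (μ := μ)
      (F := fun (n : ℕ) ζ => ((n : ℂ) + 1) * hX.dualSeq Φ (n + 1) * (ζ ^ n * φ ζ))
      (fun n => (hmono _ n).1) (((h2 ρ hρ0.le hρ1).mul_right W).of_nonneg_of_le
        (fun n => integral_nonneg fun ζ => norm_nonneg _) fun n => (hmono _ n).2)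
    rw [← integral_complex_ofReal]
    have h4 : ∫ ζ, ∑' n : ℕ, ((n : ℂ) + 1) * hX.dualSeq Φ (n + 1) * (ζ ^ n * φ ζ) ∂μ =
        ∫ ζ, ((‖deriv g ζ‖ * w ‖ζ‖ : ℝ) : ℂ) ∂μ := by
      refine integral_congr_ae ?_
      filter_upwards [hμ] with ζ hζ
      rw [← hφg]
      refine HasSum.tsum_eq ?_
      refine ((hasSum_deriv_powerSum hb (mem_ball_zero_iff.2 (hζ.trans hρ1))).mul_right
        (φ ζ)).congr_fun fun n => ?_
      ring
    rw [h4] at h3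
    refine h3.congr_fun fun n => ?_
    rw [integral_const_mul]
    push_cast
    ring
  have hhn : ‖h‖ ≤ 2 * C := by
    have h1 := Bloch.norm_le h.1 (M := 2 * C) fun z hz => by
      obtain ⟨hki, hkl⟩ := hker z hz
      have hx : ∀ ζ : ℂ, ‖ζ‖ < ρ → ‖z * ζ‖ < 1 := fun ζ hζ => by
        rw [norm_mul]
        nlinarith [norm_nonneg z, norm_nonneg ζ]
      -- One factor n + 1 comes from c and one from differentiation; summing under the integral
      -- produces the kernel. With |φ| ≤ w and the roles of z and ζ exchanged,
      -- `IsSlow.kernel_integral` applies.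
      have h2 : deriv (powerSum c) z = ∫ ζ, (1 + z * ζ) / (1 - z * ζ) ^ 3 * φ ζ ∂μ := by
        refine (hasSum_deriv_powerSum (diskSummable_of_summable hc)
          (mem_ball_zero_iff.2 hz)).unique ?_
        have h3 := hasSum_integral_of_summable_integral_norm (μ := μ)
          (F := fun (n : ℕ) ζ => ((n : ℂ) + 1) ^ 2 * z ^ n * (ζ ^ n * φ ζ))
          (fun n => (hmono _ n).1) (((summable_sq_mul_geometric hρ0.le hρ1).mul_right
            W).of_nonneg_of_le (fun n => integral_nonneg fun ζ => norm_nonneg _)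
            fun n => (hmono _ n).2.trans ?_)
        · have h4 : ∫ ζ, ∑' n : ℕ, ((n : ℂ) + 1) ^ 2 * z ^ n * (ζ ^ n * φ ζ) ∂μ =
              ∫ ζ, (1 + z * ζ) / (1 - z * ζ) ^ 3 * φ ζ ∂μ := by
            refine integral_congr_ae ?_
            filter_upwards [hμ] with ζ hζ
            refine HasSum.tsum_eq ?_
            refine ((hasSum_sq_mul_geometric (hx ζ hζ)).mul_right (φ ζ)).congr_fun fun n => ?_
            rw [mul_pow]
            ring
          rw [h4] at h3
          refine h3.congr_fun fun n => ?_
          rw [integral_const_mul]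
          simp only [c, add_tsub_cancel_right]
          push_cast
          ring
        · have hW : 0 ≤ W := integral_nonneg_of_ae (by
            filter_upwards [hμ] with ζ hζ using (w.pos _ (norm_nonneg ζ) (hζ.trans hρ1)).le)
          gcongr
          rw [norm_mul, norm_pow, norm_natCast_add_one, norm_pow]
          have : ‖z‖ ^ n ≤ 1 := pow_le_one₀ (norm_nonneg z) hz.le
          nlinarith [sq_nonneg ((n : ℝ) + 1), (Nat.cast_nonneg n : (0 : ℝ) ≤ n)]
      rw [hh', h2]
      calc _ ≤ ∫ ζ, 2 * (w ‖ζ‖ * (‖1 - z * ζ‖ ^ 3)⁻¹) ∂μ := by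
            refine norm_integral_le_of_norm_le
              (IntegrableOn.mono_set (Integrable.const_mul hki 2) hsub) ?_
            filter_upwards [hμ] with ζ hζ
            rw [norm_mul]
            calc _ ≤ 2 * (‖1 - z * ζ‖ ^ 3)⁻¹ * w ‖ζ‖ := by
                  gcongr
                  · exact norm_sq_mul_geometric_le (hx ζ hζ)
                  · exact hφ1 ζ (hζ.trans hρ1)
              _ = _ := by ring
        _ ≤ ∫ ζ in ball (0 : ℂ) 1, 2 * (w ‖ζ‖ * (‖1 - z * ζ‖ ^ 3)⁻¹) := by
            refine setIntegral_mono_set (hki.const_mul 2) ?_ (Eventually.of_forall hsub)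
            filter_upwards [ae_restrict_mem measurableSet_ball] with ζ hζ
            have := w.pos _ (norm_nonneg ζ) (mem_ball_zero_iff.1 hζ)
            simp only [Pi.zero_apply]
            positivity
        _ ≤ 2 * (C * ((1 - ‖z‖)⁻¹ * w ‖z‖)) := by
            rw [integral_const_mul]
            gcongr
        _ = _ := by ring
    have h0 : Bloch.fn h.1 0 = 0 := by
      rw [hh', powerSum_zero]
      simp [c]
    rw [h0, norm_zero, zero_add] at h1
    exact h1
  have hnn : 0 ≤ ∫ z, ‖deriv g z‖ * w ‖z‖ ∂μ := integral_nonneg_of_ae (by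
    filter_upwards [hμ] with ζ hζ
    exact mul_nonneg (norm_nonneg _) (w.pos _ (norm_nonneg ζ) (hζ.trans hρ1)).le)
  refine ⟨?_, ?_⟩
  · refine hint.norm.congr ?_
    filter_upwards [hμ] with z hz
    have := w.pos _ (norm_nonneg z) (hz.trans hρ1)
    rw [hφg, Complex.norm_real, Real.norm_of_nonneg (by positivity)]
  · have h1 := Φ.le_opNorm h
    rw [hΦ, Complex.norm_real, Real.norm_of_nonneg hnn] at h1
    calc _ ≤ ‖Φ‖ * ‖h‖ := h1
      _ ≤ ‖Φ‖ * (2 * C) := by gcongr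
      _ = _ := by ring

/-- The bound on |z| < ρ is uniform in ρ, so exhausting the disk gives integrability on 𝔻 with the
same bound. -/
theorem IsSlow.exists_rep_littleBloch {w : Weight} (hw : IsSlow w) :
    ∃ C : ℝ, ∀ Φ : StrongDual ℂ (LittleBloch w), ∃ g : Bloch1 w,
      Bloch1.fnLin w g = powerSum (hw.diskSpace_littleBloch.dualSeq Φ) ∧ ‖g‖ ≤ C * ‖Φ‖ := by
  obtain ⟨C, hC, h⟩ := setIntegral_le_of_littleBloch_dual hw
  have hX := hw.diskSpace_littleBloch
  obtain ⟨K, hK, hK0⟩ := hX.norm_dualSeq_zero_le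
  have hpi := Real.pi_pos
  refine ⟨K + Real.pi⁻¹ * C, fun Φ => ?_⟩
  have hb := hX.diskSummable_dualSeq Φ
  let F : ℂ → ℝ := fun z => ‖deriv (powerSum (hX.dualSeq Φ)) z‖ * w ‖z‖
  -- The shift by 2 keeps the radius positive at n = 0.
  let ρ : ℕ → ℝ := fun n => 1 - 1 / ((n : ℝ) + 2)
  have hρ0 : ∀ n, 0 < ρ n := fun n => by
    simp only [ρ]
    rw [sub_pos, div_lt_one (by positivity)]
    linarith [(Nat.cast_nonneg n : (0 : ℝ) ≤ n)]
  have hρ1 : ∀ n, ρ n < 1 := fun n => by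
    simp only [ρ]
    have : 0 < 1 / ((n : ℝ) + 2) := by positivity
    linarith
  have hlim : Tendsto ρ atTop (𝓝 1) := by
    have h1 : Tendsto (fun n : ℕ => 1 / ((n : ℝ) + 2)) atTop (𝓝 0) :=
      tendsto_const_nhds.div_atTop (tendsto_atTop_add_const_right _ _ tendsto_natCast_atTop_atTop)
    have h2 := h1.const_sub 1
    rwa [sub_zero] at h2
  have hcov : AECover (volume.restrict (ball (0 : ℂ) 1)) atTop fun n => ball (0 : ℂ) (ρ n) := by
    refine ⟨?_, fun n => measurableSet_ball⟩
    filter_upwards [ae_restrict_mem measurableSet_ball] with z hz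
    filter_upwards [hlim.eventually_const_lt (mem_ball_zero_iff.1 hz)] with n hn
    exact mem_ball_zero_iff.2 hn
  have hres : ∀ n, (volume.restrict (ball (0 : ℂ) 1)).restrict (ball 0 (ρ n)) =
      volume.restrict (ball 0 (ρ n)) := fun n =>
    Measure.restrict_restrict_of_subset (ball_subset_ball (hρ1 n).le)
  have hnn : ∀ z : ℂ, ‖z‖ < 1 → ‖F z‖ = F z := fun z hz =>
    Real.norm_of_nonneg (mul_nonneg (norm_nonneg _) (w.pos _ (norm_nonneg z) hz).le)
  have hle : ∀ n, ∫ z in ball (0 : ℂ) (ρ n), F z ∂(volume.restrict (ball (0 : ℂ) 1)) ≤ C * ‖Φ‖ :=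
    fun n => by
      rw [hres]
      exact (h Φ (ρ n) (hρ0 n) (hρ1 n)).2
  have hint : IntegrableOn F (ball (0 : ℂ) 1) := by
    refine hcov.integrable_of_integral_norm_bounded (C * ‖Φ‖) (fun n => ?_)
      (Eventually.of_forall fun n => ?_)
    · rw [IntegrableOn, hres]
      exact (h Φ (ρ n) (hρ0 n) (hρ1 n)).1
    · refine le_of_eq_of_le ?_ (hle n)
      rw [hres]
      exact setIntegral_congr_fun measurableSet_ball fun z hz =>
        hnn z ((mem_ball_zero_iff.1 hz).trans (hρ1 n))
  obtain ⟨g, hg⟩ : ∃ g : Bloch1 w, g.fn = powerSum (hX.dualSeq Φ) :=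
    ⟨⟨_, powerSum_mem_holDisk hb, hint⟩, rfl⟩
  refine ⟨g, hg, ?_⟩
  rw [Bloch1.norm_def, hg, powerSum_zero, add_mul]
  have h1 : ∫ z in ball (0 : ℂ) 1, F z ≤ C * ‖Φ‖ :=
    le_of_tendsto' (hcov.integral_tendsto_of_countably_generated hint) hle
  refine add_le_add (hK0 Φ) ?_
  rw [mul_assoc]
  exact mul_le_mul_of_nonneg_left h1 (by positivity)

/-- The dual of `𝔅¹_w` is `𝔅_w`. -/
theorem IsSlow.exists_dual_bloch1 {w : Weight} (hw : IsSlow w) :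
    ∃ J : Bloch w ≃L[ℂ] StrongDual ℂ (Bloch1 w), IsPairingIso Bloch1.fn Bloch.fn J := by
  obtain ⟨C, -, hC⟩ := hw.exists_pairing
  exact hw.diskSpace_bloch1.exists_pairingIso (e' := Bloch.fnLin w) Bloch.fn_mem
    (Bloch.fnLin_injective w) ⟨C, hC⟩ hw.exists_rep_bloch1

/-- The dual of `𝔟_w` is `𝔅¹_w`. -/
theorem IsSlow.exists_dual_littleBloch {w : Weight} (hw : IsSlow w) :
    ∃ J : Bloch1 w ≃L[ℂ] StrongDual ℂ (LittleBloch w),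
      IsPairingIso LittleBloch.fn Bloch1.fn J := by
  obtain ⟨C, -, hC⟩ := hw.exists_pairing
  refine hw.diskSpace_littleBloch.exists_pairingIso (e' := Bloch1.fnLin w) Bloch1.fn_mem
    (Bloch1.fnLin_injective w) ⟨C, fun f g => ?_⟩ hw.exists_rep_littleBloch
  -- The bounded pairing of 𝔅¹_w with 𝔅_w is restricted to 𝔟_w, with the two arguments exchanged.
  obtain ⟨L, hL, hn⟩ := hC g f.1
  exact ⟨L, hL.symm, hn.trans_eq (mul_right_comm C ‖g‖ ‖f‖)⟩


/-! ### The Cesàro operator -/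

/-- The coefficients of the Cesàro transform. -/
def cesaroSeq (a : ℕ → ℂ) (n : ℕ) : ℂ :=
  1 / ((n : ℂ) + 1) * ∑ k ∈ Finset.range (n + 1), a k

/-- The coefficients of the Libera transform. -/
def liberaSeq (a : ℕ → ℂ) (n : ℕ) : ℂ := ∑' j : ℕ, a (n + j) / (((n + j : ℕ) : ℂ) + 1)

theorem cesaro_eq (f : ℂ → ℂ) : cesaro f = powerSum (cesaroSeq (coeff f)) := rfl

theorem libera_eq (f : ℂ → ℂ) : libera f = powerSum (liberaSeq (coeff f)) := rfl

/-- Cauchy product with the geometric series. -/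
theorem hasSum_div_one_sub {f : ℂ → ℂ} (hf : f ∈ holDisk) {z : ℂ} (hz : z ∈ ball (0 : ℂ) 1) :
    HasSum (fun n => (∑ k ∈ Finset.range (n + 1), coeff f k) * z ^ n) (f z * (1 - z)⁻¹) := by
  have hz' := mem_ball_zero_iff.1 hz
  have h1 : Summable fun n => ‖coeff f n * z ^ n‖ := by
    simpa using diskSummable_coeff hf ‖z‖ (norm_nonneg z) hz'
  have h2 : Summable fun n : ℕ => ‖z ^ n‖ := by
    simpa using summable_geometric_of_lt_one (norm_nonneg z) hz'
  have h3 : ∀ n, ∑ k ∈ Finset.range (n + 1), coeff f k * z ^ k * z ^ (n - k) =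
      (∑ k ∈ Finset.range (n + 1), coeff f k) * z ^ n := by
    intro n
    rw [Finset.sum_mul]
    refine Finset.sum_congr rfl fun k hk => ?_
    rw [mul_assoc, ← pow_add, Nat.add_sub_cancel' (Nat.lt_succ_iff.1 (Finset.mem_range.1 hk))]
  have h4 := tsum_mul_tsum_eq_tsum_sum_range_of_summable_norm h1 h2
  have h5 := (summable_norm_sum_mul_range_of_summable_norm h1 h2).of_norm
  simp_rw [h3] at h4 h5
  rw [(hasSum_coeff hf hz).tsum_eq, tsum_geometric_of_norm_lt_one hz'] at h4
  rw [h4]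
  exact h5.hasSum

theorem diskSummable_cesaroSeq {f : ℂ → ℂ} (hf : f ∈ holDisk) :
    DiskSummable (cesaroSeq (coeff f)) :=
  (diskSummable_of_hasSum fun _ hz => hasSum_div_one_sub hf hz).mono fun n => by
    rw [cesaroSeq, norm_mul, norm_div, norm_one, norm_natCast_add_one]
    refine mul_le_of_le_one_left (norm_nonneg _) ?_
    rw [div_le_one (by positivity)]
    linarith [(Nat.cast_nonneg n : (0 : ℝ) ≤ n)]

theorem cesaro_mem {f : ℂ → ℂ} (hf : f ∈ holDisk) : cesaro f ∈ holDisk :=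
  powerSum_mem_holDisk (diskSummable_cesaroSeq hf)

theorem coeff_cesaro {f : ℂ → ℂ} (hf : f ∈ holDisk) (n : ℕ) :
    coeff (cesaro f) n = cesaroSeq (coeff f) n :=
  coeff_powerSum (diskSummable_cesaroSeq hf) n

theorem cesaro_apply_zero (f : ℂ → ℂ) : cesaro f 0 = f 0 := by
  rw [cesaro_eq, powerSum_zero, cesaroSeq]
  simp [coeff_zero_eq]

/-- This is (z 𝒞f)' = f/(1 - z): differentiating z 𝒞f multiplies the n-th mean by n + 1 and leaves
the partial sum. -/
theorem cesaro_ode {f : ℂ → ℂ} (hf : f ∈ holDisk) {z : ℂ} (hz : z ∈ ball (0 : ℂ) 1) :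
    cesaro f z + z * deriv (cesaro f) z = f z * (1 - z)⁻¹ := by
  have h0 := hasSum_coeff (cesaro_mem hf) hz
  have h1 := (hasSum_deriv (cesaro_mem hf) hz).mul_left z
  have h2 : HasSum (fun n : ℕ => (n : ℂ) * coeff (cesaro f) n * z ^ n)
      (z * deriv (cesaro f) z) := by
    refine (hasSum_nat_add_iff' 1).1 ?_
    simp only [Finset.range_one, Finset.sum_singleton, Nat.cast_zero, zero_mul, sub_zero]
    refine h1.congr_fun fun n => ?_
    push_cast
    rw [pow_succ]
    ring
  refine (h0.add h2).unique ((hasSum_div_one_sub hf hz).congr_fun fun n => ?_)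
  have : (n : ℂ) + 1 ≠ 0 := by exact_mod_cast n.succ_ne_zero
  rw [coeff_cesaro hf, cesaroSeq]
  field_simp
  ring

/-- Mean value inequality for ζ ↦ ζ 𝒞f(ζ), which vanishes at 0 and has derivative f(ζ)/(1 - ζ); the
factor |z| then cancels. -/
theorem norm_cesaro_le {f : ℂ → ℂ} (hf : f ∈ holDisk) {z : ℂ} (hz : ‖z‖ < 1) {B : ℝ}
    (hB : ∀ ζ : ℂ, ‖ζ‖ ≤ ‖z‖ → ‖f ζ * (1 - ζ)⁻¹‖ ≤ B) : ‖cesaro f z‖ ≤ B := by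
  by_cases h0 : z = 0
  · subst h0
    have := hB 0 le_rfl
    rw [cesaro_apply_zero]
    simpa using this
  have hder : ∀ ζ ∈ ball (0 : ℂ) 1,
      HasDerivAt (fun ζ => ζ * cesaro f ζ) (f ζ * (1 - ζ)⁻¹) ζ := by
    intro ζ hζ
    have h1 := ((cesaro_mem hf).1.differentiableAt (isOpen_ball.mem_nhds hζ)).hasDerivAt
    have h2 : HasDerivAt (fun ζ => ζ * cesaro f ζ)
        (1 * cesaro f ζ + ζ * deriv (cesaro f) ζ) ζ := (hasDerivAt_id' ζ).mul h1
    rwa [one_mul, cesaro_ode hf hζ] at h2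
  have hsub : closedBall (0 : ℂ) ‖z‖ ⊆ ball 0 1 := closedBall_subset_ball hz
  have h1 := (convex_closedBall (0 : ℂ) ‖z‖).norm_image_sub_le_of_norm_deriv_le
    (f := fun ζ => ζ * cesaro f ζ) (x := 0) (y := z) (C := B)
    (fun x hx => (hder x (hsub hx)).differentiableAt)
    (fun x hx => by
      rw [(hder x (hsub hx)).deriv]
      exact hB x (mem_closedBall_zero_iff.1 hx)) (by simp) (by simp)
  rw [zero_mul, sub_zero, sub_zero, norm_mul, mul_comm] at h1
  exact le_of_mul_le_mul_right h1 (norm_pos_iff.2 h0)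

/-- The weights `w`, `v` are slowly varying, `w(r) (1 - r)⁻¹` is dominated by the derivative of
`v`, and `v` is unbounded: then `𝒞` maps `𝔅_w` to `𝔅_v`. -/
structure CesaroPair (w v : Weight) : Prop where
  left : IsSlow w
  right : IsSlow v
  growth : ∃ C : ℝ, 0 < C ∧ ∃ v' : ℝ → ℝ, ∀ s, 0 ≤ s → s < 1 →
    HasDerivAt v (v' s) s ∧ (1 - s)⁻¹ * w s ≤ C * v' s
  lower : ∃ c : ℝ, 0 < c ∧ ∀ r, 0 ≤ r → r < 1 → c ≤ v r
  tendsto : Tendsto v (𝓝[<] 1) atTop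

/-- Coefficients of size O(1/n) give a derivative of size O((1 - |z|)⁻¹), which is negligible
against (1 - |z|)⁻¹ v once v is unbounded. -/
theorem norm_deriv_powerSum_le_of_bounded {c : ℕ → ℂ} (hc : DiskSummable c) {M : ℝ}
    (h : ∀ n : ℕ, ((n : ℝ) + 1) * ‖c (n + 1)‖ ≤ M) {z : ℂ} (hz : ‖z‖ < 1) :
    ‖deriv (powerSum c) z‖ ≤ M * (1 - ‖z‖)⁻¹ := by
  have h1 := hasSum_deriv_powerSum hc (mem_ball_zero_iff.2 hz)
  rw [← h1.tsum_eq]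
  refine tsum_of_norm_bounded ((hasSum_geometric_of_lt_one (norm_nonneg z) hz).mul_left M)
    fun n => ?_
  rw [norm_mul, norm_mul, norm_pow, norm_natCast_add_one]
  gcongr
  exact h n

theorem isClosed_littleBloch (w : Weight) : IsClosed (littleBloch w : Set (Bloch w)) := by
  refine isClosed_of_closure_subset fun g hg => ?_
  rw [SetLike.mem_coe, mem_littleBloch_iff]
  intro ε hε
  obtain ⟨h, hh, hd⟩ := Metric.mem_closure_iff.1 hg (ε / 2) (by positivity)
  obtain ⟨R, hR, hhR⟩ := mem_littleBloch_iff.1 hh (ε / 2) (by positivity)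
  refine ⟨R, hR, fun z h1 h2 => ?_⟩
  have h3 := (g - h).norm_deriv_le h2
  have h4 : deriv (g - h).fn z = deriv g.fn z - deriv h.fn z :=
    have hz := isOpen_ball.mem_nhds (mem_ball_zero_iff.2 h2)
    deriv_sub (g.fn_mem.1.differentiableAt hz) (h.fn_mem.1.differentiableAt hz)
  rw [h4] at h3
  rw [dist_eq_norm] at hd
  have h5 := w.factor_pos h2
  calc ‖deriv g.fn z‖ = ‖(deriv g.fn z - deriv h.fn z) + deriv h.fn z‖ := by
        rw [sub_add_cancel]
    _ ≤ ‖deriv g.fn z - deriv h.fn z‖ + ‖deriv h.fn z‖ := norm_add_le _ _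
    _ ≤ ε / 2 * ((1 - ‖z‖)⁻¹ * w ‖z‖) + ε / 2 * ((1 - ‖z‖)⁻¹ * w ‖z‖) :=
        add_le_add (h3.trans (by gcongr)) (hhR z h1 h2)
    _ = _ := by ring

namespace CesaroPair

variable {w v : Weight}

/-- Along the radius through z the derivative of f is at most ‖f‖ C v', so |f(z)| ≤ |f(0)| + ‖f‖ C
(v(|z|) - v(0)). The lower bound c of v absorbs |f(0)|. -/
theorem norm_apply_le (h : CesaroPair w v) : ∃ M : ℝ, 0 < M ∧ ∀ (f : Bloch w) (z : ℂ), ‖z‖ < 1 →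
    ‖f.fn z‖ ≤ M * ‖f‖ * v ‖z‖ := by
  obtain ⟨C, hC, v', hv'⟩ := h.growth
  obtain ⟨c, hc, hcv⟩ := h.lower
  refine ⟨c⁻¹ + C, by positivity, fun f z hz => ?_⟩
  have h0 : ‖f.fn 0‖ ≤ c⁻¹ * ‖f‖ * v ‖z‖ := by
    calc ‖f.fn 0‖ ≤ ‖f‖ * 1 := by rw [mul_one]; exact f.norm_apply_zero_le
      _ ≤ ‖f‖ * (c⁻¹ * v ‖z‖) := by
          gcongr
          rw [← inv_mul_cancel₀ hc.ne']
          gcongr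
          exact hcv _ (norm_nonneg z) hz
      _ = _ := by ring
  have hv0 := v.pos 0 le_rfl one_pos
  by_cases hz0 : z = 0
  · subst hz0
    refine h0.trans ?_
    rw [norm_zero]
    gcongr
    linarith
  have hr : 0 < ‖z‖ := norm_pos_iff.2 hz0
  let u : ℂ := z / ‖z‖
  have hu : ‖u‖ = 1 := by
    rw [norm_div, Complex.norm_real, norm_norm, div_self hr.ne']
  have hun : ∀ t : ℝ, 0 ≤ t → ‖(t : ℂ) * u‖ = t := fun t ht => by
    rw [norm_mul, hu, mul_one, Complex.norm_real, Real.norm_of_nonneg ht]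
  have hd : ∀ t ∈ Set.Icc 0 ‖z‖,
      HasDerivAt (fun t : ℝ => f.fn (t * u)) (deriv f.fn (t * u) * u) t := by
    intro t ht
    have h1 : (t : ℂ) * u ∈ ball (0 : ℂ) 1 := by
      rw [mem_ball_zero_iff, hun t ht.1]; exact ht.2.trans_lt hz
    have h2 := (f.fn_mem.1.differentiableAt (isOpen_ball.mem_nhds h1)).hasDerivAt
    have h3 : HasDerivAt (fun t : ℝ => (t : ℂ) * u) u t := by
      simpa using (Complex.ofRealCLM.hasDerivAt (x := t)).mul_const u
    exact h2.comp t h3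
  have hB : ∀ t ∈ Set.Icc 0 ‖z‖,
      HasDerivAt (fun t => ‖f.fn 0‖ + ‖f‖ * C * (v t - v 0)) (‖f‖ * C * v' t) t := by
    intro t ht
    exact (((hv' t ht.1 (ht.2.trans_lt hz)).1.sub_const _).const_mul _).const_add _
  have key := image_norm_le_of_norm_deriv_right_le_deriv_boundary'
    (f := fun t : ℝ => f.fn (t * u)) (f' := fun t => deriv f.fn (t * u) * u) (a := 0) (b := ‖z‖)
    (fun t ht => (hd t ht).continuousAt.continuousWithinAt)
    (fun t ht => (hd t (Set.Ico_subset_Icc_self ht)).hasDerivWithinAt)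
    -- A differential comparison along the radius: only pointwise derivative bounds enter, so
    -- integrability of v' is not required.
    (B := fun t => ‖f.fn 0‖ + ‖f‖ * C * (v t - v 0)) (B' := fun t => ‖f‖ * C * v' t)
    (by simp) (fun t ht => (hB t ht).continuousAt.continuousWithinAt)
    (fun t ht => (hB t (Set.Ico_subset_Icc_self ht)).hasDerivWithinAt)
    (fun t ht => by
      have ht1 : t < 1 := ht.2.trans hz
      have h1 := f.norm_deriv_le (z := t * u) (by rwa [hun t ht.1])
      rw [hun t ht.1] at h1
      rw [norm_mul, hu, mul_one, mul_assoc]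
      exact h1.trans (mul_le_mul_of_nonneg_left (hv' t ht.1 ht1).2 (norm_nonneg f)))
    (Set.right_mem_Icc.2 hr.le)
  have hzu : ((‖z‖ : ℝ) : ℂ) * u = z := by
    have : (‖z‖ : ℂ) ≠ 0 := by exact_mod_cast hr.ne'
    simp only [u]
    field_simp
  simp only [hzu] at key
  have h5 : ‖f‖ * C * (v ‖z‖ - v 0) ≤ C * ‖f‖ * v ‖z‖ := by
    rw [mul_comm ‖f‖ C]
    gcongr
    linarith
  calc _ ≤ _ := key
    _ ≤ c⁻¹ * ‖f‖ * v ‖z‖ + C * ‖f‖ * v ‖z‖ := add_le_add h0 h5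
    _ = _ := by ring

/-- In z (𝒞f)' = f/(1 - z) - 𝒞f both terms on the right are O(v/(1 - |z|)). Division by z is safe
away from 0, and the maximum principle covers the inner disk. -/
theorem norm_deriv_cesaro_le (h : CesaroPair w v) : ∃ M : ℝ, 0 < M ∧ ∀ (f : Bloch w) (z : ℂ),
    ‖z‖ < 1 → ‖deriv (cesaro f.fn) z‖ ≤ M * ‖f‖ * ((1 - ‖z‖)⁻¹ * v ‖z‖) := by
  obtain ⟨M, hM, hf⟩ := h.norm_apply_le
  obtain ⟨C, hC, hmono⟩ := h.right.almost_mono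
  obtain ⟨c, hc, hcv⟩ := h.lower
  have hF : ∀ (f : Bloch w) (z : ℂ), ‖z‖ < 1 → ∀ ζ : ℂ, ‖ζ‖ ≤ ‖z‖ →
      ‖f.fn ζ * (1 - ζ)⁻¹‖ ≤ M * ‖f‖ * (C * ((1 - ‖z‖)⁻¹ * v ‖z‖)) := by
    intro f z hz ζ hζ
    have hζ1 := hζ.trans_lt hz
    have h1 : 0 < 1 - ‖ζ‖ := by linarith
    have h2 : 1 - ‖ζ‖ ≤ ‖1 - ζ‖ := by
      have := norm_sub_norm_le 1 ζ
      rwa [norm_one] at this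
    have h3 := v.pos _ (norm_nonneg ζ) hζ1
    rw [norm_mul, norm_inv]
    calc _ ≤ (M * ‖f‖ * v ‖ζ‖) * (1 - ‖ζ‖)⁻¹ := by
          gcongr
          exact hf f ζ hζ1
      _ = M * ‖f‖ * ((1 - ‖ζ‖)⁻¹ * v ‖ζ‖) := by ring
      _ ≤ _ := by
          exact mul_le_mul_of_nonneg_left (hmono _ _ (norm_nonneg ζ) hζ hz) (by positivity)
  -- The constant 4 is 2 for the two terms of the equation times 2 for dividing by |z| ≥ 1/2.
  have hbig : ∀ (f : Bloch w) (z : ℂ), 1 / 2 ≤ ‖z‖ → ‖z‖ < 1 →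
      ‖deriv (cesaro f.fn) z‖ ≤ 4 * (M * ‖f‖ * (C * ((1 - ‖z‖)⁻¹ * v ‖z‖))) := by
    intro f z hz2 hz
    have h1 := cesaro_ode f.fn_mem (mem_ball_zero_iff.2 hz)
    have h2 : ‖z‖ * ‖deriv (cesaro f.fn) z‖ ≤
        2 * (M * ‖f‖ * (C * ((1 - ‖z‖)⁻¹ * v ‖z‖))) := by
      rw [← norm_mul, eq_sub_of_add_eq' h1, two_mul]
      exact (norm_sub_le _ _).trans
        (add_le_add (hF f z hz z le_rfl) (norm_cesaro_le f.fn_mem hz (hF f z hz)))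
    nlinarith [norm_nonneg (deriv (cesaro f.fn) z)]
  have hv2 := v.pos (1 / 2) (by norm_num) (by norm_num)
  refine ⟨4 * M * C + 4 * M * C * (2 * v (1 / 2) * c⁻¹), by positivity, fun f z hz => ?_⟩
  have hvz := v.factor_pos hz
  rcases le_or_gt (1 / 2) ‖z‖ with h2 | h2
  · refine (hbig f z h2 hz).trans ?_
    have : 0 ≤ 4 * M * C * (2 * v (1 / 2) * c⁻¹) * ‖f‖ * ((1 - ‖z‖)⁻¹ * v ‖z‖) := by positivity
    linarith
  -- On |ζ| = 1/2 the bound reads (1 - 1/2)⁻¹ v(1/2) = 2 v(1/2); v ≥ c converts it into a multiple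
  -- of v(|z|)/(1 - |z|) inside.
  · have hd : DiffContOnCl ℂ (deriv (cesaro f.fn)) (ball 0 (1 / 2)) := by
      refine DifferentiableOn.diffContOnCl
        (((cesaro_mem f.fn_mem).1.deriv isOpen_ball).mono ?_)
      exact closure_ball_subset_closedBall.trans (closedBall_subset_ball (by norm_num))
    have h3 := Complex.norm_le_of_forall_mem_frontier_norm_le isBounded_ball hd
      (C := 4 * (M * ‖f‖ * (C * (2 * v (1 / 2))))) (fun ζ hζ => by
        rw [frontier_ball _ (by norm_num), mem_sphere_zero_iff_norm] at hζ
        refine (hbig f ζ hζ.ge (by rw [hζ]; norm_num)).trans_eq ?_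
        rw [hζ]
        norm_num) (z := z) (subset_closure (mem_ball_zero_iff.2 h2))
    have h4 : 1 ≤ c⁻¹ * ((1 - ‖z‖)⁻¹ * v ‖z‖) := by
      have h5 : 1 ≤ (1 - ‖z‖)⁻¹ := (one_le_inv₀ (by linarith)).2 (by linarith [norm_nonneg z])
      have h6 := hcv _ (norm_nonneg z) hz
      calc 1 = c⁻¹ * (1 * c) := by field_simp
        _ ≤ _ := by gcongr
    calc _ ≤ 4 * (M * ‖f‖ * (C * (2 * v (1 / 2)))) * 1 := by rw [mul_one]; exact h3
      _ ≤ 4 * (M * ‖f‖ * (C * (2 * v (1 / 2)))) * (c⁻¹ * ((1 - ‖z‖)⁻¹ * v ‖z‖)) := by gcongr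
      _ ≤ _ := by
        have : 0 ≤ 4 * M * C * ‖f‖ * ((1 - ‖z‖)⁻¹ * v ‖z‖) := by positivity
        linarith

theorem cesaro_add {f g : ℂ → ℂ} (hf : f ∈ holDisk) (hg : g ∈ holDisk) :
    cesaro (f + g) = cesaro f + cesaro g :=
  holDisk_ext (cesaro_mem (add_mem hf hg)) (add_mem (cesaro_mem hf) (cesaro_mem hg)) fun n => by
    rw [coeff_cesaro (add_mem hf hg), coeff_add (cesaro_mem hf) (cesaro_mem hg), coeff_cesaro hf,
      coeff_cesaro hg]
    simp only [cesaroSeq, coeff_add hf hg, Finset.sum_add_distrib, mul_add]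

theorem cesaro_smul {f : ℂ → ℂ} (hf : f ∈ holDisk) (a : ℂ) :
    cesaro (a • f) = a • cesaro f :=
  holDisk_ext (cesaro_mem (Submodule.smul_mem _ a hf)) (Submodule.smul_mem _ a (cesaro_mem hf))
    fun n => by
      rw [coeff_cesaro (Submodule.smul_mem _ a hf), coeff_smul (cesaro_mem hf), coeff_cesaro hf]
      simp only [cesaroSeq, coeff_smul hf, ← Finset.mul_sum]
      ring

theorem exists_cesaro (h : CesaroPair w v) :
    ∃ S : Bloch w →L[ℂ] Bloch v, ∀ f, (S f).fn = cesaro f.fn := by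
  obtain ⟨M, hM, hMf⟩ := h.norm_deriv_cesaro_le
  have hex := fun f : Bloch w => Bloch.exists_of_bound (w := v) (cesaro_mem f.fn_mem) (hMf f)
  choose S hS hSn using hex
  let S₀ : Bloch w →ₗ[ℂ] Bloch v :=
    { toFun := S
      map_add' := fun f g => Bloch.fnLin_injective v (by
        rw [map_add, Bloch.fnLin_apply, Bloch.fnLin_apply, Bloch.fnLin_apply, hS, hS, hS]
        exact cesaro_add f.fn_mem g.fn_mem)
      map_smul' := fun a f => Bloch.fnLin_injective v (by
        rw [map_smul, Bloch.fnLin_apply, Bloch.fnLin_apply, hS, hS]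
        exact cesaro_smul f.fn_mem a) }
  refine ⟨S₀.mkContinuous (1 + M) fun f => ?_, hS⟩
  have h1 := hSn f
  rw [cesaro_apply_zero] at h1
  have h2 := f.norm_apply_zero_le
  change ‖S f‖ ≤ _
  linarith

theorem coeff_powerSum_monoSeq (n m : ℕ) :
    coeff (powerSum (monoSeq n)) m = if m = n then 1 else 0 := by
  rw [coeff_powerSum (diskSummable_monoSeq n), monoSeq, Pi.single_apply]

theorem coeff_cesaro_mono (n m : ℕ) : coeff (cesaro (powerSum (monoSeq n))) m =
    if m < n then 0 else 1 / ((m : ℂ) + 1) := by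
  rw [coeff_cesaro (powerSum_mem_holDisk (diskSummable_monoSeq n)), cesaroSeq]
  simp only [coeff_powerSum_monoSeq]
  rw [Finset.sum_ite_eq']
  by_cases h : m < n
  · rw [if_neg (by simpa using h), if_pos h, mul_zero]
  · rw [if_pos (by simp; omega), if_neg h, mul_one]

theorem mem_littleBloch_of_bounded (h : CesaroPair w v) {g : Bloch v} {M : ℝ}
    (hg : ∀ z : ℂ, ‖z‖ < 1 → ‖deriv g.fn z‖ ≤ M * (1 - ‖z‖)⁻¹) : g ∈ littleBloch v := by
  rw [mem_littleBloch_iff]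
  intro ε hε
  have h2 := h.tendsto.eventually_ge_atTop (M / ε)
  rw [(nhdsLT_basis (1 : ℝ)).eventually_iff] at h2
  obtain ⟨R, hR, h2⟩ := h2
  refine ⟨R, hR, fun z h3 h4 => (hg z h4).trans ?_⟩
  have h5 := h2 ⟨h3, h4⟩
  rw [div_le_iff₀' hε] at h5
  have h6 : 0 < (1 - ‖z‖)⁻¹ := inv_pos.2 (by linarith)
  calc _ ≤ ε * v ‖z‖ * (1 - ‖z‖)⁻¹ := by gcongr
    _ = _ := by ring

/-- The preimage of the closed subspace 𝔟_v under 𝒞 is closed and contains the monomials, whose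
transforms have coefficients 0 or 1/(m+1); polynomials are dense in 𝔟_w. -/
theorem exists_cesaro_little (h : CesaroPair w v) :
    ∃ T : LittleBloch w →L[ℂ] LittleBloch v, ∀ f, (T f).fn = cesaro f.fn := by
  obtain ⟨S, hS⟩ := h.exists_cesaro
  have hX := h.left.diskSpace_littleBloch
  let S₁ : LittleBloch w →L[ℂ] Bloch v := S.comp (littleBloch w).subtypeL
  have hmem : ∀ f : LittleBloch w, S₁ f ∈ littleBloch v := by
    intro f
    have hcl : IsClosed (((littleBloch v).comap S₁.toLinearMap : Submodule ℂ (LittleBloch w)) :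
        Set (LittleBloch w)) := (isClosed_littleBloch v).preimage S₁.continuous
    refine hX.mem_of_isClosed hcl (fun n => ?_) f
    refine h.mem_littleBloch_of_bounded (M := 1) fun z hz => ?_
    have h1 : (S₁ (hX.mono n)).fn = cesaro (powerSum (monoSeq n)) := by
      rw [← hX.apply_mono n]; exact hS _
    have h2 := diskSummable_monoSeq n
    change ‖deriv (S₁ (hX.mono n)).fn z‖ ≤ _
    rw [h1, cesaro_eq]
    refine norm_deriv_powerSum_le_of_bounded
      (diskSummable_cesaroSeq (powerSum_mem_holDisk h2)) (fun m => ?_) hz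
    rw [← coeff_cesaro (powerSum_mem_holDisk h2), coeff_cesaro_mono]
    split_ifs
    · simp
    · rw [norm_div, norm_one, norm_natCast_add_one]
      push_cast
      rw [mul_one_div, div_le_one (by positivity)]
      linarith
  exact ⟨S₁.codRestrict (littleBloch v) hmem, fun f => hS f.1⟩

/-! ### The Libera operator -/

/-- The partial sums are pairings of f with polynomials whose coefficients have modulus at most
1/(n+1) and the conjugate phases of f̂(n). These are bounded in 𝔅_v because v ≥ c > 0, so
boundedness of the pairing bounds the sums. -/
theorem liberaDefined (h : CesaroPair w v) (f : Bloch1 v) : LiberaDefined f.fn := by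
  obtain ⟨C, hC, hpair⟩ := h.right.exists_pairing
  obtain ⟨c, hc, hcv⟩ := h.lower
  refine summable_of_sum_range_le (c := C * ‖f‖ * (1 + c⁻¹)) (fun n => by positivity) fun N => ?_
  let d : ℕ → ℂ := fun n => if n < N then
    (starRingEnd ℂ) (coeff f.fn n) * ((‖coeff f.fn n‖⁻¹ : ℝ) : ℂ) / ((n : ℂ) + 1) else 0
  have hd : DiskSummable d := diskSummable_of_finite N fun n hn => if_neg (by omega)
  have hdn : ∀ n, ‖d n‖ ≤ 1 / ((n : ℝ) + 1) := by
    intro n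
    simp only [d]
    split_ifs
    · rw [norm_div, norm_mul, RCLike.norm_conj, Complex.norm_real, norm_inv, norm_norm,
        norm_natCast_add_one]
      gcongr
      exact mul_inv_le_one
    · rw [norm_zero]
      positivity
  obtain ⟨g, hg, hgn⟩ := Bloch.exists_of_bound (w := v) (M := c⁻¹) (powerSum_mem_holDisk hd)
    fun z hz => by
      refine (norm_deriv_powerSum_le_of_bounded hd (M := 1) (fun n => ?_) hz).trans ?_
      · calc _ ≤ ((n : ℝ) + 1) * (1 / (((n + 1 : ℕ) : ℝ) + 1)) := by gcongr; exact hdn _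
          _ ≤ 1 := by
            push_cast
            rw [mul_one_div, div_le_one (by positivity)]
            linarith
      · have h6 : 0 < (1 - ‖z‖)⁻¹ := inv_pos.2 (by linarith)
        calc 1 * (1 - ‖z‖)⁻¹ = c⁻¹ * ((1 - ‖z‖)⁻¹ * c) := by field_simp
          _ ≤ _ := by gcongr; exact hcv _ (norm_nonneg z) hz
  have hgn' : ‖g‖ ≤ 1 + c⁻¹ := by
    refine hgn.trans ?_
    rw [powerSum_zero]
    have := hdn 0
    simp only [Nat.cast_zero, zero_add, div_one] at this
    linarith
  obtain ⟨L, hL, hLn⟩ := hpair f g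
  have hterm : ∀ n, coeff f.fn n * coeff g.fn n =
      if n < N then ((‖coeff f.fn n‖ / ((n : ℝ) + 1) : ℝ) : ℂ) else 0 := by
    intro n
    rw [hg, coeff_powerSum hd]
    simp only [d]
    split_ifs
    · rw [mul_div_assoc', ← mul_assoc, Complex.mul_conj']
      push_cast
      congr 1
      by_cases h0 : (‖coeff f.fn n‖ : ℂ) = 0
      · simp [h0]
      · field_simp
    · rw [mul_zero]
  have hzero : ∀ n ∉ Finset.range N, coeff f.fn n * coeff g.fn n = 0 := by
    intro n hn
    rw [hterm, if_neg (by simpa using hn)]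
  have hval : L = ((∑ n ∈ Finset.range N, ‖coeff f.fn n‖ / ((n : ℝ) + 1) : ℝ) : ℂ) := by
    refine hL.unique ?_
    have h1 := hasAbelPairing_of_summable (f := f.fn) (g := g.fn)
      (summable_of_ne_finset_zero (s := Finset.range N) fun n hn => by rw [hzero n hn, norm_zero])
    rw [tsum_eq_sum hzero, Finset.sum_congr rfl fun n hn => by
      rw [hterm n, if_pos (Finset.mem_range.1 hn)]] at h1
    push_cast at h1 ⊢
    exact h1
  rw [hval, Complex.norm_real, Real.norm_of_nonneg (Finset.sum_nonneg fun n _ => by positivity)]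
    at hLn
  exact hLn.trans (by gcongr)

/-- The function 𝒞zⁿ has coefficients 1/(m+1) for m ≥ n, so the Libera condition is exactly what
makes the pairing converge absolutely. -/
theorem hasAbelPairing_cesaro_mono (n : ℕ) {g : ℂ → ℂ} (hg : LiberaDefined g) :
    HasAbelPairing (cesaro (powerSum (monoSeq n))) g (liberaSeq (coeff g) n) := by
  have hterm : ∀ m, coeff (cesaro (powerSum (monoSeq n))) m * coeff g m =
      if m < n then 0 else coeff g m / ((m : ℂ) + 1) := by
    intro m
    rw [coeff_cesaro_mono]
    split_ifs
    · rw [zero_mul]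
    · ring
  have hs : Summable fun m => ‖coeff (cesaro (powerSum (monoSeq n))) m * coeff g m‖ := by
    refine Summable.of_nonneg_of_le (fun m => norm_nonneg _) (fun m => ?_) hg
    rw [hterm]
    split_ifs
    · rw [norm_zero]
      positivity
    · rw [norm_div, norm_natCast_add_one]
  have h1 := hasAbelPairing_of_summable hs
  rw [← hs.of_norm.sum_add_tsum_nat_add n, Finset.sum_eq_zero fun m hm => by
    rw [hterm, if_pos (Finset.mem_range.1 hm)], zero_add] at h1
  refine (congrArg (HasAbelPairing _ g) (tsum_congr fun j => ?_)).mp h1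
  rw [hterm, if_neg (by omega), add_comm j n]

theorem coeff_libera_mono (n m : ℕ) : liberaSeq (coeff (powerSum (monoSeq n))) m =
    if m ≤ n then 1 / ((n : ℂ) + 1) else 0 := by
  simp only [liberaSeq, coeff_powerSum_monoSeq]
  split_ifs with h
  · rw [tsum_eq_single (n - m) fun j hj => by rw [if_neg (by omega), zero_div],
      if_pos (by omega), Nat.add_sub_cancel' h]
  · refine (tsum_congr fun j => ?_).trans tsum_zero
    rw [if_neg (by omega), zero_div]

theorem diskSummable_liberaSeq_mono (n : ℕ) :
    DiskSummable (liberaSeq (coeff (powerSum (monoSeq n)))) :=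
  diskSummable_of_finite (n + 1) fun m hm => by rw [coeff_libera_mono, if_neg (by omega)]

/-- Here Λzⁿ is the polynomial (1 + z + … + zⁿ)/(n+1), so the pairing is a finite sum, namely a
Cesàro mean of ĝ. -/
theorem hasAbelPairing_libera_mono (n : ℕ) (g : ℂ → ℂ) :
    HasAbelPairing (libera (powerSum (monoSeq n))) g (cesaroSeq (coeff g) n) := by
  have hterm : ∀ m, coeff (libera (powerSum (monoSeq n))) m * coeff g m =
      if m ≤ n then 1 / ((n : ℂ) + 1) * coeff g m else 0 := by
    intro m
    rw [libera_eq, coeff_powerSum (diskSummable_liberaSeq_mono n), coeff_libera_mono]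
    split_ifs
    · rfl
    · rw [zero_mul]
  have hzero : ∀ m ∉ Finset.range (n + 1),
      coeff (libera (powerSum (monoSeq n))) m * coeff g m = 0 := by
    intro m hm
    rw [hterm, if_neg (by simpa [Nat.lt_succ_iff] using hm)]
  have h1 := hasAbelPairing_of_summable (summable_of_ne_finset_zero (s := Finset.range (n + 1))
    fun m hm => by rw [hzero m hm, norm_zero])
  rw [tsum_eq_sum hzero, Finset.sum_congr rfl fun m hm => by
    rw [hterm m, if_pos (Nat.lt_succ_iff.1 (Finset.mem_range.1 hm))], ← Finset.mul_sum] at h1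
  exact h1

/-! ### The adjoints -/

/-- The Banach space adjoint, transported to the spaces that represent the duals. -/
theorem exists_adjoint {X X' Y Y' : Type} [NormedAddCommGroup X] [NormedSpace ℂ X]
    [NormedAddCommGroup X'] [NormedSpace ℂ X'] [NormedAddCommGroup Y] [NormedSpace ℂ Y]
    [NormedAddCommGroup Y'] [NormedSpace ℂ Y'] (T : X →L[ℂ] Y) (JX : X' ≃L[ℂ] StrongDual ℂ X)
    (JY : Y' ≃L[ℂ] StrongDual ℂ Y) :
    ∃ S : Y' →L[ℂ] X', ∀ g : Y', (JY g).comp T = JX (S g) :=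
  ⟨(JX.symm : StrongDual ℂ X →L[ℂ] X').comp
    (((ContinuousLinearMap.compL ℂ X Y ℂ).flip T).comp (JY : Y' →L[ℂ] StrongDual ℂ Y)),
    fun g => by simp⟩

/-- The candidate S is the abstract Banach adjoint, hence bounded. Its coefficients are the pairings
with zⁿ, which equal those of g with 𝒞zⁿ; so S = Λ, and Λ is bounded without an estimate of its own.
-/
theorem isPairingAdjoint_cesaro (h : CesaroPair w v) :
    IsPairingAdjoint (X := LittleBloch w) (X' := Bloch1 w) (Y := LittleBloch v) (Y' := Bloch1 v)
      LittleBloch.fn Bloch1.fn LittleBloch.fn Bloch1.fn cesaro libera := by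
  obtain ⟨T, hT⟩ := h.exists_cesaro_little
  obtain ⟨JX, hJX⟩ := h.left.exists_dual_littleBloch
  obtain ⟨JY, hJY⟩ := h.right.exists_dual_littleBloch
  have hX := h.left.diskSpace_littleBloch
  obtain ⟨S, hadj⟩ := exists_adjoint T JX JY
  refine ⟨T, S, JX, JY, hT, fun g => ?_, hJX, hJY, hadj⟩
  rw [libera_eq, ← powerSum_coeff (S g).fn_mem]
  congr 1
  funext n
  have hmono : (hX.mono n).fn = powerSum (monoSeq n) := hX.apply_mono n
  have h1 := hJX (hX.mono n) (S g)
  rw [hmono] at h1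
  have h2 := hJY (T (hX.mono n)) g
  rw [hT, hmono] at h2
  rw [(hasAbelPairing_monoSeq n _).unique h1, ← hadj]
  exact h2.unique (hasAbelPairing_cesaro_mono n (h.liberaDefined g))

theorem adjointOfCesaro (h : CesaroPair w v) : AdjointOfCesaro w v :=
  ⟨h.liberaDefined, h.isPairingAdjoint_cesaro⟩

theorem adjointOfLibera (h : CesaroPair w v) : AdjointOfLibera v w := by
  -- Boundedness of Λ from 𝔅¹_v to 𝔅¹_w is extracted from the adjoint relation just obtained.
  obtain ⟨-, T, -, -, -, hT, -⟩ := h.isPairingAdjoint_cesaro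
  obtain ⟨S, hS⟩ := h.exists_cesaro
  obtain ⟨JX, hJX⟩ := h.right.exists_dual_bloch1
  obtain ⟨JY, hJY⟩ := h.left.exists_dual_bloch1
  have hX := h.right.diskSpace_bloch1
  refine ⟨h.liberaDefined, T, S, JX, JY, hT, hS, hJX, hJY, fun g => ?_⟩
  rw [← JX.symm_apply_eq]
  have hJ : JX (JX.symm ((JY g).comp T)) = (JY g).comp T := JX.apply_symm_apply _
  refine Bloch.fnLin_injective v (holDisk_ext (Bloch.fn_mem _) (Bloch.fn_mem _) fun n => ?_)
  have hmono : (hX.mono n).fn = powerSum (monoSeq n) := hX.apply_mono n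
  have h1 := hJX (hX.mono n) (JX.symm ((JY g).comp T))
  rw [hmono, hJ] at h1
  have h2 := hJY (T (hX.mono n)) g
  rw [hT, hmono] at h2
  rw [Bloch.fnLin_apply, Bloch.fnLin_apply, (hasAbelPairing_monoSeq n _).unique h1, hS,
    coeff_cesaro g.fn_mem]
  exact h2.unique (hasAbelPairing_libera_mono n _)

end CesaroPair


/-! ### The logarithmic weights -/

section Ratio

variable {x y : ℝ}

theorem ratio_comm (x y : ℝ) : (x + y) / √(x * y) = (y + x) / √(y * x) := by
  rw [add_comm, mul_comm]

theorem one_le_ratio (hx : 0 < x) (hy : 0 < y) : 1 ≤ (x + y) / √(x * y) := by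
  rw [one_le_div (Real.sqrt_pos.2 (mul_pos hx hy))]
  exact Real.sqrt_le_iff.2 ⟨by positivity, by nlinarith⟩

/-- The square of the ratio is (x + y)²/(xy) ≥ y/x. -/
theorem log_sub_log_le_ratio (hx : 0 < x) (hy : 0 < y) :
    Real.log y - Real.log x ≤ 2 * Real.log ((x + y) / √(x * y)) := by
  rw [Real.log_div (by positivity) (by positivity), Real.log_sqrt (by positivity),
    Real.log_mul hx.ne' hy.ne']
  have h := Real.log_le_log hy (by linarith : y ≤ x + y)
  linarith

end Ratio

theorem log_two_div_eq {s : ℝ} (hs : s < 1) :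
    Real.log (2 / (1 - s)) = Real.log 2 - Real.log (1 - s) :=
  Real.log_div two_ne_zero (by linarith)

theorem log_four_div_eq {s : ℝ} (hs : s < 1) :
    Real.log (4 / (1 - s)) = Real.log 4 - Real.log (1 - s) :=
  Real.log_div four_ne_zero (by linarith)

theorem log_one_sub_nonpos {s : ℝ} (hs0 : 0 ≤ s) (hs : s < 1) : Real.log (1 - s) ≤ 0 :=
  Real.log_nonpos (by linarith) (by linarith)

theorem log_two_le {s : ℝ} (hs0 : 0 ≤ s) (hs : s < 1) :
    Real.log 2 ≤ Real.log (2 / (1 - s)) := by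
  rw [log_two_div_eq hs]
  linarith [log_one_sub_nonpos hs0 hs]

theorem log_four_le {s : ℝ} (hs0 : 0 ≤ s) (hs : s < 1) :
    Real.log 4 ≤ Real.log (4 / (1 - s)) := by
  rw [log_four_div_eq hs]
  linarith [log_one_sub_nonpos hs0 hs]

theorem one_lt_log_four : 1 < Real.log 4 := by
  rw [Real.lt_log_iff_exp_lt (by norm_num)]
  linarith [Real.exp_one_lt_d9]

/-- Passing from r to s changes the logarithm by at most 2 log q, where q is the ratio in `IsSlow`.
Since log q ≤ γ q^{1/γ} and log(2/(1 - r)) ≥ log 2, the additive error becomes a factor K q^{1/γ};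
raising to the power γ leaves exactly one q. -/
theorem exists_log_rpow_le {γ : ℝ} (hγ : 0 < γ) :
    ∃ C : ℝ, 0 < C ∧ ∀ s r : ℝ, 0 ≤ s → s < 1 → 0 ≤ r → r < 1 →
      Real.log (2 / (1 - s)) ^ γ ≤ C * Real.log (2 / (1 - r)) ^ γ *
        (((1 - s) + (1 - r)) / √((1 - s) * (1 - r))) := by
  have h2 : 0 < Real.log 2 := Real.log_pos one_lt_two
  set K : ℝ := 1 + 2 / Real.log 2 * γ with hK
  have hK0 : 0 < K := by positivity
  refine ⟨K ^ γ, Real.rpow_pos_of_pos hK0 γ, fun s r hs0 hs hr0 hr => ?_⟩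
  have hx : 0 < 1 - s := by linarith
  have hy : 0 < 1 - r := by linarith
  have hq := one_le_ratio hx hy
  have hlog := log_sub_log_le_ratio hx hy
  set q : ℝ := ((1 - s) + (1 - r)) / √((1 - s) * (1 - r))
  have hLr := log_two_le hr0 hr
  have hLs := log_two_le hs0 hs
  set Q : ℝ := q ^ γ⁻¹
  have hQ1 : 1 ≤ Q := Real.one_le_rpow hq (inv_pos.2 hγ).le
  have hQ : Real.log q ≤ Q * γ := by
    have := Real.log_le_rpow_div (zero_le_one.trans hq) (inv_pos.2 hγ)
    rwa [div_inv_eq_mul] at this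
  have key : Real.log (2 / (1 - s)) ≤ K * Real.log (2 / (1 - r)) * Q := by
    set M := Real.log (2 / (1 - r)) with hM
    have e : Real.log (2 / (1 - s)) ≤ M + 2 * Real.log q := by
      rw [hM, log_two_div_eq hs, log_two_div_eq hr]
      linarith
    have hM0 : 0 < M := h2.trans_le hLr
    have h3 : M ≤ M * Q := le_mul_of_one_le_right hM0.le hQ1
    have h4 : 1 ≤ M / Real.log 2 := (one_le_div h2).2 hLr
    have h5 : 2 * (Q * γ) ≤ M / Real.log 2 * (2 * (Q * γ)) :=
      le_mul_of_one_le_left (by positivity) h4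
    calc Real.log (2 / (1 - s)) ≤ M * Q + M / Real.log 2 * (2 * (Q * γ)) := by linarith
      _ = K * M * Q := by rw [hK]; ring
  calc Real.log (2 / (1 - s)) ^ γ ≤ (K * Real.log (2 / (1 - r)) * Q) ^ γ :=
        Real.rpow_le_rpow (h2.le.trans hLs) key hγ.le
    _ = K ^ γ * Real.log (2 / (1 - r)) ^ γ * q := by
        rw [Real.mul_rpow (mul_nonneg hK0.le (h2.le.trans hLr)) (zero_le_one.trans hQ1),
          Real.mul_rpow hK0.le (h2.le.trans hLr), Real.rpow_inv_rpow (zero_le_one.trans hq) hγ.ne']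

theorem isSlow_logWeight (β : ℝ) : IsSlow (logWeight β) := by
  change ∃ C : ℝ, 0 < C ∧ ∀ s r : ℝ, 0 ≤ s → s < 1 → 0 ≤ r → r < 1 →
      Real.log (2 / (1 - s)) ^ β ≤ C * Real.log (2 / (1 - r)) ^ β *
        (((1 - s) + (1 - r)) / √((1 - s) * (1 - r)))
  rcases lt_trichotomy β 0 with hβ | rfl | hβ
  -- For negative exponents the inequality with s and r exchanged is inverted; the ratio is
  -- symmetric.
  · obtain ⟨C, hC, h⟩ := exists_log_rpow_le (neg_pos.2 hβ)
    refine ⟨C, hC, fun s r hs0 hs hr0 hr => ?_⟩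
    have h1 := h r s hr0 hr hs0 hs
    rw [ratio_comm] at h1
    have hs' : 0 < Real.log (2 / (1 - s)) := (Real.log_pos one_lt_two).trans_le (log_two_le hs0 hs)
    have hr' : 0 < Real.log (2 / (1 - r)) := (Real.log_pos one_lt_two).trans_le (log_two_le hr0 hr)
    rw [Real.rpow_neg hs'.le, Real.rpow_neg hr'.le] at h1
    have hs2 := Real.rpow_pos_of_pos hs' β
    have hr2 := Real.rpow_pos_of_pos hr' β
    rw [inv_le_iff_one_le_mul₀ hr2] at h1
    calc Real.log (2 / (1 - s)) ^ β = Real.log (2 / (1 - s)) ^ β * 1 := (mul_one _).symm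
      _ ≤ _ := mul_le_mul_of_nonneg_left h1 hs2.le
      _ = _ := by field_simp
  · refine ⟨1, one_pos, fun s r _ hs _ hr => ?_⟩
    simpa using one_le_ratio (sub_pos.2 hs) (sub_pos.2 hr)
  · exact exists_log_rpow_le hβ

theorem loglog_four_le {r : ℝ} (hr0 : 0 ≤ r) (hr : r < 1) :
    Real.log (Real.log 4) ≤ loglogWeight r :=
  Real.log_le_log (zero_lt_one.trans one_lt_log_four) (log_four_le hr0 hr)

/-- From log t ≤ t - 1 and log(4/(1 - r)) > 1, the weight changes by at most 2q. Being bounded below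
by log log 4 > 0, it absorbs this additive error as a factor. -/
theorem isSlow_loglogWeight : IsSlow loglogWeight := by
  have hc : 0 < Real.log (Real.log 4) := Real.log_pos one_lt_log_four
  set c := Real.log (Real.log 4)
  refine ⟨1 + 2 / c, by positivity, fun s r hs0 hs hr0 hr => ?_⟩
  have hx : 0 < 1 - s := by linarith
  have hy : 0 < 1 - r := by linarith
  have hq := one_le_ratio hx hy
  have hlog := log_sub_log_le_ratio hx hy
  set q : ℝ := ((1 - s) + (1 - r)) / √((1 - s) * (1 - r))
  have hw : c ≤ loglogWeight r := loglog_four_le hr0 hr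
  have hM : 1 < Real.log (4 / (1 - r)) := one_lt_log_four.trans_le (log_four_le hr0 hr)
  have hN : 1 < Real.log (4 / (1 - s)) := one_lt_log_four.trans_le (log_four_le hs0 hs)
  have hlq : Real.log q ≤ q := (Real.log_le_sub_one_of_pos (by linarith)).trans (by linarith)
  have h1 : loglogWeight s ≤ loglogWeight r + 2 * q := by
    change Real.log (Real.log (4 / (1 - s))) ≤ Real.log (Real.log (4 / (1 - r))) + 2 * q
    have h2 : Real.log (4 / (1 - s)) ≤ Real.log (4 / (1 - r)) + 2 * q := by
      rw [log_four_div_eq hs, log_four_div_eq hr]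
      linarith
    set M := Real.log (4 / (1 - r))
    have h3 : Real.log (Real.log (4 / (1 - s)) / M) ≤ Real.log (4 / (1 - s)) / M - 1 :=
      Real.log_le_sub_one_of_pos (by positivity)
    rw [Real.log_div (by positivity) (by positivity)] at h3
    have h4 : Real.log (4 / (1 - s)) / M ≤ 1 + 2 * q := by
      rw [div_le_iff₀ (by positivity)]
      nlinarith
    linarith
  have h5 : loglogWeight r ≤ loglogWeight r * q := le_mul_of_one_le_right (hc.le.trans hw) hq
  have h6 : 2 * q ≤ loglogWeight r / c * (2 * q) :=
    le_mul_of_one_le_left (by positivity) ((one_le_div hc).2 hw)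
  calc loglogWeight s ≤ loglogWeight r * q + loglogWeight r / c * (2 * q) := by linarith
    _ = (1 + 2 / c) * loglogWeight r * q := by ring

theorem hasDerivAt_log_div {a s : ℝ} (ha : a ≠ 0) (hs : s < 1) :
    HasDerivAt (fun r : ℝ => Real.log (a / (1 - r))) (1 - s)⁻¹ s := by
  have hx : 1 - s ≠ 0 := by linarith
  have h := (((hasDerivAt_id s).const_sub 1).log hx).const_sub (Real.log a)
  have h' : HasDerivAt (fun r : ℝ => Real.log a - Real.log (1 - r)) (1 - s)⁻¹ s :=
    h.congr_deriv (by simp [neg_div])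
  refine h'.congr_of_eventuallyEq ?_
  filter_upwards [eventually_lt_nhds hs] with r hr
  exact Real.log_div ha (by linarith)

theorem tendsto_log_div {a : ℝ} (ha : 0 < a) :
    Tendsto (fun r : ℝ => Real.log (a / (1 - r))) (𝓝[<] 1) atTop := by
  refine Real.tendsto_log_atTop.comp ?_
  have h : Tendsto (fun r : ℝ => 1 - r) (𝓝[<] 1) (𝓝[>] 0) := by
    refine tendsto_nhdsWithin_iff.2 ⟨?_, ?_⟩
    · have : Tendsto (fun r : ℝ => 1 - r) (𝓝 1) (𝓝 (1 - 1)) := tendsto_const_nhds.sub tendsto_id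
      rw [sub_self] at this
      exact this.mono_left nhdsWithin_le_nhds
    · filter_upwards [self_mem_nhdsWithin] with r hr
      exact sub_pos.2 (Set.mem_Iio.1 hr)
  simpa only [div_eq_mul_inv, Function.comp_def] using
    (tendsto_inv_nhdsGT_zero.comp h).const_mul_atTop ha

/-- The derivative of log^α(2/(1 - s)) is α(1 - s)⁻¹ log^{α-1}(2/(1 - s)), so growth holds with
equality and C = 1/α. Positivity of α also gives the lower bound and unboundedness. -/
theorem cesaroPair_logWeight {α : ℝ} (hα : 0 < α) :
    CesaroPair (logWeight (α - 1)) (logWeight α) where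
  left := isSlow_logWeight _
  right := isSlow_logWeight _
  growth := by
    refine ⟨α⁻¹, inv_pos.2 hα,
      fun s => (1 - s)⁻¹ * α * Real.log (2 / (1 - s)) ^ (α - 1), fun s hs0 hs => ⟨?_, ?_⟩⟩
    · exact (hasDerivAt_log_div two_ne_zero hs).rpow_const
        (Or.inl ((Real.log_pos one_lt_two).trans_le (log_two_le hs0 hs)).ne')
    · refine le_of_eq ?_
      change (1 - s)⁻¹ * Real.log (2 / (1 - s)) ^ (α - 1) = _
      field_simp
  lower := ⟨Real.log 2 ^ α, Real.rpow_pos_of_pos (Real.log_pos one_lt_two) α, fun r hr0 hr =>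
    Real.rpow_le_rpow (Real.log_pos one_lt_two).le (log_two_le hr0 hr) hα.le⟩
  tendsto := (tendsto_rpow_atTop hα).comp (tendsto_log_div two_pos)

/-- The derivative of log log(4/(1 - s)) is (1 - s)⁻¹/log(4/(1 - s)). The constant 2 bridges 4 and
2: log(4/(1 - s)) ≤ 2 log(2/(1 - s)), because log 4 = 2 log 2 and log(1 - s) ≤ 0. -/
theorem cesaroPair_loglogWeight : CesaroPair (logWeight (-1)) loglogWeight where
  left := isSlow_logWeight _
  right := isSlow_loglogWeight
  growth := by
    refine ⟨2, two_pos, fun s => (1 - s)⁻¹ / Real.log (4 / (1 - s)), fun s hs0 hs => ⟨?_, ?_⟩⟩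
    · exact (hasDerivAt_log_div four_ne_zero hs).log
        (zero_lt_one.trans (one_lt_log_four.trans_le (log_four_le hs0 hs))).ne'
    · change (1 - s)⁻¹ * Real.log (2 / (1 - s)) ^ (-1 : ℝ) ≤ _
      have h2 : 0 < Real.log (2 / (1 - s)) :=
        (Real.log_pos one_lt_two).trans_le (log_two_le hs0 hs)
      have h4 : 0 < Real.log (4 / (1 - s)) :=
        zero_lt_one.trans (one_lt_log_four.trans_le (log_four_le hs0 hs))
      have h42 : Real.log (4 / (1 - s)) ≤ 2 * Real.log (2 / (1 - s)) := by
        have h : Real.log 4 = 2 * Real.log 2 := by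
          rw [show (4 : ℝ) = 2 ^ 2 by norm_num, Real.log_pow]
          norm_num
        rw [log_four_div_eq hs, log_two_div_eq hs, h]
        linarith [log_one_sub_nonpos hs0 hs]
      have h : (Real.log (2 / (1 - s)))⁻¹ ≤ 2 / Real.log (4 / (1 - s)) := by
        rw [inv_eq_one_div, div_le_div_iff₀ h2 h4]
        linarith
      rw [Real.rpow_neg_one]
      calc (1 - s)⁻¹ * (Real.log (2 / (1 - s)))⁻¹
          ≤ (1 - s)⁻¹ * (2 / Real.log (4 / (1 - s))) :=
            mul_le_mul_of_nonneg_left h (inv_nonneg.2 (by linarith))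
        _ = 2 * ((1 - s)⁻¹ / Real.log (4 / (1 - s))) := by ring
  lower := ⟨_, Real.log_pos one_lt_log_four, fun _ hr0 hr => loglog_four_le hr0 hr⟩
  tendsto := Real.tendsto_log_atTop.comp (tendsto_log_div four_pos)

end LogBloch

end

theorem mainTheorem9 :
    (∀ α : ℝ, 0 < α →
      LogBloch.AdjointOfLibera (LogBloch.logWeight α) (LogBloch.logWeight (α - 1)) ∧
      LogBloch.AdjointOfCesaro (LogBloch.logWeight (α - 1)) (LogBloch.logWeight α)) ∧
    LogBloch.AdjointOfLibera LogBloch.loglogWeight (LogBloch.logWeight (-1)) ∧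
    LogBloch.AdjointOfCesaro (LogBloch.logWeight (-1)) LogBloch.loglogWeight :=
  ⟨fun _ hα => ⟨(LogBloch.cesaroPair_logWeight hα).adjointOfLibera,
      (LogBloch.cesaroPair_logWeight hα).adjointOfCesaro⟩,
    LogBloch.cesaroPair_loglogWeight.adjointOfLibera,
    LogBloch.cesaroPair_loglogWeight.adjointOfCesaro⟩
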